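/- **Definitions.** A *vocabulary* $\tau$ consists of finitely many relation symbols $R$, each with an arity $\mathrm{ar}(R)\in\mathbb N$. A *$\tau$-structure* $\mathbf A$ consists of a nonempty finite universe $A$ and a relation $R^{\mathbf A}\subseteq A^{\mathrm{ar}(R)}$ for each $R\in\tau$. Since structures serve as inputs of machines, the symbols are taken to be $0,\dots,|\tau|-1$ and the universe to be $\{0,\dots,|A|-1\}$. The size of $\mathbf A$ is $|\mathbf A|=|\tau|+|A|+\sum_{R\in\tau}|R^{\mathbf A}|\cdot\mathrm{ar}(R)$. An *embedding* of $\mathbf A$ into a $\tau$-structure $\mathbf B$ is an injective map $h:A\to B$ with $h(R^{\mathbf A})\subseteq R^{\mathbf B}$ for all $R\in\tau$. Structures are encoded by binary strings in the standard way: the arities and the size of the universe are written in unary, and each relation is a list, in any order and without repetition, of its tuples, whose entries are written in self-delimiting binary. A pair of structures of the same vocabulary is encoded by the codes of the vocabulary, of the first structure, and of the second one. Let $\mathcal A$ be a class of structures, possibly of different vocabularies. It is *decidable* if the set of codes of its members is decidable. It has *bounded arity* if there is $r\in\mathbb N$ such that all symbols in the vocabularies of its members have arity at most $r$. It has *bounded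 treewidth* if there is $w\in\mathbb N$ such that for every $\mathbf A\in\mathcal A$ the Gaifman graph of $\mathbf A$ (vertex set $A$; distinct elements are adjacent iff they occur together in a tuple of a relation of $\mathbf A$) has treewidth at most $w$. A *parameterized problem* $(Q,\kappa)$ consists of a set $Q\subseteq\{0,1\}^*$ and a function $\kappa:\{0,1\}^*\to\mathbb N$ computable in logarithmic space. The problem $p\text{-}\mathrm{EMB}(\mathcal A)$ is the pair $(Q,\kappa)$ where $Q$ is the set of codes of pairs $(\mathbf A,\mathbf B)$ such that $\mathbf A\in\mathcal A$ and there is an embedding of $\mathbf A$ into $\mathbf B$, and where $\kappa(x)=|\mathbf A|$ if $x$ encodes a pair of structures $(\mathbf A,\mathbf B)$, and $\kappa(x)=0$ if $x$ does not encode such a pair. Machines are alternating Turing machines with a read-only input tape and several worktapes, whose only nondeterminism is binary and takes place in one existential and one universal guess state; a configuration in a guess state has two successors, in which only the state has changed. A halting configuration is accepting iff it is in the accepting state; a non-halting configuration is accepting if at least one of its successors is (if both are, in the case of the universal guess state), the accepting configurations being the least set with these properties. A machine *accepts* $Q$ if, for every $x$, the starting configuration on $x$ is accepting iff $x\in Q$.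 The class $\mathrm{TREE}$ contains a parameterized problem $(Q,\kappa)$ if there are a computable $f:\mathbb N\to\mathbb N$ and such a machine $\mathbb M$ that * accepts $Q$; * runs on every input $x\in\{0,1\}^*$ in space $O(g(\kappa(x))+\log|x|)$ for some computable $g:\mathbb N\to\mathbb N$; * in every run on every input $x$ has at most $f(\kappa(x))\cdot\log|x|$ configurations with the existential guess state and at most $f(\kappa(x))$ configurations with the universal guess state. (Here $\log n$ stands for $\lfloor\log_2 n\rfloor$, with $\log 0=0$.) **Theorem.** Let $\mathcal A$ be a decidable class of structures of bounded arity and bounded treewidth. Then $p\text{-}\mathrm{EMB}(\mathcal A)\in\mathrm{TREE}$. -/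

import Mathlib

/-! Finite relational structures -/

/-- A vocabulary: finitely many relation symbols `0, …, num - 1`, each with an arity. -/
structure Vocabulary where
  num : ℕ
  arity : Fin num → ℕ

/-- A finite relational structure over `τ` with (nonempty) universe `Fin card`. -/
structure FinStr (τ : Vocabulary) where
  card : ℕ
  card_pos : 0 < card
  rel : ∀ i : Fin τ.num, Finset (Fin (τ.arity i) → Fin card)

namespace FinStr

variable {τ : Vocabulary}

def IsHom (A B : FinStr τ) (h : Fin A.card → Fin B.card) : Prop :=
  ∀ i, ∀ a ∈ A.rel i, (fun j => h (a j)) ∈ B.rel i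

/-- An embedding is an injective homomorphism (relations need not be reflected). -/
def Embeds (A B : FinStr τ) : Prop :=
  ∃ h : Fin A.card → Fin B.card, A.IsHom B h ∧ Function.Injective h

/-- The size `|τ| + |A| + ∑_R |R^A| · ar(R)`. -/
def size (A : FinStr τ) : ℕ :=
  τ.num + A.card + ∑ i, (A.rel i).card * τ.arity i

/-- The Gaifman graph: distinct elements are adjacent iff they occur together in a tuple. -/
def gaifman (A : FinStr τ) : SimpleGraph (Fin A.card) where
  Adj u v := u ≠ v ∧ ∃ i, ∃ a ∈ A.rel i, (∃ j, a j = u) ∧ ∃ j, a j = v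
  symm := ⟨fun _ _ h => ⟨h.1.symm, by
    obtain ⟨_, i, a, ha, hu, hv⟩ := h
    exact ⟨i, a, ha, hv, hu⟩⟩⟩
  loopless := ⟨fun _ h => h.1 rfl⟩

end FinStr

/-! Treewidth -/

structure TreeDecomposition {V : Type} (G : SimpleGraph V) where
  m : ℕ
  tree : SimpleGraph (Fin m)
  isTree : tree.IsTree
  bag : Fin m → Finset V
  vertex_mem : ∀ v, ∃ t, v ∈ bag t
  edge_mem : ∀ u v, G.Adj u v → ∃ t, u ∈ bag t ∧ v ∈ bag t
  path_mem : ∀ (t t' s : Fin m) (p : tree.Walk t t'), p.IsPath → s ∈ p.support →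
    ∀ v, v ∈ bag t → v ∈ bag t' → v ∈ bag s

/-- The maximal size of a bag, minus one. -/
def TreeDecomposition.width {V : Type} {G : SimpleGraph V} (D : TreeDecomposition G) : ℕ :=
  Finset.univ.sup (fun t => (D.bag t).card) - 1

/-- The minimum width of a tree decomposition. -/
noncomputable def treewidth {V : Type} (G : SimpleGraph V) : ℕ :=
  sInf (Set.range fun D : TreeDecomposition G => D.width)

/-- A class of finite structures (the vocabulary may vary with the structure). -/
abbrev StrClass := Set (Σ τ : Vocabulary, FinStr τ)

def StrClass.BoundedArity (𝒜 : StrClass) : Prop :=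
  ∃ r : ℕ, ∀ A ∈ 𝒜, ∀ i, A.1.arity i ≤ r

def StrClass.BoundedTreewidth (𝒜 : StrClass) : Prop :=
  ∃ w : ℕ, ∀ A ∈ 𝒜, treewidth A.2.gaifman ≤ w

/-! Encoding structures by binary strings -/

def encUnary (n : ℕ) : List Bool := List.replicate n true ++ [false]

/-- Self-delimiting binary code: every bit `b` becomes `1b`, and `0` terminates. -/
def encBinary (n : ℕ) : List Bool := n.bits.flatMap (fun b => [true, b]) ++ [false]

/-- The number of symbols, then all arities, in unary. -/
def encVocabulary (τ : Vocabulary) : List Bool :=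
  encUnary τ.num ++ (List.finRange τ.num).flatMap fun i => encUnary (τ.arity i)

def encTuple {k n : ℕ} (t : Fin k → Fin n) : List Bool :=
  (List.finRange k).flatMap fun j => encBinary (t j)

/-- A list of tuples; every tuple is preceded by `1`, and `0` terminates the list. -/
def encTuples {k n : ℕ} (l : List (Fin k → Fin n)) : List Bool :=
  l.flatMap (fun t => true :: encTuple t) ++ [false]

/-- `x` encodes `A` (its vocabulary being known): the size of the universe in unary, then for each
relation its tuples, listed in some order without repetition. -/
def FinStr.CodedBy {τ : Vocabulary} (A : FinStr τ) (x : List Bool) : Prop :=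
  ∃ l : ∀ i, List (Fin (τ.arity i) → Fin A.card),
    (∀ i, (l i).Nodup ∧ ∀ t, t ∈ l i ↔ t ∈ A.rel i) ∧
    x = encUnary A.card ++ (List.finRange τ.num).flatMap fun i => encTuples (l i)

/-- `x` encodes the structure `A` together with its vocabulary. -/
def StrCode (τ : Vocabulary) (A : FinStr τ) (x : List Bool) : Prop :=
  ∃ a, A.CodedBy a ∧ x = encVocabulary τ ++ a

/-- `x` encodes the pair of structures `(A, B)` of the same vocabulary. -/
def PairCode (τ : Vocabulary) (A B : FinStr τ) (x : List Bool) : Prop :=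
  ∃ a b, A.CodedBy a ∧ B.CodedBy b ∧ x = encVocabulary τ ++ a ++ b

/-- The class is decidable: the set of codes of its members is. -/
def StrClass.IsDecidable (𝒜 : StrClass) : Prop :=
  ComputablePred fun x : List Bool => ∃ (τ : Vocabulary) (A : FinStr τ), ⟨τ, A⟩ ∈ 𝒜 ∧ StrCode τ A x

/-! Codes determine what they encode -/

theorem encUnary_inj {m n : ℕ} {r s : List Bool} (h : encUnary m ++ r = encUnary n ++ s) :
    m = n ∧ r = s := by
  induction m generalizing n with
  | zero => cases n <;> simp_all [encUnary, List.replicate_succ]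
  | succ m ih =>
    cases n with
    | zero => simp [encUnary, List.replicate_succ] at h
    | succ n =>
      have := @ih n (by simpa [encUnary, List.replicate_succ] using h)
      simpa using this

theorem encBits_inj {l m : List Bool} {r s : List Bool}
    (h : l.flatMap (fun b => [true, b]) ++ false :: r
      = m.flatMap (fun b => [true, b]) ++ false :: s) : l = m ∧ r = s := by
  induction l generalizing m with
  | nil => cases m <;> simp_all
  | cons a l ih =>
    cases m with
    | nil => simp at h
    | cons b m =>
      simp only [List.flatMap_cons, List.cons_append, List.nil_append, List.cons.injEq,
        true_and] at h
      obtain ⟨h1, h2⟩ := ih h.2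
      exact ⟨by rw [h.1, h1], h2⟩

theorem encBinary_inj {m n : ℕ} {r s : List Bool} (h : encBinary m ++ r = encBinary n ++ s) :
    m = n ∧ r = s := by
  obtain ⟨h1, h2⟩ := encBits_inj (l := m.bits) (m := n.bits) (r := r) (s := s)
    (by simpa [encBinary] using h)
  refine ⟨?_, h2⟩
  have := congrArg (fun l : List Bool => l.foldr Nat.bit 0) h1
  have key : ∀ k : ℕ, (k.bits).foldr Nat.bit 0 = k := by
    intro k
    induction k using Nat.binaryRec' with
    | zero => simp
    | bit b k hb ih => rw [Nat.bits_append_bit _ _ hb]; simp [ih]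
  simpa [key] using this

theorem flatMap_inj {ι β : Type} (L : List ι) (f g : ι → β) (e : ι → β → List Bool)
    (he : ∀ i a b r s, e i a ++ r = e i b ++ s → a = b ∧ r = s) {r s : List Bool}
    (h : (L.flatMap fun i => e i (f i)) ++ r = (L.flatMap fun i => e i (g i)) ++ s) :
    (∀ i ∈ L, f i = g i) ∧ r = s := by
  induction L with
  | nil => simpa using h
  | cons a L ih =>
    simp only [List.flatMap_cons, List.append_assoc] at h
    obtain ⟨h1, h2⟩ := he _ _ _ _ _ h
    obtain ⟨h3, h4⟩ := ih h2
    exact ⟨by simpa [h1] using h3, h4⟩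

theorem encVocabulary_inj {τ σ : Vocabulary} {r s : List Bool}
    (h : encVocabulary τ ++ r = encVocabulary σ ++ s) : τ = σ ∧ r = s := by
  obtain ⟨m, a⟩ := τ
  obtain ⟨n, b⟩ := σ
  simp only [encVocabulary, List.append_assoc] at h
  obtain ⟨h1, h2⟩ := encUnary_inj h
  subst h1
  obtain ⟨h3, h4⟩ := flatMap_inj _ a b (fun _ n => encUnary n)
    (fun _ _ _ _ _ => encUnary_inj) h2
  exact ⟨by congr; funext i; exact h3 i (List.mem_finRange i), h4⟩

theorem encTuple_inj {k n : ℕ} {t u : Fin k → Fin n} {r s : List Bool}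
    (h : encTuple t ++ r = encTuple u ++ s) : t = u ∧ r = s := by
  obtain ⟨h1, h2⟩ := flatMap_inj (List.finRange k) t u (fun _ (v : Fin n) => encBinary v)
    (fun _ a b _ _ h => by
      obtain ⟨h1, h2⟩ := encBinary_inj h
      exact ⟨Fin.ext h1, h2⟩) h
  exact ⟨funext fun i => h1 i (List.mem_finRange i), h2⟩

theorem encTuples_inj {k n : ℕ} {l m : List (Fin k → Fin n)} {r s : List Bool}
    (h : encTuples l ++ r = encTuples m ++ s) : l = m ∧ r = s := by
  induction l generalizing m with
  | nil => cases m <;> simp_all [encTuples]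
  | cons a l ih =>
    cases m with
    | nil => simp [encTuples] at h
    | cons b m =>
      simp only [encTuples, List.flatMap_cons, List.cons_append, List.append_assoc,
        List.cons.injEq, true_and] at h
      obtain ⟨h1, h2⟩ := encTuple_inj h
      obtain ⟨h3, h4⟩ := @ih m (by simpa [encTuples] using h2)
      exact ⟨by rw [h1, h3], h4⟩

theorem FinStr.codedBy_inj {τ : Vocabulary} {A B : FinStr τ} {x y r s : List Bool}
    (hA : A.CodedBy x) (hB : B.CodedBy y) (h : x ++ r = y ++ s) : A = B ∧ r = s := by
  obtain ⟨l, hl, rfl⟩ := hA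
  obtain ⟨m, hm, rfl⟩ := hB
  obtain ⟨n, hn, A⟩ := A
  obtain ⟨n', hn', B⟩ := B
  simp only [List.append_assoc] at h hl hm
  obtain ⟨h1, h2⟩ := encUnary_inj h
  subst h1
  have key : ∀ L : List (Fin τ.num), (L.flatMap fun i => encTuples (l i)) ++ r
      = (L.flatMap fun i => encTuples (m i)) ++ s → (∀ i ∈ L, l i = m i) ∧ r = s := by
    intro L h
    induction L with
    | nil => simpa using h
    | cons a L ih =>
      simp only [List.flatMap_cons, List.append_assoc] at h
      obtain ⟨h1, h2⟩ := encTuples_inj h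
      obtain ⟨h3, h4⟩ := ih h2
      exact ⟨by simpa [h1] using h3, h4⟩
  obtain ⟨h3, h4⟩ := key _ h2
  refine ⟨?_, h4⟩
  congr
  funext i
  ext t
  rw [← (hl i).2, ← (hm i).2, h3 i (List.mem_finRange i)]

theorem StrCode.inj {τ σ : Vocabulary} {A : FinStr τ} {B : FinStr σ} {x : List Bool}
    (hA : StrCode τ A x) (hB : StrCode σ B x) : (⟨τ, A⟩ : Σ τ, FinStr τ) = ⟨σ, B⟩ := by
  obtain ⟨a, ha, rfl⟩ := hA
  obtain ⟨b, hb, h⟩ := hB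
  obtain ⟨rfl, h1⟩ := encVocabulary_inj h
  obtain ⟨rfl, -⟩ := FinStr.codedBy_inj (r := []) (s := []) ha hb (by simpa using h1)
  rfl

theorem PairCode.inj {τ σ : Vocabulary} {A B : FinStr τ} {A' B' : FinStr σ} {x : List Bool}
    (h : PairCode τ A B x) (h' : PairCode σ A' B' x) :
    (⟨τ, A, B⟩ : Σ τ, FinStr τ × FinStr τ) = ⟨σ, A', B'⟩ := by
  obtain ⟨a, b, ha, hb, rfl⟩ := h
  obtain ⟨a', b', ha', hb', h⟩ := h'
  simp only [List.append_assoc] at h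
  obtain ⟨rfl, h1⟩ := encVocabulary_inj h
  obtain ⟨rfl, h2⟩ := FinStr.codedBy_inj ha ha' h1
  obtain ⟨rfl, -⟩ := FinStr.codedBy_inj (r := []) (s := []) hb hb' (by simpa using h2)
  rfl

/-! The embedding problem -/

/-- The yes-instances of the embedding problem of the class `𝒜`. -/
def embProblem (𝒜 : StrClass) : Set (List Bool) :=
  {x | ∃ (τ : Vocabulary) (A B : FinStr τ), PairCode τ A B x ∧ ⟨τ, A⟩ ∈ 𝒜 ∧ A.Embeds B}

open Classical in
/-- The parameter: `|A|` on codes of pairs `(A, B)` (see `embParam_eq`), and `0` on all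
other strings. -/
noncomputable def embParam (x : List Bool) : ℕ :=
  if h : ∃ p : Σ τ : Vocabulary, FinStr τ × FinStr τ, PairCode p.1 p.2.1 p.2.2 x
  then h.choose.2.1.size else 0

theorem embParam_eq {τ : Vocabulary} {A B : FinStr τ} {x : List Bool} (h : PairCode τ A B x) :
    embParam x = A.size := by
  have hx : ∃ p : Σ τ : Vocabulary, FinStr τ × FinStr τ, PairCode p.1 p.2.1 p.2.2 x :=
    ⟨⟨τ, A, B⟩, h⟩
  have e : hx.choose = ⟨τ, A, B⟩ := PairCode.inj hx.choose_spec h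
  rw [embParam, dif_pos hx, e]

/-! Turing machines with a read-only input tape and several worktapes -/

inductive HeadMove
  | left | stay | right

/-- Contents of the `k` worktapes (one-way infinite, with cells `0, 1, 2, …`), positions of their
heads, and position of the input head. The input `x` occupies the cells `1, …, |x|` of the input
tape; the cells `0` and `|x| + 1` are blank, and the input head never leaves `0, …, |x| + 1`. -/
structure Tapes (k : ℕ) (Γ : Type) where
  inHead : ℕ
  work : Fin k → ℕ → Γ
  head : Fin k → ℕ

/-- What a machine does in a step: a move of the input head, and for each worktape a symbol to
write and a move. -/
structure TapeAction (k : ℕ) (Γ : Type) where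
  inMove : HeadMove
  write : Fin k → Γ
  move : Fin k → HeadMove

namespace Tapes

variable {k : ℕ} {Γ : Type}

/-- Input head on the first input cell, worktapes blank. -/
def init (k : ℕ) (blank : Γ) : Tapes k Γ where
  inHead := 1
  work _ _ := blank
  head _ := 0

/-- The scanned input bit; `none` if a blank is scanned. -/
def inSym (x : List Bool) (T : Tapes k Γ) : Option Bool :=
  if T.inHead = 0 then none else x[T.inHead - 1]?

def scanned (T : Tapes k Γ) : Fin k → Γ := fun i => T.work i (T.head i)

def act (x : List Bool) (T : Tapes k Γ) (a : TapeAction k Γ) : Tapes k Γ where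
  inHead := match a.inMove with
    | .left => T.inHead - 1
    | .stay => T.inHead
    | .right => min (T.inHead + 1) (x.length + 1)
  work i := Function.update (T.work i) (T.head i) (a.write i)
  head i := match a.move i with
    | .left => T.head i - 1
    | .stay => T.head i
    | .right => T.head i + 1

end Tapes

/-- The states of an alternating machine with ordinary states `S`: the existential and the
universal guess state, two halting states, and the ordinary ones. -/
inductive AState (S : Type)
  | existsGuess
  | forallGuess
  | accept
  | reject
  | normal (s : S)

def AState.isExists {S : Type} : AState S → Bool
  | .existsGuess => true
  | _ => false

def AState.isForall {S : Type} : AState S → Bool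
  | .forallGuess => true
  | _ => false

/-- An alternating Turing machine. From the existential (universal) guess state it goes to one of
the two states `existsNext b` (respectively `forallNext b`), changing nothing else. -/
structure AltTM where
  k : ℕ
  Γ : Type
  finΓ : Finite Γ
  blank : Γ
  S : Type
  finS : Finite S
  start : S
  existsNext : Bool → S
  forallNext : Bool → S
  δ : S → Option Bool → (Fin k → Γ) → AState S × TapeAction k Γ

namespace AltTM

structure Cfg (M : AltTM) where
  state : AState M.S
  tapes : Tapes M.k M.Γ

def init (M : AltTM) : M.Cfg := ⟨.normal M.start, Tapes.init M.k M.blank⟩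

/-- `M.Step x c c'`: on input `x`, `c'` is a successor configuration of `c`. -/
inductive Step (M : AltTM) (x : List Bool) : M.Cfg → M.Cfg → Prop
  | normal (s : M.S) (T : Tapes M.k M.Γ) :
      Step M x ⟨.normal s, T⟩
        ⟨(M.δ s (T.inSym x) T.scanned).1, T.act x (M.δ s (T.inSym x) T.scanned).2⟩
  | existsGuess (b : Bool) (T : Tapes M.k M.Γ) :
      Step M x ⟨.existsGuess, T⟩ ⟨.normal (M.existsNext b), T⟩
  | forallGuess (b : Bool) (T : Tapes M.k M.Γ) :
      Step M x ⟨.forallGuess, T⟩ ⟨.normal (M.forallNext b), T⟩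

inductive AcceptingCfg (M : AltTM) (x : List Bool) : M.Cfg → Prop
  | halt (c : M.Cfg) : c.state = .accept → AcceptingCfg M x c
  | some (c c' : M.Cfg) : c.state ≠ .forallGuess → M.Step x c c' → AcceptingCfg M x c' →
      AcceptingCfg M x c
  | all (c : M.Cfg) : c.state = .forallGuess → (∀ c', M.Step x c c' → AcceptingCfg M x c') →
      AcceptingCfg M x c

/-- `M` accepts the problem `Q`. -/
def Accepts (M : AltTM) (Q : Set (List Bool)) : Prop :=
  ∀ x, M.AcceptingCfg x M.init ↔ x ∈ Q

/-- (Finite initial parts of) runs of `M` on `x`. -/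
def IsRun (M : AltTM) (x : List Bool) (l : List M.Cfg) : Prop :=
  l.head? = some M.init ∧ l.IsChain (M.Step x)

/-- No run on `x` visits a cell with number `≥ s` of a worktape. -/
def SpaceLE (M : AltTM) (x : List Bool) (s : ℕ) : Prop :=
  ∀ l, M.IsRun x l → ∀ c ∈ l, ∀ i, c.tapes.head i < s

/-- `M` is parameterized-logspace bounded with respect to `κ`. -/
def PlSpaceBounded (M : AltTM) (κ : List Bool → ℕ) : Prop :=
  ∃ f : ℕ → ℕ, Computable f ∧ ∃ C : ℕ, ∀ x, M.SpaceLE x (C * (f (κ x) + Nat.log 2 x.length))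

/-- Every run on every input `x` has at most `g x` configurations with the existential guess
state. -/
def UsesNondetBits (M : AltTM) (g : List Bool → ℕ) : Prop :=
  ∀ x l, M.IsRun x l → l.countP (fun c => c.state.isExists) ≤ g x

/-- Every run on every input `x` has at most `g x` configurations with the universal guess
state. -/
def UsesCoNondetBits (M : AltTM) (g : List Bool → ℕ) : Prop :=
  ∀ x l, M.IsRun x l → l.countP (fun c => c.state.isForall) ≤ g x

end AltTM

/-- A deterministic Turing machine with an additional write-only output tape; in each step it
may append a bit to the output, and it halts where `δ` is `none`. -/
structure Transducer where
  k : ℕ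
  Γ : Type
  finΓ : Finite Γ
  blank : Γ
  S : Type
  finS : Finite S
  start : S
  δ : S → Option Bool → (Fin k → Γ) → Option (S × TapeAction k Γ × Option Bool)

namespace Transducer

structure Cfg (M : Transducer) where
  state : M.S
  tapes : Tapes M.k M.Γ
  output : List Bool

def init (M : Transducer) : M.Cfg := ⟨M.start, Tapes.init M.k M.blank, []⟩

def step (M : Transducer) (x : List Bool) (c : M.Cfg) : Option M.Cfg :=
  (M.δ c.state (c.tapes.inSym x) c.tapes.scanned).map fun r =>
    ⟨r.1, c.tapes.act x r.2.1, c.output ++ r.2.2.toList⟩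

def Reaches (M : Transducer) (x : List Bool) : M.Cfg → M.Cfg → Prop :=
  Relation.ReflTransGen fun c c' => M.step x c = some c'

/-- On every input `x`, `M` halts with output `F x`. -/
def Computes (M : Transducer) (F : List Bool → List Bool) : Prop :=
  ∀ x, ∃ c, M.Reaches x M.init c ∧ M.step x c = none ∧ c.output = F x

def LogspaceBounded (M : Transducer) : Prop :=
  ∃ C : ℕ, ∀ x c, M.Reaches x M.init c → ∀ i, c.tapes.head i < C * (Nat.log 2 x.length + 1)

end Transducer

/-- `κ` is a parameterization: its value, in binary, is computable in logarithmic space. -/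
def IsParameterization (κ : List Bool → ℕ) : Prop :=
  ∃ M : Transducer, M.LogspaceBounded ∧ M.Computes fun x => (κ x).bits

/-- The class TREE of parameterized problems `(Q, κ)`. -/
def TREE : Set (Set (List Bool) × (List Bool → ℕ)) :=
  {P | IsParameterization P.2 ∧
    ∃ f : ℕ → ℕ, Computable f ∧ ∃ M : AltTM,
      M.Accepts P.1 ∧ M.PlSpaceBounded P.2 ∧
      M.UsesNondetBits (fun x => f (P.2 x) * Nat.log 2 x.length) ∧
      M.UsesCoNondetBits (fun x => f (P.2 x))}

/-! The proof has two halves: a game in which embeddings are verified with few guesses, and the fact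
that the machines defining `TREE` can play such games.

The game. Let k be the parameter and L = log |x|. The existential player claims an embedding h of A
into B. Writing down all of h takes about k·L bits, more than the space O(g(k) + L) allows, so h is
revealed piecewise. A position consists of the set C of elements still to be treated and a partial
map H on at most w + 1 remembered elements. In a round the existential player either splits C into
two parts that no tuple connects, and the universal player selects one of them, or moves an element
v of C into the domain of H, naming its image and possibly forgetting elements that share no tuple
with C. In every position the tuples inside the domain of H must be mapped to tuples.
`TreeDecomposition.elim` says that treewidth w permits such play: the element whose topmost bag is
highest comes next, and the elements that are not below this bag are split off. Each round shrinks
C, so about k rounds suffice, each with one universal bit and O(g(k) + L) existential bits.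

Injectivity is the obstacle, since images chosen in different branches, or forgotten ones, are never
compared. Therefore the first round fixes a table that gives for each pair u < v of elements of A a
bit position and the bit that h(u) has there and h(v) has not. Every image is then checked against
the table on its own. The table is a number below (2(L+1))^(k²), and a fixed power of the logarithm
is bounded by a function of the exponent times |x| (`mul_pow_le_two_pow`), so O(g(k) + L) bits
describe it. Soundness glues the maps obtained in the branches (`EmbGame.exists_extends`,
`EmbGame.isEmb_of_wins`); completeness plays according to h and an elimination order
(`EmbGame.wins_of_elim`, `EmbGame.exists_table`).

The machine. Programs over counters with a read-only input are compiled to Turing machines keeping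
each counter in binary on a worktape (`Prog.Exec.compile`). Values polynomial in |x|, up to a
computable function of the parameter, then need space O(g(k) + L). The functions with such programs
are closed under composition, pairing, primitive recursion with bounded values, bounded quantifiers
and search (`LogFun`, `PL`), which covers decoding the input and all conditions of the game. By
`Computable.imp` every total computable function may be applied to values bounded in terms of the
parameter; as bounded arity bounds the code of A in terms of k, membership in the decidable class
can be checked (`PL.mem_class`). Finally a game is run by iterating one program on configuration
numbers, with a guessed bit added to the number in each step (`Play.altTM`, `RoundGame.mem_tree`).
-/

/-! Counter programs -/

/-- Elementary operations on a counter. -/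
inductive COp
  | inc | dec | test

/-- While programs over counters and a head on a read-only input. Every program returns a bit. -/
inductive Prog
  | op (o : COp) (r : ℕ)
  | sym (c : Option Bool)
  | left
  | right
  | seq (P Q : Prog)
  | ite (T P Q : Prog)
  | loop (T P : Prog)

/-- The state of a counter program. -/
structure CState where
  head : ℕ
  reg : ℕ → ℕ

namespace CState

def set (σ : CState) (r v : ℕ) : CState := ⟨σ.head, Function.update σ.reg r v⟩

@[simp] theorem set_head (σ : CState) (r v : ℕ) : (σ.set r v).head = σ.head := rfl

@[simp] theorem set_reg (σ : CState) (r v q : ℕ) :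
    (σ.set r v).reg q = if q = r then v else σ.reg q := by
  simp [set, Function.update_apply]

theorem ext' {σ ρ : CState} (h : σ.head = ρ.head) (h' : ∀ r, σ.reg r = ρ.reg r) : σ = ρ := by
  cases σ; cases ρ; simp only [CState.mk.injEq]; exact ⟨h, funext h'⟩

end CState

def symAt (x : List Bool) (p : ℕ) : Option Bool := if p = 0 then none else x[p - 1]?

namespace Prog

/-- All counters used by the program have numbers below `n`. -/
def Below (n : ℕ) : Prog → Prop
  | op _ r => r < n
  | sym _ | left | right => True
  | seq P Q => P.Below n ∧ Q.Below n
  | ite T P Q => T.Below n ∧ P.Below n ∧ Q.Below n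
  | loop T P => T.Below n ∧ P.Below n

theorem Below.mono {n m : ℕ} (h : n ≤ m) : ∀ {P : Prog}, P.Below n → P.Below m
  | op _ _, hP => lt_of_lt_of_le hP h
  | sym _, _ | left, _ | right, _ => trivial
  | seq _ _, hP => ⟨hP.1.mono h, hP.2.mono h⟩
  | ite _ _ _, hP => ⟨hP.1.mono h, hP.2.1.mono h, hP.2.2.mono h⟩
  | loop _ _, hP => ⟨hP.1.mono h, hP.2.mono h⟩

/-- `P.Exec x B σ b σ'`: on input `x`, from `σ` the program ends in `σ'` with result `b`, and every
value written by an increment is at most `B`. -/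
inductive Exec (x : List Bool) (B : ℕ) : Prog → CState → Bool → CState → Prop
  | inc {r σ} : σ.reg r + 1 ≤ B → Exec x B (op .inc r) σ true (σ.set r (σ.reg r + 1))
  | dec {r σ} : σ.reg r ≠ 0 → Exec x B (op .dec r) σ true (σ.set r (σ.reg r - 1))
  | test {r σ} : Exec x B (op .test r) σ (decide (σ.reg r ≠ 0)) σ
  | sym {c σ} : Exec x B (sym c) σ (decide (symAt x σ.head = c)) σ
  | left {σ} : Exec x B left σ true ⟨σ.head - 1, σ.reg⟩
  | right {σ} : Exec x B right σ true ⟨min (σ.head + 1) (x.length + 1), σ.reg⟩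
  | seq {P Q σ b ρ b' τ} : Exec x B P σ b ρ → Exec x B Q ρ b' τ → Exec x B (seq P Q) σ b' τ
  | iteT {T P Q σ ρ b τ} : Exec x B T σ true ρ → Exec x B P ρ b τ → Exec x B (ite T P Q) σ b τ
  | iteF {T P Q σ ρ b τ} : Exec x B T σ false ρ → Exec x B Q ρ b τ → Exec x B (ite T P Q) σ b τ
  | done {T P σ ρ} : Exec x B T σ false ρ → Exec x B (loop T P) σ false ρ
  | step {T P σ ρ b τ b' υ} : Exec x B T σ true ρ → Exec x B P ρ b τ →
      Exec x B (loop T P) τ b' υ → Exec x B (loop T P) σ b' υ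

/-- Only increments raise a counter, and each of them is checked against `B`. This yields bounds on
computed values for free from bounds on the space. -/
theorem Exec.reg_le {x : List Bool} {B : ℕ} {P : Prog} {σ σ' : CState} {b : Bool}
    (h : P.Exec x B σ b σ') (r : ℕ) : σ'.reg r ≤ max B (σ.reg r) := by
  induction h with
  | inc h => rw [CState.set_reg]; split_ifs with e <;> simp_all
  | dec h => rw [CState.set_reg]; split_ifs with e
             · subst e; omega
             · simp
  | test | sym | left | right => simp
  | seq _ _ h1 h2 | iteT _ _ h1 h2 | iteF _ _ h1 h2 => omega
  | done _ h => exact h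
  | step _ _ _ h1 h2 h3 => omega

end Prog

/-! Deterministic fragments of Turing machines -/

/-- Worktape symbols: blank, the end marker, and bits. -/
abbrev TSym := Option (Option Bool)

structure Frag (k : ℕ) (ε : Type) where
  L : Type
  fin : Finite L
  entry : L
  δ : L → Option Bool → (Fin k → TSym) → (L ⊕ ε) × TapeAction k TSym

namespace Frag

variable {k : ℕ} {ε ε' : Type}

/-- From location `l` the fragment leaves through `e`, and before every step all heads on
worktapes are on cells below `s`. -/
inductive Run (F : Frag k ε) (x : List Bool) (s : ℕ) :
    F.L → Tapes k TSym → ε → Tapes k TSym → Prop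
  | last {l T e a} : (∀ i, T.head i < s) → F.δ l (T.inSym x) T.scanned = (.inr e, a) →
      Run F x s l T e (T.act x a)
  | step {l T l' a e T'} : (∀ i, T.head i < s) → F.δ l (T.inSym x) T.scanned = (.inl l', a) →
      Run F x s l' (T.act x a) e T' → Run F x s l T e T'

/-- The exit of `F` is remembered as the index of the copy of `G` that is entered; this is how a
program branches on a returned bit. -/
def bind (F : Frag k ε) (G : ε → Frag k ε') [Finite ε] : Frag k ε' where
  L := F.L ⊕ Σ e, (G e).L
  fin := by
    have := F.fin
    have := fun e => (G e).fin
    infer_instance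
  entry := .inl F.entry
  δ l o w := match l with
    | .inl l => match F.δ l o w with
      | (.inl l', a) => (.inl (.inl l'), a)
      | (.inr e, a) => (.inl (.inr ⟨e, (G e).entry⟩), a)
    | .inr ⟨e, l⟩ => match (G e).δ l o w with
      | (.inl l', a) => (.inl (.inr ⟨e, l'⟩), a)
      | (.inr e', a) => (.inr e', a)

theorem Run.bind [Finite ε] {F : Frag k ε} {G : ε → Frag k ε'} {x : List Bool} {s : ℕ}
    {l : F.L} {T T' T'' : Tapes k TSym} {e : ε} {e' : ε'} (h : F.Run x s l T e T')
    (h' : (G e).Run x s (G e).entry T' e' T'') : (F.bind G).Run x s (.inl l) T e' T'' := by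
  have key : ∀ l T, (G e).Run x s l T e' T'' → (F.bind G).Run x s (.inr ⟨e, l⟩) T e' T'' := by
    intro l T h
    induction h with
    | last h1 h2 => exact .last h1 (by simp [Frag.bind, h2])
    | step h1 h2 _ ih => exact .step h1 (by simp only [Frag.bind, h2]) (ih h')
  induction h with
  | last h1 h2 => exact .step h1 (by simp only [Frag.bind, h2]) (key _ _ h')
  | step h1 h2 _ ih => exact .step h1 (by simp only [Frag.bind, h2]) (ih h' key)

def map (F : Frag k ε) (g : ε → ε') : Frag k ε' where
  L := F.L
  fin := F.fin
  entry := F.entry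
  δ l o w := match F.δ l o w with
    | (.inl l', a) => (.inl l', a)
    | (.inr e, a) => (.inr (g e), a)

theorem Run.map {F : Frag k ε} (g : ε → ε') {x : List Bool} {s : ℕ} {l : F.L}
    {T T' : Tapes k TSym} {e : ε} (h : F.Run x s l T e T') :
    (F.map g).Run x s l T (g e) T' := by
  induction h with
  | last h1 h2 => exact .last h1 (by simp [Frag.map, h2])
  | step h1 h2 _ ih => exact .step h1 (by simp only [Frag.map, h2]) ih

/-- `F` is the test and `G` the body, whose result is ignored. The only exit is the exit `false` of
the test. -/
def loop (F G : Frag k Bool) : Frag k Bool where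
  L := F.L ⊕ G.L
  fin := by
    have := F.fin
    have := G.fin
    infer_instance
  entry := .inl F.entry
  δ l o w := match l with
    | .inl l => match F.δ l o w with
      | (.inl l', a) => (.inl (.inl l'), a)
      | (.inr true, a) => (.inl (.inr G.entry), a)
      | (.inr false, a) => (.inr false, a)
    | .inr l => match G.δ l o w with
      | (.inl l', a) => (.inl (.inr l'), a)
      | (.inr _, a) => (.inl (.inl F.entry), a)

theorem Run.loop_done {F : Frag k Bool} (G : Frag k Bool) {x : List Bool} {s : ℕ} {l : F.L}
    {T T' : Tapes k TSym} (h : F.Run x s l T false T') :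
    (F.loop G).Run x s (.inl l) T false T' := by
  generalize he : false = e at h
  induction h with
  | last h1 h2 => subst he; exact .last h1 (by simp [Frag.loop, h2])
  | step h1 h2 _ ih => exact .step h1 (by simp only [Frag.loop, h2]) (ih he)

theorem Run.loop_step {F G : Frag k Bool} {x : List Bool} {s : ℕ} {l : F.L}
    {T T' T'' T''' : Tapes k TSym} {b b' : Bool} (h : F.Run x s l T true T')
    (h' : G.Run x s G.entry T' b T'')
    (h'' : (F.loop G).Run x s (F.loop G).entry T'' b' T''') :
    (F.loop G).Run x s (.inl l) T b' T''' := by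
  have key : ∀ l T, G.Run x s l T b T'' → (F.loop G).Run x s (.inr l) T b' T''' := by
    intro l T h
    induction h with
    | last h1 h2 => exact .step h1 (by simp only [Frag.loop, h2]) h''
    | step h1 h2 _ ih => exact .step h1 (by simp only [Frag.loop, h2]) (ih h' h'')
  generalize he : true = e at h
  induction h with
  | last h1 h2 => subst he; exact .step h1 (by simp only [Frag.loop, h2]) (key _ _ h')
  | step h1 h2 _ ih => exact .step h1 (by simp only [Frag.loop, h2]) (ih h' he)

/-- A single step without effect on worktapes. -/
def move (m : HeadMove) (res : Option Bool → Bool) : Frag k Bool where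
  L := Unit
  fin := inferInstance
  entry := ()
  δ _ o w := (.inr (res o), ⟨m, w, fun _ => .stay⟩)

end Frag

/-! Counters on worktapes -/

/-- The least significant bit comes first. High-order zeros are permitted, because a decrement does
not shorten the list; hence the length of a counter is not determined by its value. -/
def bitsVal : List Bool → ℕ
  | [] => 0
  | b :: l => b.toNat + 2 * bitsVal l

/-- The contents of a tape that holds an end marker followed by `l`. -/
def tapeOf (l : List Bool) : ℕ → TSym
  | 0 => some none
  | i + 1 => l[i]?.map some

theorem tapeOf_update_append (pre l : List Bool) (a b : Bool) :
    Function.update (tapeOf (pre ++ a :: l)) (pre.length + 1) (some (some b))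
      = tapeOf (pre ++ b :: l) := by
  funext i
  cases i with
  | zero => simp [tapeOf]
  | succ i =>
    simp only [Function.update_apply, tapeOf, Nat.add_right_cancel_iff]
    split_ifs with h
    · simp [h]
    · rcases lt_or_gt_of_ne h with h | h
      · simp [List.getElem?_append_left h]
      · rw [List.getElem?_append_right h.le, List.getElem?_append_right h.le]
        obtain ⟨d, hd⟩ : ∃ d, i - pre.length = d + 1 := ⟨i - pre.length - 1, by omega⟩
        simp [hd]

theorem tapeOf_update_end (pre : List Bool) (b : Bool) :
    Function.update (tapeOf pre) (pre.length + 1) (some (some b)) = tapeOf (pre ++ [b]) := by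
  funext i
  cases i with
  | zero => simp [tapeOf]
  | succ i =>
    simp only [Function.update_apply, tapeOf, Nat.add_right_cancel_iff]
    split_ifs with h
    · simp [h]
    · rcases lt_or_gt_of_ne h with h | h
      · simp [List.getElem?_append_left h]
      · rw [List.getElem?_eq_none (by omega), List.getElem?_eq_none (by simp; omega)]

namespace COp

/-- What is done in the sweep to the right: the symbol to write, and the result if it turns. -/
def go : COp → TSym → TSym × Option Bool
  | _, some none => (some none, none)
  | inc, some (some true) => (some (some false), none)
  | inc, _ => (some (some true), some true)
  | dec, some (some false) => (some (some true), none)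
  | dec, _ => (some (some false), some true)
  | test, some (some false) => (some (some false), none)
  | test, some (some true) => (some (some true), some true)
  | test, none => (none, some false)

/-- The effect of a sweep on the binary representation. -/
def sweep : COp → List Bool → List Bool × Bool
  | inc, [] => ([true], true)
  | inc, true :: l => (false :: (sweep inc l).1, (sweep inc l).2)
  | inc, false :: l => (true :: l, true)
  | dec, [] => ([], true)
  | dec, false :: l => (true :: (sweep dec l).1, (sweep dec l).2)
  | dec, true :: l => (false :: l, true)
  | test, [] => ([], false)
  | test, false :: l => (false :: (sweep test l).1, (sweep test l).2)
  | test, true :: l => (true :: l, true)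

/-- The list grows only if the carry runs through all of it, and then the new value is a power of
two with the old length as exponent. So a bound on the values written bounds the lengths, in spite
of high-order zeros. -/
theorem sweep_inc (l : List Bool) : bitsVal (inc.sweep l).1 = bitsVal l + 1 ∧
    (inc.sweep l).2 = true ∧ ((inc.sweep l).1.length = l.length ∨
      (inc.sweep l).1.length = l.length + 1 ∧ 2 ^ l.length ≤ bitsVal (inc.sweep l).1) := by
  induction l with
  | nil => simp [sweep, bitsVal]
  | cons a l ih =>
    cases a with
    | false => simp [sweep, bitsVal]; omega
    | true =>
      obtain ⟨h1, h2, h3⟩ := ih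
      refine ⟨by simp [sweep, bitsVal, h1]; omega, by simp [sweep, h2], ?_⟩
      simp only [sweep, bitsVal, List.length_cons, pow_succ, Bool.toNat_false]
      omega

theorem sweep_dec (l : List Bool) (h : bitsVal l ≠ 0) :
    bitsVal (dec.sweep l).1 = bitsVal l - 1 ∧ (dec.sweep l).2 = true ∧
      (dec.sweep l).1.length = l.length := by
  induction l with
  | nil => simp [bitsVal] at h
  | cons a l ih =>
    cases a with
    | true => simp [sweep, bitsVal]
    | false =>
      obtain ⟨h1, h2, h3⟩ := ih (by simp [bitsVal] at h; omega)
      refine ⟨?_, by simp [sweep, h2], by simp [sweep, h3]⟩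
      simp only [sweep, bitsVal, h1, Bool.toNat_false, Bool.toNat_true]
      have : bitsVal l ≠ 0 := by simpa [bitsVal] using h
      omega

theorem sweep_test (l : List Bool) :
    test.sweep l = (l, decide (bitsVal l ≠ 0)) := by
  induction l with
  | nil => simp [sweep, bitsVal]
  | cons a l ih =>
    cases a with
    | true => simp [sweep, bitsVal]
    | false => simp [sweep, ih, bitsVal]

/-- The action on the `r`-th worktape. -/
def action {k : ℕ} (r : Fin k) (w : Fin k → TSym) (a : TSym) (m : HeadMove) :
    TapeAction k TSym where
  inMove := .stay
  write i := if i = r then a else w i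
  move i := if i = r then m else .stay

/-- Sweep right over the `r`-th worktape, then return to the marker. -/
def frag {k : ℕ} (o : COp) (r : Fin k) : Frag k Bool where
  L := Option Bool
  fin := inferInstance
  entry := none
  δ l _ w := match l with
    | none => match o.go (w r) with
      | (a, none) => (.inl none, action r w a .right)
      | (a, some b) => (.inl (some b), action r w a .left)
    | some b => if w r = some none then (.inr b, action r w (w r) .stay)
        else (.inl (some b), action r w (w r) .left)

end COp

namespace Tapes

variable {k : ℕ}

def setTape (T : Tapes k TSym) (r : Fin k) (w : ℕ → TSym) (p : ℕ) : Tapes k TSym where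
  inHead := T.inHead
  work := Function.update T.work r w
  head := Function.update T.head r p

theorem act_action (x : List Bool) (T : Tapes k TSym) (r : Fin k) (w : ℕ → TSym) (p : ℕ)
    (a : TSym) (m : HeadMove) :
    (T.setTape r w p).act x (COp.action r (T.setTape r w p).scanned a m)
      = T.setTape r (Function.update w p a)
          (match m with | .left => p - 1 | .stay => p | .right => p + 1) := by
  simp only [act, COp.action, setTape, Tapes.mk.injEq, true_and]
  constructor
  · funext i
    by_cases h : i = r
    · subst h; simp
    · simp [h, scanned]
  · funext i
    by_cases h : i = r
    · subst h; cases m <;> simp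
    · simp [h]

@[simp] theorem scanned_setTape (T : Tapes k TSym) (r : Fin k) (w : ℕ → TSym) (p : ℕ) :
    (T.setTape r w p).scanned r = w p := by
  simp [scanned, setTape]

end Tapes

namespace COp

variable {k : ℕ} {x : List Bool} {s : ℕ} {r : Fin k} {T : Tapes k TSym}

/-- The marker occurs in cell `0` only, so the head finds its way back without counting. -/
theorem run_back (o : COp) (l : List Bool) (b : Bool) (hs : l.length + 1 < s)
    (hT : ∀ i, T.head i < s) (p : ℕ) (hp : p ≤ l.length) :
    (o.frag r).Run x s (some b) (T.setTape r (tapeOf l) p) b (T.setTape r (tapeOf l) 0) := by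
  have hd : ∀ p ≤ l.length, ∀ i, (T.setTape r (tapeOf l) p).head i < s := by
    intro p hp i
    simp only [Tapes.setTape, Function.update_apply]
    split_ifs
    · omega
    · exact hT i
  induction p with
  | zero =>
    have := Frag.Run.last (F := o.frag r) (x := x) (l := some b) (e := b) (hd 0 hp)
      (a := action r (T.setTape r (tapeOf l) 0).scanned
        ((T.setTape r (tapeOf l) 0).scanned r) .stay) (by simp [frag, tapeOf])
    rw [Tapes.act_action] at this
    simpa using this
  | succ p ih =>
    refine .step (l' := some b) (hd _ hp)
      (a := action r (T.setTape r (tapeOf l) (p + 1)).scanned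
        ((T.setTape r (tapeOf l) (p + 1)).scanned r) .left) ?_ ?_
    · have : tapeOf l (p + 1) ≠ some none := by
        simp [tapeOf]
      simp [frag, this]
    · rw [Tapes.act_action]
      simpa using ih (by omega)

/-- Induction over the part `suf` not yet swept, with the processed bits `pre` to the left of the
head. A decrement of a nonzero number meets a one before the end of the list, so it never turns on a
blank. -/
theorem run_go (o : COp) (suf pre : List Bool)
    (hs : (pre ++ (o.sweep suf).1).length + 1 < s) (hs' : (pre ++ suf).length + 1 < s)
    (hT : ∀ i, T.head i < s) (ho : suf = [] → o = dec → False)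
    (hd : o = dec → bitsVal suf ≠ 0) :
    (o.frag r).Run x s none (T.setTape r (tapeOf (pre ++ suf)) (pre.length + 1)) (o.sweep suf).2
      (T.setTape r (tapeOf (pre ++ (o.sweep suf).1)) 0) := by
  induction suf generalizing pre with
  | nil =>
    have hl : ∀ i, (T.setTape r (tapeOf (pre ++ [])) (pre.length + 1)).head i < s := by
      intro i
      simp only [Tapes.setTape, Function.update_apply]
      split_ifs
      · simp at hs'; omega
      · exact hT i
    have hb : tapeOf pre (pre.length + 1) = none := by simp [tapeOf]
    cases o with
    | dec => exact (ho rfl rfl).elim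
    | inc =>
      refine .step (l' := some true) hl
        (a := action r (T.setTape r (tapeOf (pre ++ [])) (pre.length + 1)).scanned
        (some (some true)) .left) (by simp [frag, hb, go]) ?_
      rw [Tapes.act_action, List.append_nil, tapeOf_update_end]
      exact run_back _ _ _ (by simpa [sweep] using hs) hT _ (by simp)
    | test =>
      refine .step (l' := some false) hl
        (a := action r (T.setTape r (tapeOf (pre ++ [])) (pre.length + 1)).scanned
        none .left) (by simp [frag, hb, go]) ?_
      rw [Tapes.act_action, List.append_nil]
      have : Function.update (tapeOf pre) (pre.length + 1) none = tapeOf pre := by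
        rw [← hb, Function.update_eq_self]
      rw [this]
      simpa [sweep] using run_back (x := x) (r := r) .test pre false
        (by simpa [sweep] using hs) hT _ le_rfl
  | cons a suf ih =>
    have hl : ∀ i, (T.setTape r (tapeOf (pre ++ a :: suf)) (pre.length + 1)).head i < s := by
      intro i
      simp only [Tapes.setTape, Function.update_apply]
      split_ifs
      · simp at hs'; omega
      · exact hT i
    have hb : tapeOf (pre ++ a :: suf) (pre.length + 1) = some (some a) := by simp [tapeOf]
    have cont : ∀ a', o.go (some (some a)) = (some (some a'), none) →
        o.sweep (a :: suf) = (a' :: (o.sweep suf).1, (o.sweep suf).2) →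
        (suf = [] → o = dec → False) → (o = dec → bitsVal suf ≠ 0) →
        (o.frag r).Run x s none (T.setTape r (tapeOf (pre ++ a :: suf)) (pre.length + 1))
          (o.sweep (a :: suf)).2 (T.setTape r (tapeOf (pre ++ (o.sweep (a :: suf)).1)) 0) := by
      intro a' h1 h2 h3 h4
      refine .step (l' := none) hl
        (a := action r (T.setTape r (tapeOf (pre ++ a :: suf)) (pre.length + 1)).scanned
        (some (some a')) .right) (by simp [frag, hb, h1]) ?_
      rw [Tapes.act_action, tapeOf_update_append]
      rw [h2] at hs ⊢
      have := ih (pre ++ [a']) (by simpa [Nat.add_assoc, Nat.add_comm, Nat.add_left_comm] using hs)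
        (by simpa [Nat.add_assoc, Nat.add_comm, Nat.add_left_comm] using hs') h3 h4
      simpa using this
    have turn : ∀ a', o.go (some (some a)) = (some (some a'), some true) →
        o.sweep (a :: suf) = (a' :: suf, true) →
        (o.frag r).Run x s none (T.setTape r (tapeOf (pre ++ a :: suf)) (pre.length + 1))
          (o.sweep (a :: suf)).2 (T.setTape r (tapeOf (pre ++ (o.sweep (a :: suf)).1)) 0) := by
      intro a' h1 h2
      refine .step (l' := some true) hl
        (a := action r (T.setTape r (tapeOf (pre ++ a :: suf)) (pre.length + 1)).scanned
        (some (some a')) .left) (by simp [frag, hb, h1]) ?_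
      rw [Tapes.act_action, tapeOf_update_append, h2]
      rw [h2] at hs
      exact run_back _ _ _ hs hT _ (by simp)
    cases o with
    | inc =>
      cases a
      · exact turn true rfl rfl
      · exact cont false rfl rfl (by simp) (by simp)
    | test =>
      cases a
      · exact cont false rfl rfl (by simp) (by simp)
      · exact turn true rfl rfl
    | dec =>
      cases a
      · have h : bitsVal suf ≠ 0 := by
          have := hd rfl
          simp [bitsVal] at this
          exact this
        exact cont true rfl rfl (by rintro rfl; simp [bitsVal] at h) (fun _ => h)
      · exact turn false rfl rfl

theorem run (o : COp) (l : List Bool) (hl : T.work r = tapeOf l) (h0 : T.head r = 0)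
    (hs : (o.sweep l).1.length + 1 < s) (hs' : l.length + 1 < s)
    (hT : ∀ i, T.head i < s) (hd : o = dec → bitsVal l ≠ 0) :
    (o.frag r).Run x s (o.frag r).entry T (o.sweep l).2
      (T.setTape r (tapeOf (o.sweep l).1) 0) := by
  have e : T = T.setTape r (tapeOf l) 0 := by
    rw [← hl, ← h0]; simp [Tapes.setTape]
  have key := run_go (x := x) (r := r) o l [] hs hs' hT
    (by rintro rfl h; exact hd h rfl) hd
  refine .step (l' := none)
    (a := action r (T.setTape r (tapeOf l) 0).scanned (some none) .right) hT ?_ ?_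
  · simp only [frag, ← e]
    have : T.scanned r = some none := by simp [Tapes.scanned, hl, h0, tapeOf]
    rw [this]; cases o <;> simp [go]
  · have h2 : Function.update (tapeOf l) 0 (some none) = tapeOf l := by
      have : tapeOf l 0 = some none := rfl
      rw [← this, Function.update_eq_self]
    have h3 := Tapes.act_action x T r (tapeOf l) 0 (some none) .right
    rw [← e, h2] at h3
    rw [← e, h3]
    exact key

end COp

/-! Compilation of counter programs -/

namespace Prog

/-- Counter `r` is kept on worktape `r`. -/
def compile (k : ℕ) : Prog → Frag (k + 1) Bool
  | op o r => o.frag (Fin.ofNat (k + 1) r)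
  | sym c => .move .stay fun o => decide (o = c)
  | left => .move .left fun _ => true
  | right => .move .right fun _ => true
  | seq P Q => (P.compile k).bind fun _ => Q.compile k
  | ite T P Q => (T.compile k).bind fun b => if b then P.compile k else Q.compile k
  | loop T P => (T.compile k).loop (P.compile k)

end Prog

/-- The tapes `T` hold the counters of `σ`, with at most `s` bits each. -/
def Tapes.Holds {k : ℕ} (T : Tapes (k + 1) TSym) (s : ℕ) (σ : CState) : Prop :=
  T.inHead = σ.head ∧ ∀ i : Fin (k + 1), T.head i = 0 ∧
    ∃ l, T.work i = tapeOf l ∧ bitsVal l = σ.reg i ∧ l.length ≤ s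

theorem Tapes.Holds.setTape {k : ℕ} {T : Tapes (k + 1) TSym} {s : ℕ} {σ : CState}
    (h : T.Holds s σ) (r : ℕ) (hr : r ≤ k) (l : List Bool) (hl : l.length ≤ s) :
    (T.setTape (Fin.ofNat (k + 1) r) (tapeOf l) 0).Holds s (σ.set r (bitsVal l)) := by
  refine ⟨h.1, fun i => ?_⟩
  have hr' : (Fin.ofNat (k + 1) r : ℕ) = r := Nat.mod_eq_of_lt (by omega)
  by_cases e : i = Fin.ofNat (k + 1) r
  · subst e
    simp only [Tapes.setTape, Function.update_self, true_and, CState.set_reg, hr', if_true]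
    exact ⟨l, rfl, rfl, hl⟩
  · have : (i : ℕ) ≠ r := fun h => e (Fin.ext (by rw [hr', h]))
    simpa only [Tapes.setTape, Function.update_of_ne e, CState.set_reg, this, if_false] using h.2 i

/-- Induction over the execution. As `B < 2 ^ s`, no counter ever needs more than `s` bits
(`COp.sweep_inc`); the two further cells are the end marker and the first blank behind the bits. -/
theorem Prog.Exec.compile {x : List Bool} {B k s : ℕ} (hB : B < 2 ^ s) {P : Prog}
    {σ σ' : CState} {b : Bool} (h : P.Exec x B σ b σ') (hP : P.Below (k + 1))
    {T : Tapes (k + 1) TSym} (hT : T.Holds s σ) :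
    ∃ T', T'.Holds s σ' ∧ (P.compile k).Run x (s + 2) (P.compile k).entry T b T' := by
  have hd : ∀ {σ} {T : Tapes (k + 1) TSym}, T.Holds s σ → ∀ i, T.head i < s + 2 :=
    fun h i => by rw [(h.2 i).1]; omega
  have hr' : ∀ {r}, r < k + 1 → (Fin.ofNat (k + 1) r : ℕ) = r := fun h => Nat.mod_eq_of_lt h
  have hsym : ∀ {σ} {T : Tapes (k + 1) TSym}, T.Holds s σ → T.inSym x = symAt x σ.head :=
    fun h => by simp [Tapes.inSym, symAt, h.1]
  induction h generalizing T with
  | @inc r σ h =>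
    obtain ⟨h0, l, hl, hv, hls⟩ := hT.2 (Fin.ofNat (k + 1) r)
    rw [hr' hP] at hv
    obtain ⟨h1, h2, h3⟩ := COp.sweep_inc l
    have h4 : (COp.inc.sweep l).1.length ≤ s := by
      rcases h3 with h3 | ⟨h3, h5⟩
      · omega
      · have : 2 ^ l.length < 2 ^ s := by omega
        have := (Nat.pow_lt_pow_iff_right (by norm_num : 1 < 2)).1 this
        omega
    have := COp.run (x := x) (s := s + 2) .inc l hl h0 (by omega) (by omega) (hd hT) (by simp)
    rw [h2] at this
    have hh := hT.setTape r (Nat.lt_succ_iff.1 hP) _ h4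
    rw [h1, hv] at hh
    exact ⟨_, hh, this⟩
  | @dec r σ h =>
    obtain ⟨h0, l, hl, hv, hls⟩ := hT.2 (Fin.ofNat (k + 1) r)
    rw [hr' hP] at hv
    obtain ⟨h1, h2, h3⟩ := COp.sweep_dec l (by omega)
    have := COp.run (x := x) (s := s + 2) .dec l hl h0 (by omega) (by omega) (hd hT)
      (fun _ => by omega)
    rw [h2] at this
    have hh := hT.setTape r (Nat.lt_succ_iff.1 hP) _ (h3.trans_le hls)
    rw [h1, hv] at hh
    exact ⟨_, hh, this⟩
  | @test r σ =>
    obtain ⟨h0, l, hl, hv, hls⟩ := hT.2 (Fin.ofNat (k + 1) r)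
    rw [hr' hP] at hv
    have h1 := COp.sweep_test l
    have := COp.run (x := x) (s := s + 2) .test l hl h0 (by rw [h1]; simp; omega) (by omega)
      (hd hT) (by simp)
    rw [h1, hv] at this
    have hh := hT.setTape r (Nat.lt_succ_iff.1 hP) _ hls
    rw [hv] at hh
    refine ⟨_, ?_, this⟩
    convert hh using 1
    exact CState.ext' rfl fun q => by simp +contextual
  | @sym c σ =>
    have key := Frag.Run.last (F := (Prog.sym c).compile k) (x := x) (s := s + 2) (l := ())
      (e := decide (T.inSym x = c)) (hd hT) rfl
    rw [hsym hT] at key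
    exact ⟨T.act x ⟨.stay, T.scanned, fun _ => .stay⟩,
      ⟨hT.1, fun i => by simpa [Tapes.act, Tapes.scanned] using hT.2 i⟩, key⟩
  | @left σ =>
    have key := Frag.Run.last (F := Prog.left.compile k) (x := x) (s := s + 2) (l := ())
      (e := true) (hd hT) rfl
    exact ⟨_, ⟨by simp [Tapes.act, hT.1],
      fun i => by simpa [Tapes.act, Tapes.scanned] using hT.2 i⟩, key⟩
  | @right σ =>
    have key := Frag.Run.last (F := Prog.right.compile k) (x := x) (s := s + 2) (l := ())
      (e := true) (hd hT) rfl
    exact ⟨_, ⟨by simp [Tapes.act, hT.1],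
      fun i => by simpa [Tapes.act, Tapes.scanned] using hT.2 i⟩, key⟩
  | seq _ _ ih1 ih2 =>
    obtain ⟨T1, h1, r1⟩ := ih1 hP.1 hT
    obtain ⟨T2, h2, r2⟩ := ih2 hP.2 h1
    exact ⟨T2, h2, r1.bind r2⟩
  | iteT _ _ ih1 ih2 =>
    obtain ⟨T1, h1, r1⟩ := ih1 hP.1 hT
    obtain ⟨T2, h2, r2⟩ := ih2 hP.2.1 h1
    exact ⟨T2, h2, r1.bind (by simpa using r2)⟩
  | iteF _ _ ih1 ih2 =>
    obtain ⟨T1, h1, r1⟩ := ih1 hP.1 hT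
    obtain ⟨T2, h2, r2⟩ := ih2 hP.2.2 h1
    exact ⟨T2, h2, r1.bind (by simpa using r2)⟩
  | done _ ih =>
    obtain ⟨T1, h1, r1⟩ := ih hP.1 hT
    exact ⟨T1, h1, r1.loop_done _⟩
  | step _ _ _ ih1 ih2 ih3 =>
    obtain ⟨T1, h1, r1⟩ := ih1 hP.1 hT
    obtain ⟨T2, h2, r2⟩ := ih2 hP.2 h1
    obtain ⟨T3, h3, r3⟩ := ih3 hP h2
    exact ⟨T3, h3, r1.loop_step r2 r3⟩

/-! Alternating machines and transducers that iterate a counter program -/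

/-- `D` computes on input `x` a step at the value `a` of counter `0`: two bits, in the counters
`p` and `q`, and the next value of counter `0`. -/
def Prog.StepsTo (D : Prog) (p q : ℕ) (x : List Bool) (B a : ℕ) (y : (Bool × Bool) × ℕ) : Prop :=
  ∀ σ : CState, σ.head = 0 → σ.reg 0 = a → ∃ b σ', D.Exec x B σ b σ' ∧ σ'.head = 0 ∧
    σ'.reg 0 = y.2 ∧ decide (σ'.reg p ≠ 0) = y.1.1 ∧ decide (σ'.reg q ≠ 0) = y.1.2

/-- The two tests turn the counters `p` and `q` into an exit, on which a machine can act with its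
finite control; they do not alter any counter. -/
def Prog.mainFrag (D : Prog) (p q k : ℕ) : Frag (k + 1) (Bool × Bool) :=
  (D.compile k).bind fun _ => ((Prog.op .test p).compile k).bind fun b =>
    ((Prog.op .test q).compile k).map fun b' => (b, b')

theorem Prog.StepsTo.run {D : Prog} {p q k s : ℕ} {x : List Bool} {B a : ℕ}
    {y : (Bool × Bool) × ℕ} (h : D.StepsTo p q x B a y) (hB : B < 2 ^ s) (hD : D.Below (k + 1))
    (hp : p ≤ k) (hq : q ≤ k) {T : Tapes (k + 1) TSym} {σ : CState} (hT : T.Holds s σ)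
    (h0 : σ.head = 0) (ha : σ.reg 0 = a) :
    ∃ T' σ', T'.Holds s σ' ∧ σ'.head = 0 ∧ σ'.reg 0 = y.2 ∧
      (D.mainFrag p q k).Run x (s + 2) (D.mainFrag p q k).entry T y.1 T' := by
  obtain ⟨b, σ', he, h1, h2, h3, h4⟩ := h σ h0 ha
  obtain ⟨T1, t1, r1⟩ := he.compile hB hD hT
  obtain ⟨T2, t2, r2⟩ := (Prog.Exec.test (x := x) (B := B) (r := p) (σ := σ')).compile hB
    (Nat.lt_succ_iff.2 hp) t1
  obtain ⟨T3, t3, r3⟩ := (Prog.Exec.test (x := x) (B := B) (r := q) (σ := σ')).compile hB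
    (Nat.lt_succ_iff.2 hq) t2
  refine ⟨T3, σ', t3, h1, h2, ?_⟩
  have := r1.bind (G := fun _ => ((Prog.op .test p).compile k).bind fun b =>
    ((Prog.op .test q).compile k).map fun b' => (b, b'))
    (r2.bind (G := fun b => ((Prog.op .test q).compile k).map fun b' => (b, b'))
      (r3.map fun b' => (_, b')))
  rw [h3, h4] at this
  exact this

/-! Alternating machines -/

namespace AltTM

/-- From `c` all runs halt, with at most `E` existential and `U` universal guesses and with all
heads below `s`, and `c` is accepting iff `p`. -/
inductive Behaves (M : AltTM) (x : List Bool) (s : ℕ) : ℕ → ℕ → Prop → M.Cfg → Prop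
  | accept {E U T} : (∀ i, T.head i < s) → Behaves M x s E U True ⟨.accept, T⟩
  | reject {E U T} : (∀ i, T.head i < s) → Behaves M x s E U False ⟨.reject, T⟩
  | normal {E U p T l} : (∀ i, T.head i < s) →
      Behaves M x s E U p ⟨(M.δ l (T.inSym x) T.scanned).1,
        T.act x (M.δ l (T.inSym x) T.scanned).2⟩ → Behaves M x s E U p ⟨.normal l, T⟩
  | ex {E U T} {p : Bool → Prop} : (∀ i, T.head i < s) →
      (∀ b, Behaves M x s E U (p b) ⟨.normal (M.existsNext b), T⟩) →
      Behaves M x s (E + 1) U (∃ b, p b) ⟨.existsGuess, T⟩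
  | all {E U T} {p : Bool → Prop} : (∀ i, T.head i < s) →
      (∀ b, Behaves M x s E U (p b) ⟨.normal (M.forallNext b), T⟩) →
      Behaves M x s E (U + 1) (∀ b, p b) ⟨.forallGuess, T⟩

variable {M : AltTM} {x : List Bool} {s E U : ℕ} {p : Prop} {c : M.Cfg}

theorem Behaves.accepting_iff (h : M.Behaves x s E U p c) : M.AcceptingCfg x c ↔ p := by
  induction h with
  | accept => exact iff_of_true (.halt _ rfl) trivial
  | reject =>
    refine iff_of_false (fun h => ?_) id
    cases h with
    | halt _ h => cases h
    | some _ _ _ h => cases h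
    | all _ h => cases h
  | normal _ _ ih =>
    rw [← ih]
    constructor
    · intro h
      cases h with
      | halt _ h => cases h
      | some _ _ _ h h' => cases h; exact h'
      | all _ h => cases h
    · exact fun h => .some _ _ (by simp) (.normal _ _) h
  | ex _ _ ih =>
    simp only [← ih]
    constructor
    · intro h
      cases h with
      | halt _ h => cases h
      | some _ _ _ h h' => cases h with | existsGuess b => exact ⟨b, h'⟩
      | all _ h => cases h
    · exact fun ⟨b, h⟩ => .some _ _ (by simp) (.existsGuess b _) h
  | all _ _ ih =>
    simp only [← ih]
    constructor
    · intro h b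
      cases h with
      | halt _ h => cases h
      | some _ _ h => exact (h rfl).elim
      | all _ _ h => exact h _ (.forallGuess b _)
    · exact fun h => .all _ rfl fun c' hc => by cases hc with | forallGuess b => exact h b

/-- A run is a path in the finite tree of configurations described by `Behaves`; `E` and `U` bound
the number of guesses along each branch. -/
theorem Behaves.runs (h : M.Behaves x s E U p c) (l : List M.Cfg) (hl : l.head? = some c)
    (hc : l.IsChain (M.Step x)) : l.countP (fun c => c.state.isExists) ≤ E ∧
      l.countP (fun c => c.state.isForall) ≤ U ∧ ∀ c ∈ l, ∀ i, c.tapes.head i < s := by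
  induction h generalizing l with
  | accept h | reject h =>
    cases l with
    | nil => simp at hl
    | cons a l =>
      simp only [List.head?_cons, Option.some.injEq] at hl
      subst hl
      cases l with
      | nil => simpa [AState.isExists, AState.isForall] using h
      | cons b l => rw [List.isChain_cons_cons] at hc; cases hc.1
  | normal h _ ih =>
    cases l with
    | nil => simp at hl
    | cons a l =>
      simp only [List.head?_cons, Option.some.injEq] at hl
      subst hl
      cases l with
      | nil => simpa [AState.isExists, AState.isForall] using h
      | cons b l =>
        rw [List.isChain_cons_cons] at hc
        obtain ⟨h1, h2⟩ := hc
        cases h1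
        obtain ⟨h3, h4, h5⟩ := ih _ rfl h2
        exact ⟨(List.countP_cons_of_neg (by simp [AState.isExists])).trans_le h3,
          (List.countP_cons_of_neg (by simp [AState.isForall])).trans_le h4, fun c hc => (List.mem_cons.1 hc).elim (fun e => e ▸ h) (h5 c)⟩
  | ex h _ ih =>
    cases l with
    | nil => simp at hl
    | cons a l =>
      simp only [List.head?_cons, Option.some.injEq] at hl
      subst hl
      cases l with
      | nil => simpa [AState.isExists, AState.isForall] using h
      | cons b l =>
        rw [List.isChain_cons_cons] at hc
        obtain ⟨h1, h2⟩ := hc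
        cases h1 with
        | existsGuess b =>
        obtain ⟨h3, h4, h5⟩ := ih b _ rfl h2
        exact ⟨(List.countP_cons_of_pos rfl).trans_le (Nat.add_le_add_right h3 1),
          (List.countP_cons_of_neg (by simp [AState.isForall])).trans_le h4, fun c hc => (List.mem_cons.1 hc).elim (fun e => e ▸ h) (h5 c)⟩
  | all h _ ih =>
    cases l with
    | nil => simp at hl
    | cons a l =>
      simp only [List.head?_cons, Option.some.injEq] at hl
      subst hl
      cases l with
      | nil => simpa [AState.isExists, AState.isForall] using h
      | cons b l =>
        rw [List.isChain_cons_cons] at hc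
        obtain ⟨h1, h2⟩ := hc
        cases h1 with
        | forallGuess b =>
        obtain ⟨h3, h4, h5⟩ := ih b _ rfl h2
        exact ⟨(List.countP_cons_of_neg (by simp [AState.isExists])).trans_le h3,
          (List.countP_cons_of_pos rfl).trans_le (Nat.add_le_add_right h4 1), fun c hc => (List.mem_cons.1 hc).elim (fun e => e ▸ h) (h5 c)⟩

end AltTM

/-- What the alternating machine does when a step of the program has returned two bits. -/
def kindState {S : Type} : Bool × Bool → AState S
  | (false, false) => .reject
  | (false, true) => .accept
  | (true, false) => .existsGuess
  | (true, true) => .forallGuess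

/-- Put the end markers, then run `F` again and again; after a guess of the bit `1`, run `I`
first. -/
def Frag.alternating {k : ℕ} (F : Frag (k + 1) (Bool × Bool)) (I : Frag (k + 1) Bool) : AltTM where
  k := k + 1
  Γ := TSym
  finΓ := inferInstance
  blank := none
  S := Option (F.L ⊕ I.L)
  finS := by
    have := F.fin
    have := I.fin
    infer_instance
  start := none
  existsNext b := some (if b then .inr I.entry else .inl F.entry)
  forallNext b := some (if b then .inr I.entry else .inl F.entry)
  δ l o w := match l with
    | none => (.normal (some (.inl F.entry)), ⟨.left, fun _ => some none, fun _ => .stay⟩)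
    | some (.inl l) => match F.δ l o w with
      | (.inl l', a) => (.normal (some (.inl l')), a)
      | (.inr e, a) => (kindState e, a)
    | some (.inr l) => match I.δ l o w with
      | (.inl l', a) => (.normal (some (.inr l')), a)
      | (.inr _, a) => (.normal (some (.inl F.entry)), a)

namespace Frag

variable {k : ℕ} {F : Frag (k + 1) (Bool × Bool)} {I : Frag (k + 1) Bool} {x : List Bool}
  {s E U : ℕ} {p : Prop} {T T' : Tapes (k + 1) TSym}

theorem Run.alternating_main {l : F.L} {e : Bool × Bool} (h : F.Run x s l T e T')
    (h' : (F.alternating I).Behaves x s E U p ⟨kindState e, T'⟩) :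
    (F.alternating I).Behaves x s E U p ⟨.normal (some (.inl l)), T⟩ := by
  induction h with
  | last h1 h2 =>
    refine .normal h1 ?_
    simp only [Frag.alternating, h2]
    exact h'
  | step h1 h2 _ ih =>
    refine .normal h1 ?_
    simp only [Frag.alternating, h2]
    exact ih h'

theorem Run.alternating_inc {l : I.L} {e : Bool} (h : I.Run x s l T e T')
    (h' : (F.alternating I).Behaves x s E U p ⟨.normal (some (.inl F.entry)), T'⟩) :
    (F.alternating I).Behaves x s E U p ⟨.normal (some (.inr l)), T⟩ := by
  induction h with
  | last h1 h2 =>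
    refine .normal h1 ?_
    simp only [Frag.alternating, h2]
    exact h'
  | step h1 h2 _ ih =>
    refine .normal h1 ?_
    simp only [Frag.alternating, h2]
    exact ih h'

end Frag

/-- Alternating computations whose configurations are numbers `≤ A`: `F a` is the kind of the
configuration `a` (halting, existential or universal) and a number `a'`, the successors being `a'`
and `a' + 1`. -/
inductive Play (F : ℕ → (Bool × Bool) × ℕ) (A : ℕ) : ℕ → ℕ → Prop → ℕ → Prop
  | reject {E U a} : a ≤ A → (F a).1 = (false, false) → Play F A E U False a
  | accept {E U a} : a ≤ A → (F a).1 = (false, true) → Play F A E U True a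
  | ex {E U a} {p : Bool → Prop} : a ≤ A → (F a).1 = (true, false) →
      (∀ b : Bool, Play F A E U (p b) ((F a).2 + b.toNat)) → Play F A (E + 1) U (∃ b, p b) a
  | all {E U a} {p : Bool → Prop} : a ≤ A → (F a).1 = (true, true) →
      (∀ b : Bool, Play F A E U (p b) ((F a).2 + b.toNat)) → Play F A E (U + 1) (∀ b, p b) a

theorem Play.le {F : ℕ → (Bool × Bool) × ℕ} {A E U a : ℕ} {p : Prop} (h : Play F A E U p a) :
    a ≤ A := by
  cases h <;> assumption

theorem Tapes.holds_init {k : ℕ} (x : List Bool) (s : ℕ) :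
    ((Tapes.init (k + 1) (none : TSym)).act x
      ⟨.left, fun _ => some none, fun _ => .stay⟩).Holds s ⟨0, fun _ => 0⟩ := by
  refine ⟨rfl, fun i => ⟨rfl, [], ?_, rfl, by simp⟩⟩
  funext j
  cases j <;> simp [Tapes.act, Tapes.init, tapeOf]

/-- The machine that iterates `D`. -/
def Prog.altTM (D : Prog) (p q k : ℕ) : AltTM :=
  (D.mainFrag p q k).alternating ((Prog.op .inc 0).compile k)

/-- One step of the play is one run of `D` followed by a guess. The guessed bit is added to counter
`0` by the extra increment after a guess of `1`, whence the two successors are consecutive numbers.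
-/
theorem Play.behaves {D : Prog} {p q k s : ℕ} {x : List Bool} {B A : ℕ}
    {F : ℕ → (Bool × Bool) × ℕ} (hF : ∀ a ≤ A, D.StepsTo p q x B a (F a)) (hA : A ≤ B)
    (hB : B < 2 ^ s) (hD : D.Below (k + 1)) (hp : p ≤ k) (hq : q ≤ k) {E U a : ℕ} {P : Prop}
    (h : Play F A E U P a) {T : Tapes (k + 1) TSym} {σ : CState} (hT : T.Holds s σ)
    (h0 : σ.head = 0) (ha : σ.reg 0 = a) :
    (D.altTM p q k).Behaves x (s + 2) E U P
      ⟨.normal (some (.inl (D.mainFrag p q k).entry)), T⟩ := by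
  have hh : ∀ {T : Tapes (k + 1) TSym} {σ}, T.Holds s σ → ∀ i, T.head i < s + 2 :=
    fun h i => by rw [(h.2 i).1]; omega
  have next : ∀ {E U : ℕ} {p' : Bool → Prop} {y : ℕ}, (∀ b : Bool, Play F A E U (p' b)
      (y + b.toNat)) → (∀ (b : Bool) {T : Tapes (k + 1) TSym} {σ : CState}, T.Holds s σ →
        σ.head = 0 → σ.reg 0 = y + b.toNat → (D.altTM p q k).Behaves x (s + 2) E U (p' b)
          ⟨.normal (some (.inl (D.mainFrag p q k).entry)), T⟩) →
      ∀ {T : Tapes (k + 1) TSym} {σ : CState}, T.Holds s σ → σ.head = 0 → σ.reg 0 = y →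
      ∀ b : Bool, (D.altTM p q k).Behaves x (s + 2) E U (p' b)
        ⟨.normal (some (if b then .inr ((Prog.op .inc 0).compile k).entry
          else .inl (D.mainFrag p q k).entry)), T⟩ := by
    intro E U p' y hpl ih T σ hT h0 hy b
    cases b with
    | false => exact ih false hT h0 hy
    | true =>
      -- The incremented number is itself a configuration of the play, hence at most `A ≤ B`, so the
      -- increment is legal.
      have hle := (hpl true).le
      obtain ⟨T', hT', r⟩ := (Prog.Exec.inc (x := x) (B := B) (r := 0) (σ := σ)
        (by simp at hle; omega)).compile hB (by simp [Prog.Below]) hT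
      exact r.alternating_inc (ih true hT' h0 (by simp [hy]))
  induction h generalizing T σ with
  | @reject E U a h1 h2 =>
    obtain ⟨T', σ', t1, t2, t3, r⟩ := (hF a h1).run hB hD hp hq hT h0 ha
    refine r.alternating_main ?_
    rw [h2]
    exact .reject (hh t1)
  | @accept E U a h1 h2 =>
    obtain ⟨T', σ', t1, t2, t3, r⟩ := (hF a h1).run hB hD hp hq hT h0 ha
    refine r.alternating_main ?_
    rw [h2]
    exact .accept (hh t1)
  | @ex E U a p' h1 h2 h3 ih =>
    obtain ⟨T', σ', t1, t2, t3, r⟩ := (hF a h1).run hB hD hp hq hT h0 ha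
    refine r.alternating_main ?_
    rw [h2]
    exact .ex (hh t1) (next h3 (fun b _ _ => ih b) t1 t2 t3)
  | @all E U a p' h1 h2 h3 ih =>
    obtain ⟨T', σ', t1, t2, t3, r⟩ := (hF a h1).run hB hD hp hq hT h0 ha
    refine r.alternating_main ?_
    rw [h2]
    exact .all (hh t1) (next h3 (fun b _ _ => ih b) t1 t2 t3)

theorem Play.altTM {D : Prog} {p q k s : ℕ} {x : List Bool} {B A : ℕ}
    {F : ℕ → (Bool × Bool) × ℕ} (hF : ∀ a ≤ A, D.StepsTo p q x B a (F a)) (hA : A ≤ B)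
    (hB : B < 2 ^ s) (hD : D.Below (k + 1)) (hp : p ≤ k) (hq : q ≤ k) {E U : ℕ} {P : Prop}
    (h : Play F A E U P 0) :
    ((D.altTM p q k).AcceptingCfg x (D.altTM p q k).init ↔ P) ∧
      ∀ l, (D.altTM p q k).IsRun x l → l.countP (fun c => c.state.isExists) ≤ E ∧
      l.countP (fun c => c.state.isForall) ≤ U ∧ ∀ c ∈ l, ∀ i, c.tapes.head i < s + 2 := by
  have : (D.altTM p q k).Behaves x (s + 2) E U P (D.altTM p q k).init :=
    .normal (fun i => by simp [Tapes.init])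
      (h.behaves hF hA hB hD hp hq (Tapes.holds_init x s) rfl rfl)
  exact ⟨this.accepting_iff, fun l hl => this.runs l hl.1 hl.2⟩

/-! Transducers -/

namespace Transducer

/-- From `c` the transducer halts with output `o`, with all heads below `s`. -/
inductive Behaves (M : Transducer) (x : List Bool) (s : ℕ) : List Bool → M.Cfg → Prop
  | halt {c} : (∀ i, c.tapes.head i < s) → M.step x c = none → Behaves M x s c.output c
  | step {c c' o} : (∀ i, c.tapes.head i < s) → M.step x c = some c' → Behaves M x s o c' →
      Behaves M x s o c

theorem Behaves.reaches {M : Transducer} {x : List Bool} {s : ℕ} {o : List Bool} {c : M.Cfg}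
    (h : M.Behaves x s o c) : ∃ c', M.Reaches x c c' ∧ M.step x c' = none ∧ c'.output = o := by
  induction h with
  | halt _ h => exact ⟨_, .refl, h, rfl⟩
  | step _ h _ ih =>
    obtain ⟨c', h1, h2⟩ := ih
    exact ⟨c', .head h h1, h2⟩

theorem Behaves.head_lt {M : Transducer} {x : List Bool} {s : ℕ} {o : List Bool} {c c' : M.Cfg}
    (h : M.Behaves x s o c) (hc : M.Reaches x c c') (i) : c'.tapes.head i < s := by
  induction h with
  | halt h1 h2 =>
    rcases hc.cases_head with rfl | ⟨d, h3, -⟩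
    · exact h1 i
    · rw [h2] at h3; cases h3
  | step h1 h2 _ ih =>
    rcases hc.cases_head with rfl | ⟨d, h3, h4⟩
    · exact h1 i
    · rw [h2] at h3; cases h3; exact ih h4

end Transducer

/-- Put the end markers, then run `F` again and again, until it returns `false` as its first bit;
the second bit is appended to the output. -/
def Frag.transducing {k : ℕ} (F : Frag (k + 1) (Bool × Bool)) : Transducer where
  k := k + 1
  Γ := TSym
  finΓ := inferInstance
  blank := none
  S := Option (Option F.L)
  finS := by
    have := F.fin
    infer_instance
  start := some none
  δ l o w := match l with
    | none => none
    | some none => some (some (some F.entry), ⟨.left, fun _ => some none, fun _ => .stay⟩, none)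
    | some (some l) => match F.δ l o w with
      | (.inl l', a) => some (some (some l'), a, none)
      | (.inr (true, b), a) => some (some (some F.entry), a, some b)
      | (.inr (false, _), a) => some (none, a, none)

theorem Frag.Run.transducing_emit {k : ℕ} {F : Frag (k + 1) (Bool × Bool)} {x : List Bool}
    {s : ℕ} {T T' : Tapes (k + 1) TSym} {l : F.L} {b : Bool} (h : F.Run x s l T (true, b) T')
    {o o' : List Bool}
    (h' : F.transducing.Behaves x s o' ⟨some (some F.entry), T', o ++ [b]⟩) :
    F.transducing.Behaves x s o' ⟨some (some l), T, o⟩ := by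
  generalize he : (true, b) = e at h
  induction h with
  | last h1 h2 =>
    subst he
    refine .step h1 ?_ h'
    simp [Transducer.step, Frag.transducing, h2]
  | step h1 h2 _ ih =>
    refine .step h1 ?_ (ih h' he)
    simp [Transducer.step, Frag.transducing, h2]

theorem Frag.Run.transducing_halt {k : ℕ} {F : Frag (k + 1) (Bool × Bool)} {x : List Bool}
    {s : ℕ} {T T' : Tapes (k + 1) TSym} {l : F.L} {b : Bool} (h : F.Run x s l T (false, b) T')
    (hT' : ∀ i, T'.head i < s) {o : List Bool} :
    F.transducing.Behaves x s o ⟨some (some l), T, o⟩ := by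
  generalize he : (false, b) = e at h
  induction h with
  | last h1 h2 =>
    subst he
    refine .step h1 ?_ (.halt (c := ⟨none, _, o⟩) hT' rfl)
    simp [Transducer.step, Frag.transducing, h2, Tapes.act]
  | step h1 h2 _ ih =>
    refine .step h1 ?_ (ih hT' he)
    simp [Transducer.step, Frag.transducing, h2]

/-- From the number `a`, the iteration of `F` outputs `o`. -/
inductive Emits (F : ℕ → (Bool × Bool) × ℕ) (A : ℕ) : List Bool → ℕ → Prop
  | halt {a} : a ≤ A → (F a).1.1 = false → Emits F A [] a
  | emit {a b o} : a ≤ A → (F a).1 = (true, b) → Emits F A o (F a).2 → Emits F A (b :: o) a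

theorem Emits.behaves {D : Prog} {p q k s : ℕ} {x : List Bool} {B A : ℕ}
    {F : ℕ → (Bool × Bool) × ℕ} (hF : ∀ a ≤ A, D.StepsTo p q x B a (F a))
    (hB : B < 2 ^ s) (hD : D.Below (k + 1)) (hp : p ≤ k) (hq : q ≤ k) {a : ℕ} {o : List Bool}
    (h : Emits F A o a) {o' : List Bool} {T : Tapes (k + 1) TSym} {σ : CState} (hT : T.Holds s σ)
    (h0 : σ.head = 0) (ha : σ.reg 0 = a) :
    (D.mainFrag p q k).transducing.Behaves x (s + 2) (o' ++ o)
      ⟨some (some (D.mainFrag p q k).entry), T, o'⟩ := by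
  induction h generalizing T σ o' with
  | @halt a h1 h2 =>
    obtain ⟨T', σ', t1, t2, t3, r⟩ := (hF a h1).run hB hD hp hq hT h0 ha
    have e : (F a).1 = (false, (F a).1.2) := by rw [← h2]
    rw [e] at r
    rw [List.append_nil]
    exact r.transducing_halt (fun i => by rw [(t1.2 i).1]; omega)
  | @emit a b o h1 h2 _ ih =>
    obtain ⟨T', σ', t1, t2, t3, r⟩ := (hF a h1).run hB hD hp hq hT h0 ha
    rw [h2] at r
    have := ih (o' := o' ++ [b]) t1 t2 t3
    rw [List.append_assoc, List.singleton_append] at this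
    exact r.transducing_emit this

theorem Emits.transducer {D : Prog} {p q k s : ℕ} {x : List Bool} {B A : ℕ}
    {F : ℕ → (Bool × Bool) × ℕ} (hF : ∀ a ≤ A, D.StepsTo p q x B a (F a))
    (hB : B < 2 ^ s) (hD : D.Below (k + 1)) (hp : p ≤ k) (hq : q ≤ k) {o : List Bool}
    (h : Emits F A o 0) :
    (D.mainFrag p q k).transducing.Behaves x (s + 2) o (D.mainFrag p q k).transducing.init := by
  have := h.behaves hF hB hD hp hq (o' := []) (Tapes.holds_init x s) rfl rfl
  exact .step (fun i => by simp [Transducer.init, Tapes.init]) rfl this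

/-! Counter programs for functions -/

namespace Prog

/-- From `σ` the program `P` ends in a state satisfying `R`. -/
def Does (x : List Bool) (B : ℕ) (P : Prog) (σ : CState) (R : CState → Prop) : Prop :=
  ∃ b σ', P.Exec x B σ b σ' ∧ R σ'

variable {x : List Bool} {B : ℕ} {P Q T : Prog} {σ : CState} {R R' : CState → Prop}

theorem Does.mono (h : Does x B P σ R) (hR : ∀ σ, R σ → R' σ) : Does x B P σ R' :=
  let ⟨b, σ', h1, h2⟩ := h
  ⟨b, σ', h1, hR _ h2⟩

theorem Does.seq (h : Does x B P σ fun ρ => Does x B Q ρ R) : Does x B (seq P Q) σ R :=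
  let ⟨_, _, h1, b, τ, h2, h3⟩ := h
  ⟨b, τ, .seq h1 h2, h3⟩

theorem does_inc {r : ℕ} (hB : σ.reg r + 1 ≤ B) (h : R (σ.set r (σ.reg r + 1))) :
    Does x B (op .inc r) σ R := ⟨_, _, .inc hB, h⟩

theorem does_dec {r : ℕ} (hB : σ.reg r ≠ 0) (h : R (σ.set r (σ.reg r - 1))) :
    Does x B (op .dec r) σ R := ⟨_, _, .dec hB, h⟩

theorem does_ite_test {r : ℕ} (h1 : σ.reg r ≠ 0 → Does x B P σ R)
    (h2 : σ.reg r = 0 → Does x B Q σ R) : Does x B (ite (op .test r) P Q) σ R := by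
  have ht := Exec.test (x := x) (B := B) (r := r) (σ := σ)
  by_cases h : σ.reg r = 0
  · obtain ⟨b, σ', h3, h4⟩ := h2 h
    exact ⟨b, σ', .iteF (by simpa [h] using ht) h3, h4⟩
  · obtain ⟨b, σ', h3, h4⟩ := h1 h
    exact ⟨b, σ', .iteT (by simpa [h] using ht) h3, h4⟩

theorem does_ite_sym {c : Option Bool} (h1 : symAt x σ.head = c → Does x B P σ R)
    (h2 : symAt x σ.head ≠ c → Does x B Q σ R) : Does x B (ite (sym c) P Q) σ R := by
  have ht := Exec.sym (x := x) (B := B) (c := c) (σ := σ)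
  by_cases h : symAt x σ.head = c
  · obtain ⟨b, σ', h3, h4⟩ := h1 h
    exact ⟨b, σ', .iteT (by simpa [h] using ht) h3, h4⟩
  · obtain ⟨b, σ', h3, h4⟩ := h2 h
    exact ⟨b, σ', .iteF (by simpa [h] using ht) h3, h4⟩

def nop : Prog := op .test 0

theorem does_nop (h : R σ) : Does x B nop σ R := ⟨_, _, .test, h⟩

/-- Decrement `r` and run `P`, as long as `r` is not zero. -/
def repeated (r : ℕ) (P : Prog) : Prog := loop (op .test r) (seq (op .dec r) P)

/-- The loop rule, with an invariant indexed by the current value of `r`. The body must leave `r` as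
it finds it after the decrement, so that this value counts the remaining rounds. -/
theorem does_repeated {r : ℕ} (I : ℕ → CState → Prop)
    (hP : ∀ n σ, I (n + 1) σ → σ.reg r = n + 1 →
      Does x B P (σ.set r n) fun σ' => I n σ' ∧ σ'.reg r = n)
    (h : I (σ.reg r) σ) (hR : ∀ σ, I 0 σ → σ.reg r = 0 → R σ) :
    Does x B (repeated r P) σ R := by
  generalize hn : σ.reg r = n at h
  induction n generalizing σ with
  | zero =>
    have ht := Exec.test (x := x) (B := B) (r := r) (σ := σ)
    exact ⟨_, _, .done (by simpa [hn] using ht), hR _ h hn⟩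
  | succ n ih =>
    obtain ⟨b, ρ, h1, h2, h3⟩ := hP n σ h hn
    obtain ⟨b', τ, h4, h5⟩ := ih h3 h2
    have ht := Exec.test (x := x) (B := B) (r := r) (σ := σ)
    refine ⟨b', τ, .step (b := b) (by simpa [hn] using ht) (.seq (.dec (by omega)) ?_) h4, h5⟩
    simpa [hn] using h1

def clear (r : ℕ) : Prog := repeated r nop

theorem does_clear {r : ℕ} (h : R (σ.set r 0)) : Does x B (clear r) σ R := by
  refine does_repeated (fun n ρ => ρ = σ.set r n) ?_ ?_ ?_
  · rintro n _ rfl -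
    exact does_nop ⟨CState.ext' rfl fun q => by simp; split_ifs <;> rfl, by simp⟩
  · exact CState.ext' rfl fun q => by simp +contextual
  · rintro _ rfl -
    exact h

/-- Add counter `r` to `t` and clear it. -/
def move (r t : ℕ) : Prog := repeated r (op .inc t)

theorem does_move {r t : ℕ} (hrt : r ≠ t) (hB : σ.reg t + σ.reg r ≤ B)
    (h : R ((σ.set r 0).set t (σ.reg t + σ.reg r))) : Does x B (move r t) σ R := by
  refine does_repeated (fun n ρ => n ≤ σ.reg r ∧
    ρ = (σ.set r n).set t (σ.reg t + (σ.reg r - n))) ?_ ?_ ?_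
  · rintro n _ ⟨hn, rfl⟩ -
    refine does_inc (by simp [hrt.symm]; omega) ⟨⟨by omega, CState.ext' rfl fun q => ?_⟩, ?_⟩
    · simp [hrt.symm]
      split_ifs <;> omega
    · simp [hrt]
  · exact ⟨le_rfl, CState.ext' rfl fun q => by simp; split_ifs <;> simp_all⟩
  · rintro _ ⟨-, rfl⟩ -
    exact h

/-- Add counter `r` to `t` and to `u` and clear it. -/
def move₂ (r t u : ℕ) : Prog := repeated r (seq (op .inc t) (op .inc u))

theorem does_move₂ {r t u : ℕ} (hrt : r ≠ t) (hru : r ≠ u) (htu : t ≠ u)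
    (hB : σ.reg t + σ.reg r ≤ B) (hB' : σ.reg u + σ.reg r ≤ B)
    (h : R (((σ.set r 0).set t (σ.reg t + σ.reg r)).set u (σ.reg u + σ.reg r))) :
    Does x B (move₂ r t u) σ R := by
  refine does_repeated (fun n ρ => n ≤ σ.reg r ∧
    ρ = ((σ.set r n).set t (σ.reg t + (σ.reg r - n))).set u (σ.reg u + (σ.reg r - n))) ?_ ?_ ?_
  · rintro n _ ⟨hn, rfl⟩ -
    refine .seq <| does_inc (by simp [hrt.symm, htu]; omega) <|
      does_inc (by simp [hru.symm, htu.symm]; omega) ⟨⟨by omega, CState.ext' rfl fun q => ?_⟩, ?_⟩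
    · simp [hrt.symm, hru.symm, htu, htu.symm]
      split_ifs <;> omega
    · simp [hrt, hru]
  · exact ⟨le_rfl, CState.ext' rfl fun q => by simp; split_ifs <;> simp_all⟩
  · rintro _ ⟨-, rfl⟩ -
    exact h

/-- Copy counter `r` to `t`, clearing `u`. -/
def copy (r t u : ℕ) : Prog := seq (clear t) <| seq (clear u) <| seq (move₂ r t u) (move u r)

theorem does_copy {r t u : ℕ} (hrt : r ≠ t) (hru : r ≠ u) (htu : t ≠ u) (hB : σ.reg r ≤ B)
    (h : R ((σ.set t (σ.reg r)).set u 0)) : Does x B (copy r t u) σ R := by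
  refine .seq <| does_clear <| .seq <| does_clear <| .seq <| does_move₂ hrt hru htu ?_ ?_ <|
    does_move hru.symm ?_ ?_
  · simp [hrt, hru, htu, hB]
  · simp [hrt, hru, hB]
  · simp [hrt, hru, hB]
  · convert h using 1
    refine CState.ext' rfl fun q => ?_
    simp [hrt, hru, htu]
    split_ifs <;> simp_all

/-! Pairing -/

/-- Replace counter `0` by the code of the pair of the counters `0` and `1`. -/
def pairing : Prog :=
  seq (clear 2) <| seq (clear 3) <| seq (clear 4) <|
  seq (loop (ite (op .test 0) (op .test 1) (op .test 0))
    (seq (op .dec 0) <| seq (op .dec 1) (op .inc 2))) <|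
  seq (ite (op .test 1) (move₂ 1 3 4) (seq (move₂ 0 3 4) (op .inc 4))) <|
  seq (repeated 2 (seq (op .inc 3) <| seq (op .inc 4) (op .inc 0)))
    (repeated 3 (seq (move₂ 4 1 0) (move 1 4)))

theorem below_pairing : pairing.Below 5 := by
  simp [pairing, Below, clear, move, move₂, repeated, nop]

/-- The counters `0` and `1` are decremented together until one of them vanishes; the number of
rounds, which is their minimum, is collected in counter `2`. The test is a conjunction: if counter
`0` is zero, testing it again returns `false`. -/
theorem does_cancel (h2 : σ.reg 2 + σ.reg 0 ≤ B)
    (h : ∀ σ' : CState, σ'.head = σ.head → σ'.reg 0 = σ.reg 0 - min (σ.reg 0) (σ.reg 1) →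
      σ'.reg 1 = σ.reg 1 - min (σ.reg 0) (σ.reg 1) →
      σ'.reg 2 = σ.reg 2 + min (σ.reg 0) (σ.reg 1) → (∀ r ≥ 3, σ'.reg r = σ.reg r) → R σ') :
    Does x B (loop (ite (op .test 0) (op .test 1) (op .test 0))
      (seq (op .dec 0) <| seq (op .dec 1) (op .inc 2))) σ R := by
  generalize hn : σ.reg 0 = n at h
  induction n generalizing σ with
  | zero =>
    have ht := Exec.test (x := x) (B := B) (r := 0) (σ := σ)
    rw [hn] at ht
    exact ⟨_, _, .done (.iteF ht ht), h _ rfl (by simp [hn]) (by simp) (by simp) (by simp)⟩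
  | succ n ih =>
    have ht := Exec.test (x := x) (B := B) (r := 0) (σ := σ)
    have ht' := Exec.test (x := x) (B := B) (r := 1) (σ := σ)
    rw [hn] at ht
    by_cases h1 : σ.reg 1 = 0
    · rw [h1] at ht'
      exact ⟨_, _, .done (.iteT ht ht'), h _ rfl (by simp [hn, h1]) (by simp [h1]) (by simp [h1])
        (by simp)⟩
    · obtain ⟨b, σ', h3, h4⟩ := ih (σ := ((σ.set 0 n).set 1 (σ.reg 1 - 1)).set 2 (σ.reg 2 + 1))
        (by simp; omega) (by simp) (fun σ' e0 e1 e2 e3 e4 => by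
          simp at e0 e1 e2 e3 e4
          refine h σ' e0 (by omega) (by omega) (by omega) fun r hr => ?_
          rw [e4 r hr, if_neg (by omega), if_neg (by omega), if_neg (by omega)])
      refine ⟨b, σ', .step (.iteT ht (by simpa [h1] using ht')) (.seq (.dec (by omega)) <|
        .seq (.dec (by simpa using h1)) (.inc (by simp; omega))) ?_, h4⟩
      convert h3 using 1
      simp [hn]

/-- Both cases in the definition of `Nat.pair` have the form `u + p * q` with `u` the minimum of the
components: `p = q = d` if `c < d`, and `p = c`, `q = c + 1` otherwise. The factors are assembled in
the counters `3` and `4`, and the product is a repeated addition. -/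
theorem does_pairing (hB : (σ.reg 0 + σ.reg 1 + 1) ^ 2 ≤ B)
    (h : ∀ σ' : CState, σ'.head = σ.head → σ'.reg 0 = Nat.pair (σ.reg 0) (σ.reg 1) →
      (∀ r ≥ 5, σ'.reg r = σ.reg r) → R σ') : Does x B pairing σ R := by
  generalize hc : σ.reg 0 = c at h hB
  generalize hd : σ.reg 1 = d at h hB
  have hsq : c + d + 1 ≤ (c + d + 1) ^ 2 := Nat.le_self_pow (by norm_num) _
  refine .seq <| does_clear <| .seq <| does_clear <| .seq <| does_clear <| .seq <|
    does_cancel (by simp [hc]; omega) ?_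
  intro σ1 e0 e1 e2 e3 e4
  simp only [CState.set_head, CState.set_reg, hc, hd] at e0 e1 e2 e3 e4
  norm_num at e0 e1 e2 e3 e4
  set u := min c d with hu
  have e33 : σ1.reg 3 = 0 := by rw [e4 3 (by omega)]; simp
  have e34 : σ1.reg 4 = 0 := by rw [e4 4 (by omega)]; simp
  refine .seq ?_
  -- Here `s` and `t` are the two factors minus `u`; the loop over counter `2` adds `u` to both.
  suffices key : ∀ (σ2 : CState) (s t : ℕ), σ2.head = σ.head → σ2.reg 0 = 0 → σ2.reg 1 = 0 →
      σ2.reg 2 = u → σ2.reg 3 = s → σ2.reg 4 = t → (∀ r ≥ 5, σ2.reg r = σ.reg r) →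
      s + u ≤ c + d → t + u ≤ c + d + 1 → u + (s + u) * (t + u) = Nat.pair c d →
      Does x B (seq (repeated 2 (seq (op .inc 3) <| seq (op .inc 4) (op .inc 0)))
        (repeated 3 (seq (move₂ 4 1 0) (move 1 4)))) σ2 R by
    refine does_ite_test (fun h1 => does_move₂ (by omega) (by omega) (by omega) (by omega)
      (by omega) ?_) (fun h1 => .seq <| does_move₂ (by omega) (by omega) (by omega) (by omega)
      (by omega) <| does_inc (by simp; omega) ?_)
    · refine key _ (d - u) (d - u) (by simpa using e0) (by simp; omega) (by simp) (by simp [e2, e3])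
        (by simp; omega) (by simp; omega) ?_ (by omega) (by omega) ?_
      · intro r hr
        simp only [CState.set_reg]
        rw [if_neg (by omega), if_neg (by omega), if_neg (by omega), e4 r (by omega),
          if_neg (by omega), if_neg (by omega), if_neg (by omega)]
      · have : c < d := by omega
        rw [Nat.pair, if_pos this]
        have : u = c := by omega
        rw [this, Nat.sub_add_cancel (by omega), Nat.add_comm]
    · refine key _ (c - u) (c - u + 1) (by simpa using e0) (by simp) (by simp; omega)
        (by simp [e3]) (by simp; omega) (by simp; omega) ?_ (by omega) (by omega) ?_
      · intro r hr
        simp only [CState.set_reg]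
        rw [if_neg (by omega), if_neg (by omega), if_neg (by omega), if_neg (by omega),
          e4 r (by omega), if_neg (by omega), if_neg (by omega), if_neg (by omega)]
      · have : ¬ c < d := by omega
        rw [Nat.pair, if_neg this]
        have : u = d := by omega
        have h2 : c - u + 1 + u = c + 1 := by omega
        rw [h2, Nat.sub_add_cancel (by omega), this]
        ring
  intro σ2 s t f0 f1 f2 f3 f4 f5 f6 hs ht hp
  refine .seq <| does_repeated (fun n ρ => n ≤ u ∧ ρ = (((σ2.set 2 n).set 3 (s + (u - n))).set 4
    (t + (u - n))).set 0 (u - n)) ?_ ?_ ?_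
  · rintro n _ ⟨hn, rfl⟩ -
    refine .seq <| does_inc (by simp; omega) <| .seq <| does_inc (by simp; omega) <|
      does_inc (by simp; omega) ⟨⟨by omega, CState.ext' rfl fun q => ?_⟩, by simp⟩
    simp
    split_ifs <;> omega
  · refine ⟨f3.le, CState.ext' rfl fun q => ?_⟩
    simp only [CState.set_reg, f3]
    split_ifs <;> simp_all
  · rintro _ ⟨-, rfl⟩ -
    have hB2 : u + (s + u) * (t + u) ≤ B := by
      rw [hp]
      refine le_trans ?_ hB
      have := Nat.pair_lt_max_add_one_sq c d
      refine this.le.trans (Nat.pow_le_pow_left ?_ 2)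
      omega
    refine does_repeated (fun n ρ => n ≤ s + u ∧ ρ.head = σ.head ∧ ρ.reg 1 = 0 ∧
      ρ.reg 4 = t + u ∧ ρ.reg 0 = u + (s + u - n) * (t + u) ∧ ∀ r ≥ 5, ρ.reg r = σ.reg r) ?_ ?_ ?_
    · rintro n ρ ⟨g0, g1, g2, g3, g4, g5⟩ hr
      have g6 : (s + u - n) * (t + u) = (s + u - (n + 1)) * (t + u) + (t + u) := by
        have : s + u - n = s + u - (n + 1) + 1 := by omega
        rw [this]; ring
      have g7 : (s + u - n) * (t + u) ≤ (s + u) * (t + u) :=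
        Nat.mul_le_mul_right _ (by omega)
      refine .seq <| does_move₂ (by omega) (by omega) (by omega) ?_ ?_ <| does_move (by omega) ?_
        ⟨⟨by omega, by simpa using g1, by simp, ?_, ?_, ?_⟩, by simp⟩
      · simp [g2, g3]; omega
      · simp [g3, g4]; omega
      · simp [g2, g3]; omega
      · simp [g2, g3]
      · simp [g3, g4, g6]; omega
      · intro r hr
        simp only [CState.set_reg]
        rw [if_neg (by omega), if_neg (by omega), if_neg (by omega), if_neg (by omega),
          if_neg (by omega), if_neg (by omega), g5 r hr]
    · simp only [CState.set_reg, CState.set_head]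
      refine ⟨by simp, f0, by simpa using f2, by simp, by simp, fun r hr => ?_⟩
      rw [if_neg (by omega), if_neg (by omega), if_neg (by omega), if_neg (by omega), f6 r hr]
    · rintro ρ ⟨g0, g1, g2, g3, g4, g5⟩ -
      exact h ρ g1 (by rw [g4, Nat.sub_zero, hp]) g5

/-- Put into the counters `1`, `2`, `3` the minimum and the difference of the components of the
pair coded by counter `0`, and whether the first is at least the second. -/
def unpairing : Prog :=
  seq (clear 1) <| seq (clear 2) <| seq (clear 3) <| seq (op .inc 3) <|
  repeated 0 (ite (op .test 2)
    (seq (op .dec 2) <| seq (op .inc 1) <|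
      ite (op .test 2) nop (ite (op .test 3) nop (seq (move 1 2) (op .inc 3))))
    (seq (op .dec 3) <| seq (move 1 2) (op .inc 2)))

theorem below_unpairing : unpairing.Below 4 := by
  simp [unpairing, Below, clear, move, repeated, nop]

/-- `u`, `d`, `e` represent the pair coded by `n` as in `unpairing`. -/
def UnpairRep (n u d e : ℕ) : Prop :=
  e = 1 ∧ n = Nat.pair (u + d) u ∨ e = 0 ∧ d ≠ 0 ∧ n = Nat.pair u (u + d)

theorem UnpairRep.le {n u d e : ℕ} (h : UnpairRep n u d e) : u + d ≤ n := by
  rcases h with ⟨_, rfl⟩ | ⟨_, _, rfl⟩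
  · exact Nat.left_le_pair _ _
  · exact Nat.right_le_pair _ _

/-- No square root is needed: while counter `0` is counted down, the represented pair runs through
the enumeration of all pairs from `(0, 0)` on. One step increases the minimum and decreases the
difference, except at the corners, where the flag changes and the minimum restarts at `0`: after
`(u, u + 1)` comes `(u + 1, 0)`, and after `(u, u)` comes `(0, u + 1)`. -/
theorem does_unpairing (hB : σ.reg 0 + 1 ≤ B)
    (h : ∀ σ' : CState, σ'.head = σ.head → σ'.reg 0 = 0 →
      UnpairRep (σ.reg 0) (σ'.reg 1) (σ'.reg 2) (σ'.reg 3) → (∀ r ≥ 4, σ'.reg r = σ.reg r) → R σ') :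
    Does x B unpairing σ R := by
  refine .seq <| does_clear <| .seq <| does_clear <| .seq <| does_clear <| .seq <|
    does_inc (by simp; omega) ?_
  refine does_repeated (fun n ρ => n ≤ σ.reg 0 ∧ ρ.head = σ.head ∧
    UnpairRep (σ.reg 0 - n) (ρ.reg 1) (ρ.reg 2) (ρ.reg 3) ∧ ∀ r ≥ 4, ρ.reg r = σ.reg r) ?_ ?_ ?_
  · rintro n ρ ⟨h0, h1, h2, h3⟩ -
    have hle := h2.le
    have hm : σ.reg 0 - n = σ.reg 0 - (n + 1) + 1 := by omega
    have fr : ∀ r ≥ 4, (ρ.set 0 n).reg r = σ.reg r := fun r hr => by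
      simp only [CState.set_reg]; rw [if_neg (by omega), h3 r hr]
    generalize σ.reg 0 - (n + 1) = m at h2 hm hle
    have post : ∀ τ : CState, τ.head = σ.head → τ.reg 0 = n →
        UnpairRep (m + 1) (τ.reg 1) (τ.reg 2) (τ.reg 3) →
        (∀ r ≥ 4, τ.reg r = σ.reg r) →
        (n ≤ σ.reg 0 ∧ τ.head = σ.head ∧ UnpairRep (σ.reg 0 - n) (τ.reg 1) (τ.reg 2) (τ.reg 3) ∧
          ∀ r ≥ 4, τ.reg r = σ.reg r) ∧ τ.reg 0 = n :=
      fun τ t1 t2 t3 t4 => ⟨⟨by omega, t1, hm ▸ t3, t4⟩, t2⟩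
    refine does_ite_test (fun hd => .seq <| does_dec hd <| .seq <| does_inc ?_ <|
      does_ite_test (fun hd' => does_nop ?_) fun hd' => does_ite_test (fun he => does_nop ?_)
      fun he => .seq <| does_move (by omega) ?_ <| does_inc ?_ ?_)
      fun hd => .seq <| does_dec ?_ <| .seq <| does_move (by omega) ?_ <| does_inc ?_ ?_
    all_goals simp at hd
    · simp at *
      omega
    · simp at hd'
      refine post _ (by simpa using h1) (by simp) ?_ ?_
      · simp
        rcases h2 with ⟨e1, e2⟩ | ⟨e1, e2, e3⟩
        · left
          refine ⟨e1, ?_⟩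
          have h1 : ¬ ρ.reg 1 + ρ.reg 2 < ρ.reg 1 := by omega
          have h2 : ¬ ρ.reg 1 + 1 + (ρ.reg 2 - 1) < ρ.reg 1 + 1 := by omega
          have h3 : ρ.reg 1 + 1 + (ρ.reg 2 - 1) = ρ.reg 1 + ρ.reg 2 := by omega
          rw [e2, Nat.pair, Nat.pair, if_neg h1, if_neg h2, h3]
          omega
        · right
          refine ⟨e1, by omega, ?_⟩
          have h1 : ρ.reg 1 < ρ.reg 1 + ρ.reg 2 := by omega
          have h2 : ρ.reg 1 + 1 < ρ.reg 1 + 1 + (ρ.reg 2 - 1) := by omega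
          have h3 : ρ.reg 1 + 1 + (ρ.reg 2 - 1) = ρ.reg 1 + ρ.reg 2 := by omega
          rw [e3, Nat.pair, Nat.pair, if_pos h1, if_pos h2, h3]
          omega
      · intro r hr
        simp only [CState.set_reg]
        rw [if_neg (by omega), if_neg (by omega), if_neg (by omega), h3 r hr]
    · simp at hd' he
      refine post _ (by simpa using h1) (by simp) ?_ ?_
      · simp
        rcases h2 with ⟨e1, e2⟩ | ⟨e1, e2, e3⟩
        · left
          refine ⟨e1, ?_⟩
          have h1 : ¬ ρ.reg 1 + ρ.reg 2 < ρ.reg 1 := by omega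
          have h2 : ¬ ρ.reg 1 + 1 + (ρ.reg 2 - 1) < ρ.reg 1 + 1 := by omega
          have h3 : ρ.reg 1 + 1 + (ρ.reg 2 - 1) = ρ.reg 1 + ρ.reg 2 := by omega
          rw [e2, Nat.pair, Nat.pair, if_neg h1, if_neg h2, h3]
          omega
        · omega
      · intro r hr
        simp only [CState.set_reg]
        rw [if_neg (by omega), if_neg (by omega), if_neg (by omega), h3 r hr]
    · simp at *
      omega
    · simp at *
      omega
    · simp at hd' he
      refine post _ (by simpa using h1) (by simp) ?_ ?_
      · simp
        rcases h2 with ⟨e1, e2⟩ | ⟨e1, e2, e3⟩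
        · omega
        · left
          refine ⟨by omega, ?_⟩
          have h1 : ρ.reg 2 = 1 := by omega
          rw [e3, h1, Nat.pair, Nat.pair, if_pos (by omega), if_neg (by omega)]
          simp
          ring
      · intro r hr
        simp only [CState.set_reg]
        rw [if_neg (by omega), if_neg (by omega), if_neg (by omega), if_neg (by omega),
          if_neg (by omega), if_neg (by omega), h3 r hr]
    · simp at *
      rcases h2 with ⟨e1, e2⟩ | ⟨e1, e2, e3⟩ <;> omega
    · simp at *
      omega
    · simp at *
      omega
    · refine post _ (by simpa using h1) (by simp) ?_ ?_
      · simp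
        rcases h2 with ⟨e1, e2⟩ | ⟨e1, e2, e3⟩
        · right
          refine ⟨by omega, ?_⟩
          rw [e2, hd, Nat.pair, Nat.pair, if_neg (by omega), if_pos (by omega)]
          simp
          ring
        · omega
      · intro r hr
        simp only [CState.set_reg]
        rw [if_neg (by omega), if_neg (by omega), if_neg (by omega), if_neg (by omega),
          if_neg (by omega), h3 r hr]
  · simp only [CState.set_reg, CState.set_head]
    refine ⟨by simp, trivial, by simp [UnpairRep, Nat.pair], fun r hr => ?_⟩
    rw [if_neg (by omega), if_neg (by omega), if_neg (by omega), if_neg (by omega)]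
  · rintro ρ ⟨h0, h1, h2, h3⟩ h4
    exact h ρ h1 h4 h2 h3

/-- Go back to the left end of the input. -/
def rewind : Prog :=
  seq left (loop (ite (sym (some true)) (sym (some true)) (sym (some false))) left)

/-- The first move to the left leaves the blank behind the input, where the head may stand and which
looks like the blank in cell `0`. After it, a blank can only mean the left end. -/
theorem does_rewind (hσ : σ.head ≤ x.length + 1) (h : R ⟨0, σ.reg⟩) : Does x B rewind σ R := by
  refine .seq ⟨_, _, .left, ?_⟩
  obtain ⟨p, r⟩ := σ
  simp only at h hσ ⊢
  have hp : p - 1 ≤ x.length := by omega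
  generalize p - 1 = q at hp
  clear hσ
  induction q with
  | zero =>
    have ht := fun c => Exec.sym (x := x) (B := B) (c := c) (σ := ⟨0, r⟩)
    exact ⟨_, _, .done (.iteF (by simpa [symAt] using ht (some true))
      (by simpa [symAt] using ht (some false))), h⟩
  | succ q ih =>
    obtain ⟨b, σ', h1, h2⟩ := ih (by omega)
    have ht := fun c => Exec.sym (x := x) (B := B) (c := c) (σ := ⟨q + 1, r⟩)
    refine ⟨b, σ', .step (ρ := ⟨q + 1, r⟩) (τ := ⟨q, r⟩) ?_ .left h1, h2⟩
    have hs : symAt x (q + 1) = some x[q] := by simp [symAt]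
    cases hb : x[q] with
    | true =>
      have := ht (some true)
      simp only [hs, hb] at this
      exact .iteT this this
    | false =>
      have h1 := ht (some true)
      have h2 := ht (some false)
      simp only [hs, hb] at h1 h2
      exact .iteF h1 h2

end Prog

/-! ### Functions implemented by counter programs, with a bound on the values written -/

/-- `f` is implemented by a counter program, with argument and value in counter `0`; from the
argument `a` no value above `S x a` is written. -/
def Imp (f S : List Bool → ℕ → ℕ) : Prop :=
  ∃ (P : Prog) (N : ℕ), P.Below N ∧ 0 < N ∧ ∀ x σ B, σ.head = 0 → S x (σ.reg 0) ≤ B →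
    P.Does x B σ fun σ' => σ'.head = 0 ∧ σ'.reg 0 = f x (σ.reg 0) ∧
      ∀ r ≥ N, σ'.reg r = σ.reg r

open Prog

theorem Prog.UnpairRep.fst {n u d e : ℕ} (h : UnpairRep n u d e) :
    n.unpair.1 = if e ≠ 0 then u + d else u := by
  rcases h with ⟨rfl, rfl⟩ | ⟨rfl, _, rfl⟩ <;> simp

theorem Prog.UnpairRep.snd {n u d e : ℕ} (h : UnpairRep n u d e) :
    n.unpair.2 = if e ≠ 0 then u else u + d := by
  rcases h with ⟨rfl, rfl⟩ | ⟨rfl, _, rfl⟩ <;> simp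

namespace Imp

variable {f g S Sf Sg : List Bool → ℕ → ℕ}

theorem mono (h : Imp f Sf) (hS : ∀ x a, Sf x a ≤ S x a) : Imp f S := by
  obtain ⟨P, N, h1, h2, h3⟩ := h
  exact ⟨P, N, h1, h2, fun x σ B h h' => h3 x σ B h ((hS _ _).trans h')⟩

/-- The value ends up in a counter, so it was either there at the start or was reached by permitted
increments. -/
theorem le (h : Imp f S) (x : List Bool) (a : ℕ) : f x a ≤ max (S x a) a := by
  obtain ⟨P, N, -, -, h3⟩ := h
  obtain ⟨b, σ', h4, -, h5, -⟩ := h3 x ⟨0, fun _ => a⟩ (S x a) rfl le_rfl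
  rw [← h5]
  exact h4.reg_le 0

theorem id : Imp (fun _ a => a) fun _ _ => 0 :=
  ⟨nop, 1, by simp [nop, Below], one_pos, fun x σ B h _ => does_nop ⟨h, rfl, fun _ _ => rfl⟩⟩

theorem zero : Imp (fun _ _ => 0) fun _ _ => 0 :=
  ⟨clear 0, 1, by simp [clear, repeated, nop, Below], one_pos, fun x σ B h _ =>
    does_clear ⟨h, by simp, fun r hr => by simp; omega⟩⟩

theorem succ : Imp (fun _ a => a + 1) fun _ a => a + 1 :=
  ⟨.op .inc 0, 1, by simp [Below], one_pos, fun x σ B h hB =>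
    does_inc hB ⟨h, by simp, fun r hr => by simp; omega⟩⟩

theorem comp (hf : Imp f Sf) (hg : Imp g Sg) :
    Imp (fun x a => f x (g x a)) fun x a => Sg x a + Sf x (g x a) := by
  obtain ⟨P, N, h1, h2, h3⟩ := hf
  obtain ⟨Q, M, h4, h5, h6⟩ := hg
  refine ⟨.seq Q P, max N M, ⟨h4.mono (by omega), h1.mono (by omega)⟩, by omega,
    fun x σ B h hB => by
    dsimp only at hB
    exact .seq <| (h6 x σ B h (by omega)).mono fun ρ ⟨k1, k2, k3⟩ =>
      (h3 x ρ B k1 (by rw [k2]; omega)).mono fun τ ⟨l1, l2, l3⟩ =>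
        ⟨l1, by rw [l2, k2], fun r hr => by rw [l3 r (by omega), k3 r (by omega)]⟩⟩

theorem pair (hf : Imp f Sf) (hg : Imp g Sg) : Imp (fun x a => Nat.pair (f x a) (g x a))
    fun x a => a + Sf x a + Sg x a + (f x a + g x a + 1) ^ 2 := by
  obtain ⟨P, N, h1, h2, h3⟩ := hf
  obtain ⟨Q, M, h4, h5, h6⟩ := hg
  -- Neither of the two programs nor the pairing program changes counters from `K` on; there the
  -- argument and the first value survive.
  set K := max (max N M) 5 with hK
  refine ⟨.seq (copy 0 K (K + 1)) <| .seq P <| .seq (copy 0 (K + 1) (K + 2)) <|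
    .seq (copy K 0 (K + 2)) <| .seq Q <| .seq (clear 1) <| .seq (Prog.move 0 1) <|
    .seq (Prog.move (K + 1) 0) pairing, K + 3, ?_, by omega, fun x σ B h hB => ?_⟩
  · have b1 := h1.mono (show N ≤ K + 3 by omega)
    have b2 := h4.mono (show M ≤ K + 3 by omega)
    have b3 := below_pairing.mono (show 5 ≤ K + 3 by omega)
    simp only [Below, copy, clear, repeated, nop, move₂, Prog.move, b1, b2, b3]
    and_intros <;> first | omega | trivial
  · dsimp only at hB
    set a := σ.reg 0 with ha
    have hsq : f x a + g x a + 1 ≤ (f x a + g x a + 1) ^ 2 := Nat.le_self_pow (by norm_num) _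
    refine .seq <| does_copy (by omega) (by omega) (by omega) (by omega) <| .seq <|
      (h3 x _ B (by simpa using h) ?_).mono fun σ1 ⟨p1, p2, p3⟩ => ?_
    · simp only [CState.set_reg]
      (repeat rw [if_neg (by omega)])
      rw [← ha]; omega
    simp only [CState.set_reg, if_neg (show 0 ≠ K + 1 by omega),
      if_neg (show 0 ≠ K by omega), ← ha] at p2 p3
    have q1 : σ1.reg K = a := by rw [p3 K (by omega)]; simp
    have q2 : ∀ r ≥ K + 3, σ1.reg r = σ.reg r := fun r hr => by
      rw [p3 r (by omega)]; (repeat rw [if_neg (by omega)])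
    refine .seq <| does_copy (by omega) (by omega) (by omega) (by omega) <| .seq <|
      does_copy (by omega) (by omega) (by omega) (by simp; omega) <| .seq <|
      (h6 x _ B (by simpa using p1) ?_).mono fun σ2 ⟨r1, r2, r3⟩ => ?_
    · simp only [CState.set_reg]
      simp [q1]
      omega
    simp only [CState.set_reg] at r2 r3
    simp [q1] at r2
    have s1 : σ2.reg (K + 1) = f x a := by rw [r3 _ (by omega)]; simp [p2]
    have s2 : ∀ r ≥ K + 3, σ2.reg r = σ.reg r := fun r hr => by
      rw [r3 r (by omega)]; (repeat rw [if_neg (by omega)]); try rw [q2 r hr]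
    refine .seq <| does_clear <| .seq <| does_move (by omega) (by simp; omega) <| .seq <|
      does_move (by omega) ?_ <| does_pairing ?_ fun τ t1 t2 t3 => ⟨?_, ?_, ?_⟩
    · simp [s1, show K ≠ 0 by omega]; omega
    · simp [s1, r2, show K ≠ 0 by omega]; omega
    · simpa [r1] using t1
    · simpa [s1, r2, show K ≠ 0 by omega] using t2
    · intro r hr
      rw [t3 r (by omega)]
      simp only [CState.set_reg]
      (repeat rw [if_neg (by omega)]); try rw [s2 r hr]

theorem left : Imp (fun _ a => a.unpair.1) fun _ a => a + 1 := by
  refine ⟨.seq unpairing <| .seq (Prog.move 1 0) <| .ite (.op .test 3) (Prog.move 2 0) nop, 4,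
    ⟨below_unpairing, by simp [Prog.move, repeated, nop, Below]⟩, by omega, fun x σ B h hB => ?_⟩
  dsimp only at hB
  refine .seq <| does_unpairing hB fun ρ h1 h2 h3 h4 => .seq <| does_move (by omega) ?_ ?_
  · have := h3.le; omega
  · have hle := h3.le
    refine does_ite_test (fun he => does_move (by omega) ?_ ⟨by simp [h1, h], ?_, ?_⟩)
      (fun he => does_nop ⟨by simp [h1, h], ?_, ?_⟩)
    · simp [h2]; omega
    · simp at he
      simp [h2, UnpairRep.fst h3, he]
    · intro r hr
      simp only [CState.set_reg]
      (repeat rw [if_neg (by omega)]); try rw [h4 r hr]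
    · simp at he
      simp [h2, UnpairRep.fst h3, he]
    · intro r hr
      simp only [CState.set_reg]
      (repeat rw [if_neg (by omega)]); try rw [h4 r hr]

theorem right : Imp (fun _ a => a.unpair.2) fun _ a => a + 1 := by
  refine ⟨.seq unpairing <| .seq (Prog.move 1 0) <| .ite (.op .test 3) nop (Prog.move 2 0), 4,
    ⟨below_unpairing, by simp [Prog.move, repeated, nop, Below]⟩, by omega, fun x σ B h hB => ?_⟩
  dsimp only at hB
  refine .seq <| does_unpairing hB fun ρ h1 h2 h3 h4 => .seq <| does_move (by omega) ?_ ?_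
  · have := h3.le; omega
  · have hle := h3.le
    refine does_ite_test (fun he => does_nop ⟨by simp [h1, h], ?_, ?_⟩)
      (fun he => does_move (by omega) ?_ ⟨by simp [h1, h], ?_, ?_⟩)
    · simp at he
      simp [h2, UnpairRep.snd h3, he]
    · intro r hr
      simp only [CState.set_reg]
      (repeat rw [if_neg (by omega)]); try rw [h4 r hr]
    · simp [h2]; omega
    · simp at he
      simp [h2, UnpairRep.snd h3, he]
    · intro r hr
      simp only [CState.set_reg]
      (repeat rw [if_neg (by omega)]); try rw [h4 r hr]

end Imp

/-- The input bit at position `i`, plus one; `0` beyond the end of the input. -/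
def inputSym (x : List Bool) (i : ℕ) : ℕ :=
  match x[i]? with
  | none => 0
  | some false => 1
  | some true => 2

namespace Imp

variable {f g S Sf Sg : List Bool → ℕ → ℕ}

/-- The bit at position `i` is in cell `i + 1`, whence the one additional move to the right. Beyond
the input the head is stopped at the blank, which gives the value `0`. -/
theorem inputSym : Imp inputSym fun _ _ => 2 := by
  refine ⟨.seq .right <| .seq (repeated 0 .right) <| .seq
    (.ite (.sym none) nop <| .ite (.sym (some true)) (.seq (.op .inc 0) (.op .inc 0)) (.op .inc 0))
    rewind, 1, by simp [repeated, nop, rewind, Below], by omega, fun x σ B h hB => ?_⟩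
  dsimp only at hB
  refine .seq ⟨_, _, .right, .seq <| does_repeated (fun n ρ => n ≤ σ.reg 0 ∧
    ρ.head = min (σ.reg 0 - n + 1) (x.length + 1) ∧ ∀ r ≥ 1, ρ.reg r = σ.reg r) ?_ ?_ ?_⟩
  · rintro n ρ ⟨h1, h2, h3⟩ -
    refine ⟨_, _, .right, ⟨by omega, ?_, fun r hr => ?_⟩, by simp⟩
    · simp [h2]; omega
    · simp [h3 r hr]; omega
  · simp [h]
  · rintro ρ ⟨-, h2, h3⟩ h0
    have hs : symAt x ρ.head = x[σ.reg 0]? := by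
      rw [h2, symAt]; (repeat rw [if_neg (by omega)])
      rcases lt_or_ge (σ.reg 0) x.length with hl | hl
      · congr 1; omega
      · rw [List.getElem?_eq_none hl, List.getElem?_eq_none (by omega)]
    refine .seq ?_
    have fin : ∀ v, v = _root_.inputSym x (σ.reg 0) → ∀ τ : CState, τ.head = ρ.head → τ.reg 0 = v →
        (∀ r ≥ 1, τ.reg r = ρ.reg r) → rewind.Does x B τ fun σ' => σ'.head = 0 ∧
          σ'.reg 0 = _root_.inputSym x (σ.reg 0) ∧ ∀ r ≥ 1, σ'.reg r = σ.reg r := by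
      intro v hv τ t1 t2 t3
      exact does_rewind (by omega) ⟨rfl, by rw [← hv]; exact t2, fun r hr => by
        rw [← h3 r hr, ← t3 r hr]⟩
    have fr : ∀ v, ∀ r ≥ 1, (ρ.set 0 v).reg r = ρ.reg r := fun v r hr => by simp; omega
    refine does_ite_sym (fun e => does_nop ?_) fun e => does_ite_sym
      (fun e' => .seq <| does_inc (by omega) <| does_inc (by simp; omega) ?_)
      fun e' => does_inc (by omega) ?_
    · rw [hs] at e
      exact fin 0 (by simp [_root_.inputSym, e]) ρ rfl h0 fun _ _ => rfl
    · rw [hs] at e'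
      refine fin 2 (by simp [_root_.inputSym, e']) _ rfl (by simp [h0]) fun r hr => ?_
      rw [CState.set_reg, if_neg (by omega), CState.set_reg, if_neg (by omega)]
    · rw [hs] at e e'
      refine fin 1 ?_ _ rfl (by simp [h0]) (fr _)
      rcases h : x[σ.reg 0]? with _ | _ | _ <;> simp_all [_root_.inputSym]

/-- Primitive recursion. -/
theorem prec (hf : Imp f Sf) (hg : Imp g Sg) (F : List Bool → ℕ → ℕ → ℕ)
    (h0 : ∀ x z, F x z 0 = f x z)
    (h1 : ∀ x z n, F x z (n + 1) = g x (Nat.pair z (Nat.pair n (F x z n))))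
    (hS : ∀ x z n, Nat.pair z n + 1 ≤ S x (Nat.pair z n) ∧ Sf x z ≤ S x (Nat.pair z n) ∧
      ∀ i < n, Sg x (Nat.pair z (Nat.pair i (F x z i))) ≤ S x (Nat.pair z n) ∧
        (z + (i + F x z i + 1) ^ 2 + 1) ^ 2 ≤ S x (Nat.pair z n)) :
    Imp (fun x a => F x a.unpair.1 a.unpair.2) S := by
  obtain ⟨PL, NL, l1, l2, l3⟩ := left
  obtain ⟨PR, NR, r1, r2, r3⟩ := right
  obtain ⟨P, N, p1, p2, p3⟩ := hf
  obtain ⟨Q, M, q1, q2, q3⟩ := hg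
  set K := max (max N M) (max (max NL NR) 5) with hK
  -- counter `K` holds the parameter, `K + 1` the rounds left, `K + 2` the rounds done
  refine ⟨.seq (copy 0 K (K + 3)) <| .seq PR <| .seq (copy 0 (K + 1) (K + 3)) <|
    .seq (copy K 0 (K + 3)) <| .seq PL <| .seq (copy 0 K (K + 3)) <| .seq P <|
    .seq (clear (K + 2)) <| repeated (K + 1) <|
    .seq (clear 1) <| .seq (Prog.move 0 1) <| .seq (copy (K + 2) 0 (K + 3)) <| .seq pairing <|
    .seq (clear 1) <| .seq (Prog.move 0 1) <| .seq (copy K 0 (K + 3)) <| .seq pairing <|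
    .seq Q (.op .inc (K + 2)), K + 4, ?_, by omega, fun x σ B h hB => ?_⟩
  · have b1 := l1.mono (show NL ≤ K + 4 by omega)
    have b2 := r1.mono (show NR ≤ K + 4 by omega)
    have b3 := p1.mono (show N ≤ K + 4 by omega)
    have b4 := q1.mono (show M ≤ K + 4 by omega)
    have b5 := below_pairing.mono (show 5 ≤ K + 4 by omega)
    simp only [Below, copy, clear, repeated, nop, move₂, Prog.move, b1, b2, b3, b4, b5]
    and_intros <;> first | omega | trivial
  set a := σ.reg 0 with ha
  set z := a.unpair.1 with hz
  set n := a.unpair.2 with hn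
  have hzn : Nat.pair z n = a := Nat.pair_unpair a
  obtain ⟨s1, s2, s3⟩ := hS x z n
  rw [hzn] at s1 s2 s3
  have hza : z ≤ a := Nat.unpair_left_le a
  have hna : n ≤ a := Nat.unpair_right_le a
  refine .seq <| does_copy (by omega) (by omega) (by omega) (by omega) <| .seq <|
    (r3 x _ B (by simpa using h) ?_).mono fun σ1 ⟨a1, a2, a3⟩ => ?_
  · simp only [CState.set_reg]
    (repeat rw [if_neg (by omega)])
    omega
  simp only [CState.set_reg, if_neg (show 0 ≠ K + 3 by omega),
    if_neg (show 0 ≠ K by omega), ← ha] at a2 a3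
  have a4 : σ1.reg K = a := by rw [a3 K (by omega)]; simp
  have a5 : ∀ r ≥ K + 4, σ1.reg r = σ.reg r := fun r hr => by
    rw [a3 r (by omega)]; (repeat rw [if_neg (by omega)])
  refine .seq <| does_copy (by omega) (by omega) (by omega) (by omega) <| .seq <|
    does_copy (by omega) (by omega) (by omega) (by simp; omega) <| .seq <|
    (l3 x _ B (by simpa using a1) ?_).mono fun σ2 ⟨b1, b2, b3⟩ => ?_
  · simp [a4]; omega
  simp only [CState.set_reg] at b2 b3
  simp [a4] at b2
  have b4 : σ2.reg (K + 1) = n := by rw [b3 _ (by omega)]; simp [a2, n]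
  have b5 : ∀ r ≥ K + 4, σ2.reg r = σ.reg r := fun r hr => by
    rw [b3 r (by omega)]; (repeat rw [if_neg (by omega)]); try rw [a5 r hr]
  refine .seq <| does_copy (by omega) (by omega) (by omega) (by omega) <| .seq <|
    (p3 x _ B (by simpa using b1) ?_).mono fun σ3 ⟨c1, c2, c3⟩ => ?_
  · simp [b2, show 0 ≠ K by omega, ← hz]; omega
  simp only [CState.set_reg] at c2 c3
  simp [show 0 ≠ K by omega, b2] at c2
  have c4 : σ3.reg (K + 1) = n := by rw [c3 _ (by omega)]; simp [b4]
  have c4' : σ3.reg K = z := by rw [c3 _ (by omega)]; simp [b2, z]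
  have c5 : ∀ r ≥ K + 4, σ3.reg r = σ.reg r := fun r hr => by
    rw [c3 r (by omega)]; (repeat rw [if_neg (by omega)]); try rw [b5 r hr]
  refine .seq <| does_clear <| does_repeated (fun m ρ => m ≤ n ∧ ρ.head = 0 ∧
    ρ.reg 0 = F x z (n - m) ∧ ρ.reg K = z ∧ ρ.reg (K + 2) = n - m ∧
    ∀ r ≥ K + 4, ρ.reg r = σ.reg r) ?_ ?_ ?_
  · rintro m ρ ⟨d1, d2, d3, d4, d5, d6⟩ d7
    obtain ⟨e1, e2⟩ := s3 (n - (m + 1)) (by omega)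
    have hm : n - m = n - (m + 1) + 1 := by omega
    rw [hm, h1]
    set i := n - (m + 1)
    set y := F x z i
    have hs1 : i + y + 1 ≤ (i + y + 1) ^ 2 := Nat.le_self_pow (by norm_num) _
    have hs2 : z + (i + y + 1) ^ 2 + 1 ≤ (z + (i + y + 1) ^ 2 + 1) ^ 2 :=
      Nat.le_self_pow (by norm_num) _
    have hp : Nat.pair i y ≤ (i + y + 1) ^ 2 :=
      (Nat.pair_lt_max_add_one_sq i y).le.trans (Nat.pow_le_pow_left (by omega) 2)
    have hp' : (z + Nat.pair i y + 1) ^ 2 ≤ (z + (i + y + 1) ^ 2 + 1) ^ 2 :=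
      Nat.pow_le_pow_left (by omega) 2
    refine .seq <| does_clear <| .seq <| does_move (by omega) (by simp [d3]; omega) <| .seq <|
      does_copy (by omega) (by omega) (by omega) (by simp [d5]; omega) <| .seq <|
      does_pairing ?_ fun τ f1 f2 f3 => ?_
    · simp [d3, d5]; omega
    simp [d2, d3, d5] at f1 f2 f3
    have f4 : τ.reg K = z := by
      rw [f3 K (by omega)]; (repeat rw [if_neg (by omega)]); try rw [d4]
    have f5 : τ.reg (K + 2) = i := by
      rw [f3 _ (by omega)]; (repeat rw [if_neg (by omega)]); try rw [d5]
    have f6 : τ.reg (K + 1) = m := by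
      rw [f3 _ (by omega)]; (repeat rw [if_neg (by omega)])
      simp
    have f7 : ∀ r ≥ K + 4, τ.reg r = σ.reg r := fun r hr => by
      rw [f3 r (by omega)]; (repeat rw [if_neg (by omega)]); try rw [d6 r hr]
    refine .seq <| does_clear <| .seq <| does_move (by omega) (by simp [f2]; omega) <| .seq <|
      does_copy (by omega) (by omega) (by omega) ?_ <| .seq <|
      does_pairing ?_ fun υ g1 g2 g3 => ?_
    · simp [f4, show K ≠ 0 by omega, show K ≠ 1 by omega]; omega
    · simp [f2, f4, show K ≠ 0 by omega, show K ≠ 1 by omega]; omega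
    simp [f1, f2, f4, show K ≠ 0 by omega, show K ≠ 1 by omega] at g1 g2 g3
    refine .seq <| (q3 x υ B g1 (by rw [g2]; omega)).mono fun ω ⟨k1, k2, k3⟩ => ?_
    have k5 : ω.reg (K + 2) = i := by
      rw [k3 _ (by omega), g3 _ (by omega)]; (repeat rw [if_neg (by omega)]); try rw [f5]
    have k6 : ω.reg (K + 1) = m := by
      rw [k3 _ (by omega), g3 _ (by omega)]; (repeat rw [if_neg (by omega)]); try rw [f6]
    have k4 : ω.reg K = z := by
      rw [k3 _ (by omega), g3 _ (by omega)]; (repeat rw [if_neg (by omega)]); try rw [f4]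
    have k7 : ∀ r ≥ K + 4, ω.reg r = σ.reg r := fun r hr => by
      rw [k3 r (by omega), g3 r (by omega)]; (repeat rw [if_neg (by omega)]); try rw [f7 r hr]
    refine does_inc (by omega) ⟨⟨by omega, k1, ?_, ?_, ?_, ?_⟩, ?_⟩
    · simp [k2, g2]
    · simp [k4]
    · simp [k5]
    · intro r hr
      simp only [CState.set_reg]
      (repeat rw [if_neg (by omega)]); try rw [k7 r hr]
    · simp [k6]
  · simp only [CState.set_reg, CState.set_head]
    (repeat rw [if_neg (by omega)]); try rw [c4, c4', c2]
    refine ⟨le_rfl, c1, ?_, rfl, by simp, fun r hr => ?_⟩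
    · rw [Nat.sub_self, h0]
    · (repeat rw [if_neg (by omega)]); try rw [c5 r hr]
  · rintro ρ ⟨-, d2, d3, -, -, d6⟩ -
    exact ⟨d2, by rw [d3, Nat.sub_zero], d6⟩

/-- Unbounded search for the least `k` such that `f` does not vanish at the pair of the argument
and `k`. -/
theorem search (hf : Imp f Sf) (F K : List Bool → ℕ → ℕ)
    (h0 : ∀ x a, ∀ k < K x a, f x (Nat.pair a k) = 0)
    (h1 : ∀ x a, f x (Nat.pair a (K x a)) = F x a + 1)
    (hS : ∀ x a, ∀ k ≤ K x a, Sf x (Nat.pair a k) ≤ S x a ∧ (a + k + 1) ^ 2 ≤ S x a) :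
    Imp F S := by
  obtain ⟨P, N, p1, p2, p3⟩ := hf
  set M := max N 5 with hM
  refine ⟨.seq (copy 0 M (M + 2)) <| .seq (clear (M + 1)) <| .seq
    (.seq (copy M 0 (M + 2)) <| .seq (copy (M + 1) 1 (M + 2)) <| .seq pairing P) <| .seq
    -- The negation of a test: the head stands on the blank cell `0`, so `sym (some true)` returns
    -- `false` and `sym none` returns `true`. The final decrement removes the one by which a found
    -- value is marked as found.
    (.loop (.ite (.op .test 0) (.sym (some true)) (.sym none)) <| .seq (.op .inc (M + 1)) <|
      .seq (copy M 0 (M + 2)) <| .seq (copy (M + 1) 1 (M + 2)) <| .seq pairing P)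
    (.op .dec 0), M + 3, ?_, by omega, fun x σ B h hB => ?_⟩
  · have b1 := p1.mono (show N ≤ M + 3 by omega)
    have b5 := below_pairing.mono (show 5 ≤ M + 3 by omega)
    simp only [Below, copy, clear, repeated, nop, move₂, Prog.move, b1, b5]
    and_intros <;> first | omega | trivial
  set a := σ.reg 0 with ha
  have eval : ∀ (ρ : CState) (k : ℕ) (R : CState → Prop), k ≤ K x a → ρ.head = 0 → ρ.reg M = a →
      ρ.reg (M + 1) = k → (∀ r ≥ M + 3, ρ.reg r = σ.reg r) →
      (∀ τ : CState, τ.head = 0 → τ.reg M = a → τ.reg (M + 1) = k →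
        (∀ r ≥ M + 3, τ.reg r = σ.reg r) → τ.reg 0 = f x (Nat.pair a k) → R τ) →
      Does x B (.seq (copy M 0 (M + 2)) <| .seq (copy (M + 1) 1 (M + 2)) <| .seq pairing P) ρ R := by
    intro ρ k R hk r1 r2 r3 r4 hR
    obtain ⟨s1, s2⟩ := hS x a k hk
    have hs : a + k + 1 ≤ (a + k + 1) ^ 2 := Nat.le_self_pow (by norm_num) _
    refine .seq <| does_copy (by omega) (by omega) (by omega) (by omega) <| .seq <|
      does_copy (by omega) (by omega) (by omega) (by simp; omega) <| .seq <|
      does_pairing (by simp [r2, r3]; omega) fun τ t1 t2 t3 => ?_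
    simp [r1, r2, r3] at t1 t2 t3
    refine (p3 x τ B t1 (by rw [t2]; omega)).mono fun υ ⟨u1, u2, u3⟩ =>
      hR υ u1 ?_ ?_ ?_ (by rw [u2, t2])
    · rw [u3 _ (by omega), t3 _ (by omega)]; (repeat rw [if_neg (by omega)]); try rw [r2]
    · rw [u3 _ (by omega), t3 _ (by omega)]; (repeat rw [if_neg (by omega)]); try rw [r3]
    · intro r hr
      rw [u3 _ (by omega), t3 _ (by omega)]; (repeat rw [if_neg (by omega)]); try rw [r4 r hr]
  have hB0 := (hS x a 0 (Nat.zero_le _)).2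
  have hs0 : a + 0 + 1 ≤ (a + 0 + 1) ^ 2 := Nat.le_self_pow (by norm_num) _
  refine .seq <| does_copy (by omega) (by omega) (by omega) (by omega) <| .seq <| does_clear <|
    .seq <| eval _ 0 _ (Nat.zero_le _) (by simpa using h) (by simp [← ha]) (by simp) ?_ ?_
  · intro r hr
    simp only [CState.set_reg]
    (repeat rw [if_neg (by omega)])
  intro τ t1 t2 t3 t4 t5
  refine .seq ?_
  suffices key : ∀ (m k : ℕ) (τ : CState), k + m = K x a → τ.head = 0 → τ.reg M = a →
      τ.reg (M + 1) = k → (∀ r ≥ M + 3, τ.reg r = σ.reg r) → τ.reg 0 = f x (Nat.pair a k) →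
      Does x B (.loop (.ite (.op .test 0) (.sym (some true)) (.sym none)) <|
        .seq (.op .inc (M + 1)) <| .seq (copy M 0 (M + 2)) <| .seq (copy (M + 1) 1 (M + 2)) <|
        .seq pairing P) τ fun τ => τ.head = 0 ∧ (∀ r ≥ M + 3, τ.reg r = σ.reg r) ∧
          τ.reg 0 = F x a + 1 by
    refine (key (K x a) 0 τ (by omega) t1 t2 t3 t4 t5).mono fun υ ⟨u1, u2, u3⟩ =>
      does_dec (by omega) ⟨u1, by simp [u3], fun r hr => ?_⟩
    simp only [CState.set_reg]
    (repeat rw [if_neg (by omega)]); try rw [u2 r hr]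
  intro m
  induction m with
  | zero =>
    intro k τ hk t1 t2 t3 t4 t5
    have hk' : k = K x a := by omega
    subst hk'
    rw [h1] at t5
    have e1 := Exec.test (x := x) (B := B) (r := 0) (σ := τ)
    have e2 := Exec.sym (x := x) (B := B) (c := some true) (σ := τ)
    exact ⟨_, _, .done (.iteT (by simpa [t5] using e1) (by simpa [symAt, t1] using e2)),
      t1, t4, t5⟩
  | succ m ih =>
    intro k τ hk t1 t2 t3 t4 t5
    rw [h0 x a k (by omega)] at t5
    have e1 := Exec.test (x := x) (B := B) (r := 0) (σ := τ)
    have e2 := Exec.sym (x := x) (B := B) (c := none) (σ := τ)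
    have hs := (hS x a (k + 1) (by omega)).2
    have hs' : a + (k + 1) + 1 ≤ (a + (k + 1) + 1) ^ 2 := Nat.le_self_pow (by norm_num) _
    obtain ⟨b, ρ, d1, d2⟩ := eval (τ.set (M + 1) (k + 1)) (k + 1) (fun ρ => Does x B
      (.loop (.ite (.op .test 0) (.sym (some true)) (.sym none)) <|
        .seq (.op .inc (M + 1)) <| .seq (copy M 0 (M + 2)) <| .seq (copy (M + 1) 1 (M + 2)) <|
        .seq pairing P) ρ fun τ => τ.head = 0 ∧ (∀ r ≥ M + 3, τ.reg r = σ.reg r) ∧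
          τ.reg 0 = F x a + 1) (by omega) t1 (by simp [t2]) (by simp)
      (fun r hr => by simp only [CState.set_reg]; (repeat rw [if_neg (by omega)]); try rw [t4 r hr])
      (ih (k + 1) · (by omega))
    obtain ⟨b', υ, d3, d4⟩ := d2
    refine ⟨b', υ, .step (b := b) (.iteF (by simpa [t5] using e1) (by simpa [symAt, t1] using e2))
      (.seq (.inc (by omega)) ?_) d3, d4⟩
    rw [t3]
    exact d1

end Imp

/-! Bounds that are polynomial in the input length, up to a computable function of the parameter -/

/-- `S` is bounded by a power of `g (κ x) + |x| + a + 2`, with `g` computable. -/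
def PolyBd (κ : List Bool → ℕ) (S : List Bool → ℕ → ℕ) : Prop :=
  ∃ (g : ℕ → ℕ) (c : ℕ), Computable g ∧ ∀ x a, S x a ≤ (g (κ x) + x.length + a + 2) ^ c

namespace PolyBd

variable {κ : List Bool → ℕ} {S S' : List Bool → ℕ → ℕ}

theorem mono (h : PolyBd κ S) (hS : ∀ x a, S' x a ≤ S x a) : PolyBd κ S' := by
  obtain ⟨g, c, h1, h2⟩ := h
  exact ⟨g, c, h1, fun x a => (hS x a).trans (h2 x a)⟩

theorem _root_.computable_add {f g : ℕ → ℕ} (hf : Computable f) (hg : Computable g) :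
    Computable fun n => f n + g n := Primrec.nat_add.to_comp.comp hf hg

theorem param {g : ℕ → ℕ} (hg : Computable g) : PolyBd κ fun x _ => g (κ x) :=
  ⟨g, 1, hg, fun x a => by simp only [pow_one]; omega⟩

theorem const (n : ℕ) : PolyBd κ fun _ _ => n := param (g := fun _ => n) (Computable.const n)

theorem arg : PolyBd κ fun _ a => a :=
  ⟨fun _ => 0, 1, Computable.const 0, fun x a => by simp only [pow_one]; omega⟩

theorem length : PolyBd κ fun x _ => x.length :=
  ⟨fun _ => 0, 1, Computable.const 0, fun x a => by simp only [pow_one]; omega⟩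

theorem mul (h : PolyBd κ S) (h' : PolyBd κ S') : PolyBd κ fun x a => S x a * S' x a := by
  obtain ⟨g, c, h1, h2⟩ := h
  obtain ⟨g', c', h3, h4⟩ := h'
  refine ⟨fun n => g n + g' n, c + c', computable_add h1 h3, fun x a => ?_⟩
  rw [pow_add]
  refine Nat.mul_le_mul ((h2 x a).trans ?_) ((h4 x a).trans ?_) <;>
  exact Nat.pow_le_pow_left (by dsimp only; omega) _

theorem add (h : PolyBd κ S) (h' : PolyBd κ S') : PolyBd κ fun x a => S x a + S' x a := by
  obtain ⟨g, c, h1, h2⟩ := h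
  obtain ⟨g', c', h3, h4⟩ := h'
  refine ⟨fun n => g n + g' n, max c c' + 1, computable_add h1 h3, fun x a => ?_⟩
  set y := g (κ x) + g' (κ x) + x.length + a + 2
  have e1 : S x a ≤ y ^ max c c' :=
    (h2 x a).trans ((Nat.pow_le_pow_left (by omega) _).trans
      (Nat.pow_le_pow_right (by omega) (le_max_left _ _)))
  have e2 : S' x a ≤ y ^ max c c' :=
    (h4 x a).trans ((Nat.pow_le_pow_left (by omega) _).trans
      (Nat.pow_le_pow_right (by omega) (le_max_right _ _)))
  calc S x a + S' x a ≤ y ^ max c c' * 2 := by omega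
    _ ≤ y ^ max c c' * y := Nat.mul_le_mul_left _ (by omega)
    _ = _ := by rw [pow_succ]

theorem pow (h : PolyBd κ S) (n : ℕ) : PolyBd κ fun x a => S x a ^ n := by
  induction n with
  | zero => simpa using const 1
  | succ n ih => simpa only [pow_succ] using ih.mul h

theorem comp (h : PolyBd κ S) (h' : PolyBd κ S') : PolyBd κ fun x a => S x (S' x a) := by
  obtain ⟨g, c, h1, h2⟩ := h
  exact ((((param h1).add length).add h').add (const 2) |>.pow c).mono fun x a => h2 x _

theorem pair (h : PolyBd κ S) (h' : PolyBd κ S') :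
    PolyBd κ fun x a => Nat.pair (S x a) (S' x a) :=
  (((h.add h').add (const 1)).pow 2).mono fun x a =>
    (Nat.pair_lt_max_add_one_sq _ _).le.trans (Nat.pow_le_pow_left (by omega) 2)

/-- Bounds are often needed at intermediate values of which only upper bounds are known. -/
theorem exists_monotone (h : PolyBd κ S) :
    ∃ S', PolyBd κ S' ∧ (∀ x a, S x a ≤ S' x a) ∧ ∀ x, Monotone (S' x) := by
  obtain ⟨g, c, h1, h2⟩ := h
  exact ⟨fun x a => (g (κ x) + x.length + a + 2) ^ c, ⟨g, c, h1, fun _ _ => le_rfl⟩, h2,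
    fun x a b hab => Nat.pow_le_pow_left (by omega) _⟩

end PolyBd

/-! ### The class of functions computable within polynomially bounded values -/

/-- Unary functions implemented by counter programs within such a bound. -/
def LogFun (κ : List Bool → ℕ) (f : List Bool → ℕ → ℕ) : Prop :=
  ∃ S, Imp f S ∧ PolyBd κ S

namespace LogFun

variable {κ : List Bool → ℕ} {f g : List Bool → ℕ → ℕ}

theorem polyBd (h : LogFun κ f) : PolyBd κ f := by
  obtain ⟨S, h1, h2⟩ := h
  exact (h2.add .arg).mono fun x a => (h1.le x a).trans (by omega)

theorem comp (hf : LogFun κ f) (hg : LogFun κ g) : LogFun κ fun x a => f x (g x a) := by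
  have hg' := hg.polyBd
  obtain ⟨S, h1, h2⟩ := hf
  obtain ⟨T, h3, h4⟩ := hg
  exact ⟨_, h1.comp h3, h4.add (h2.comp hg')⟩

theorem pair (hf : LogFun κ f) (hg : LogFun κ g) :
    LogFun κ fun x a => Nat.pair (f x a) (g x a) := by
  have hf' := hf.polyBd
  have hg' := hg.polyBd
  obtain ⟨S, h1, h2⟩ := hf
  obtain ⟨T, h3, h4⟩ := hg
  exact ⟨_, h1.pair h3, ((PolyBd.arg.add h2).add h4).add (((hf'.add hg').add (.const 1)).pow 2)⟩

theorem id : LogFun κ fun _ a => a := ⟨_, .id, .const 0⟩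
theorem zero : LogFun κ fun _ _ => 0 := ⟨_, .zero, .const 0⟩
theorem succ : LogFun κ fun _ a => a + 1 := ⟨_, .succ, .add .arg (.const 1)⟩
theorem left : LogFun κ fun _ a => a.unpair.1 := ⟨_, .left, .add .arg (.const 1)⟩
theorem right : LogFun κ fun _ a => a.unpair.2 := ⟨_, .right, .add .arg (.const 1)⟩
theorem inputSym : LogFun κ inputSym := ⟨_, .inputSym, .const 2⟩

theorem _root_.Nat.pair_mono {a b c d : ℕ} (h : a ≤ c) (h' : b ≤ d) :
    Nat.pair a b ≤ Nat.pair c d := by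
  rcases h.eq_or_lt with rfl | h
  · rcases h'.eq_or_lt with rfl | h'
    · rfl
    · exact (Nat.pair_lt_pair_right _ h').le
  · rcases h'.eq_or_lt with rfl | h'
    · exact (Nat.pair_lt_pair_left _ h).le
    · exact ((Nat.pair_lt_pair_left _ h).trans (Nat.pair_lt_pair_right _ h')).le

/-- Without the bound `B` on all values of the recursion their size could grow in every round. With
it, each round works on numbers below one common polynomial bound, and the space is that of a single
round. -/
theorem prec (hf : LogFun κ f) (hg : LogFun κ g) (F : List Bool → ℕ → ℕ → ℕ)
    (h0 : ∀ x z, F x z 0 = f x z)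
    (h1 : ∀ x z n, F x z (n + 1) = g x (Nat.pair z (Nat.pair n (F x z n))))
    {B : List Bool → ℕ → ℕ} (hB : PolyBd κ B) (hF : ∀ x z n, F x z n ≤ B x (Nat.pair z n)) :
    LogFun κ fun x a => F x a.unpair.1 a.unpair.2 := by
  obtain ⟨S, f1, f2⟩ := hf
  obtain ⟨T, g1, g2⟩ := hg
  obtain ⟨B', b1, b2, b3⟩ := hB.exists_monotone
  obtain ⟨S', s1, s2, s3⟩ := f2.exists_monotone
  obtain ⟨T', t1, t2, t3⟩ := g2.exists_monotone
  refine ⟨fun x a => a + 1 + S' x a + T' x (Nat.pair a (Nat.pair a (B' x a))) +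
    (a + (a + B' x a + 1) ^ 2 + 1) ^ 2, f1.prec g1 F h0 h1 fun x z n => ?_, ?_⟩
  · have hz := Nat.left_le_pair z n
    have hn := Nat.right_le_pair z n
    set a := Nat.pair z n with ha
    refine ⟨by omega, ((s2 x z).trans (s3 x hz)).trans (by omega), fun i hi => ?_⟩
    have hFi : F x z i ≤ B' x a :=
      (hF x z i).trans ((b2 _ _).trans (b3 x (Nat.pair_mono le_rfl hi.le)))
    constructor
    · refine (t2 _ _).trans ((t3 x (?_ : _ ≤ Nat.pair a (Nat.pair a (B' x a)))).trans (by omega))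
      exact Nat.pair_mono hz (Nat.pair_mono (by omega) hFi)
    · refine le_trans ?_ (Nat.le_add_left _ _)
      refine Nat.pow_le_pow_left ?_ 2
      have : (i + F x z i + 1) ^ 2 ≤ (a + B' x a + 1) ^ 2 := Nat.pow_le_pow_left (by omega) 2
      omega
  · exact (((PolyBd.arg.add (.const 1)).add s1).add (t1.comp (.pair .arg (.pair .arg b1)))).add
      (((PolyBd.arg.add (((PolyBd.arg.add b1).add (.const 1)).pow 2)).add (.const 1)).pow 2)

end LogFun

/-! Computable functions -/

/-- The bound on the space is carried along as a primitive recursive function of its own, so nothing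
has to be known about the growth of `f`. -/
theorem exists_imp_of_primrec {f : ℕ → ℕ} (hf : Nat.Primrec f) :
    ∃ S : ℕ → ℕ, Primrec S ∧ Imp (fun _ => f) fun _ => S := by
  induction hf with
  | zero => exact ⟨_, Primrec.const 0, .zero⟩
  | succ => exact ⟨_, Primrec.succ, .succ⟩
  | left => exact ⟨_, Primrec.succ, .left⟩
  | right => exact ⟨_, Primrec.succ, .right⟩
  | @pair f g hf hg ihf ihg =>
    obtain ⟨S, s1, s2⟩ := ihf
    obtain ⟨T, t1, t2⟩ := ihg
    have pf := Primrec.nat_iff.2 hf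
    have pg := Primrec.nat_iff.2 hg
    have h3 : Primrec fun a => f a + g a + 1 :=
      Primrec.succ.comp (Primrec.nat_add.comp pf pg)
    refine ⟨_, ?_, s2.pair t2⟩
    simp only [sq]
    exact Primrec.nat_add.comp (Primrec.nat_add.comp (Primrec.nat_add.comp Primrec.id s1) t1)
      (Primrec.nat_mul.comp h3 h3)
  | @comp f g hf hg ihf ihg =>
    obtain ⟨S, s1, s2⟩ := ihf
    obtain ⟨T, t1, t2⟩ := ihg
    exact ⟨_, Primrec.nat_add.comp t1 (s1.comp (Primrec.nat_iff.2 hg)), s2.comp t2⟩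
  | @prec f g hf hg ihf ihg =>
    obtain ⟨S, s1, s2⟩ := ihf
    obtain ⟨T, t1, t2⟩ := ihg
    have pf := Primrec.nat_iff.2 hf
    have pg := Primrec.nat_iff.2 hg
    set F : ℕ → ℕ → ℕ := fun z n =>
      Nat.rec (f z) (fun y IH => g (Nat.pair z (Nat.pair y IH))) n with hF
    have pF : Primrec₂ F := by
      refine Primrec.nat_rec (f := f) (g := fun z p => g (Nat.pair z (Nat.pair p.1 p.2))) pf ?_
      exact pg.comp (Primrec₂.natPair.comp Primrec.fst (Primrec₂.natPair.comp
        (Primrec.fst.comp Primrec.snd) (Primrec.snd.comp Primrec.snd)))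
    set V : ℕ → ℕ → ℕ := fun z i => T (Nat.pair z (Nat.pair i (F z i))) +
      (z + (i + F z i + 1) * (i + F z i + 1) + 1) * (z + (i + F z i + 1) * (i + F z i + 1) + 1)
      with hV
    have pV : Primrec₂ V := by
      have q1 : Primrec₂ fun z i => i + F z i + 1 :=
        Primrec.succ.comp₂ (Primrec.nat_add.comp₂ Primrec₂.right pF)
      have q2 : Primrec₂ fun z i => z + (i + F z i + 1) * (i + F z i + 1) + 1 :=
        Primrec.succ.comp₂ (Primrec.nat_add.comp₂ Primrec₂.left (Primrec.nat_mul.comp₂ q1 q1))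
      refine Primrec.nat_add.comp₂ ?_ (Primrec.nat_mul.comp₂ q2 q2)
      exact t1.comp₂ (Primrec₂.natPair.comp₂ Primrec₂.left
        (Primrec₂.natPair.comp₂ Primrec₂.right pF))
    -- The sum of the bounds over all rounds of the recursion dominates each of them and is again
    -- primitive recursive.
    set W : ℕ → ℕ → ℕ := fun z n =>
      Nat.rec (S z) (fun y IH => IH + V z y) n with hW
    have pW : Primrec₂ W := by
      refine Primrec.nat_rec (f := S) (g := fun z p => p.2 + V z p.1) s1 ?_
      exact Primrec.nat_add.comp (Primrec.snd.comp Primrec.snd)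
        (pV.comp Primrec.fst (Primrec.fst.comp Primrec.snd))
    have hW1 : ∀ z n, S z ≤ W z n := by
      intro z n
      induction n with
      | zero => rfl
      | succ n ih => exact ih.trans (Nat.le_add_right _ _)
    have hW2 : ∀ z n, ∀ i < n, V z i ≤ W z n := by
      intro z n
      induction n with
      | zero => intro i hi; omega
      | succ n ih =>
        intro i hi
        rcases (Nat.lt_succ_iff_lt_or_eq.1 hi) with hi | rfl
        · exact (ih i hi).trans (Nat.le_add_right _ _)
        · exact Nat.le_add_left _ _
    refine ⟨fun a => a + 1 + W a.unpair.1 a.unpair.2, ?_, ?_⟩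
    · exact Primrec.nat_add.comp Primrec.succ (pW.comp (Primrec.fst.comp Primrec.unpair)
        (Primrec.snd.comp Primrec.unpair))
    · refine Imp.prec s2 t2 (fun _ => F) (fun _ _ => rfl) (fun _ _ _ => rfl) fun x z n => ?_
      simp only [Nat.unpair_pair]
      refine ⟨by omega, (hW1 z n).trans (by omega), fun i hi => ?_⟩
      have := hW2 z n i hi
      simp only [hV, ← sq] at this
      omega

/-- Every total computable function is implemented by a counter program with a computable bound
on the values. -/
theorem Computable.imp {u : ℕ → ℕ} (hu : Computable u) :
    ∃ S : ℕ → ℕ, Computable S ∧ Imp (fun _ => u) fun _ => S := by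
  obtain ⟨c, hc⟩ := Nat.Partrec.Code.exists_code.1 (Partrec.nat_iff.1 hu)
  have hex : ∀ n, ∃ k, (Nat.Partrec.Code.evaln k c n).isSome := by
    intro n
    have : u n ∈ c.eval n := by rw [hc]; exact Part.mem_some _
    obtain ⟨k, hk⟩ := Nat.Partrec.Code.evaln_complete.1 this
    exact ⟨k, by rw [Option.mem_def] at hk; simp [hk]⟩
  have hval : ∀ n k y, Nat.Partrec.Code.evaln k c n = some y → y = u n := by
    intro n k y h
    have := Nat.Partrec.Code.evaln_sound (k := k) (c := c) (n := n) (x := y) (by simp [h])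
    rw [hc] at this
    simpa using this
  -- The value plus one if the computation halts within the given fuel, and `0` otherwise: this is
  -- the form required by `Imp.search`. The function is primitive recursive, in contrast to `u`.
  set p : ℕ → ℕ := fun a => ((Nat.Partrec.Code.evaln a.unpair.2 c a.unpair.1).map Nat.succ).getD 0
    with hp
  have pp : Primrec p := by
    refine Primrec.option_getD.comp (Primrec.option_map ?_ (Primrec.succ.comp₂ Primrec₂.right))
      (Primrec.const 0)
    exact Nat.Partrec.Code.primrec_evaln.comp (((Primrec.snd.comp Primrec.unpair).pair
      (Primrec.const c)).pair (Primrec.fst.comp Primrec.unpair))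
  obtain ⟨S, s1, s2⟩ := exists_imp_of_primrec (Primrec.nat_iff.1 pp)
  set K : ℕ → ℕ := fun n => Nat.find (hex n) with hK
  -- The fuel that suffices is found by unbounded search, so it is computable; so is the sum of the
  -- bounds over all attempts up to it.
  have cK : Computable K := by
    have : Computable₂ fun n k => (Nat.Partrec.Code.evaln k c n).isSome :=
      (Primrec.option_isSome.comp (Nat.Partrec.Code.primrec_evaln.comp
        ((Primrec.snd.pair (Primrec.const c)).pair Primrec.fst))).to_comp
    refine (Partrec.rfind this.partrec₂).of_eq fun n => Part.eq_some_iff.2 (Nat.mem_rfind.2 ?_)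
    exact ⟨by simpa using (Nat.find_spec (hex n)).symm, fun {m} hm => by
      simpa using (Nat.find_min (hex n) hm)⟩
  set W : ℕ → ℕ → ℕ := fun z n => Nat.rec 0
    (fun k IH => IH + (S (Nat.pair z k) + (z + k + 1) * (z + k + 1))) n with hW
  have pW : Primrec₂ W := by
    refine Primrec.nat_rec (f := fun _ => 0) (g := fun z p => p.2 + (S (Nat.pair z p.1) +
      (z + p.1 + 1) * (z + p.1 + 1))) (Primrec.const 0) ?_
    have q : Primrec₂ fun (z : ℕ) (p : ℕ × ℕ) => z + p.1 + 1 :=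
      Primrec.succ.comp (Primrec.nat_add.comp Primrec.fst (Primrec.fst.comp Primrec.snd))
    refine Primrec.nat_add.comp (Primrec.snd.comp Primrec.snd) (Primrec.nat_add.comp (s1.comp
      (Primrec₂.natPair.comp Primrec.fst (Primrec.fst.comp Primrec.snd)))
      (Primrec.nat_mul.comp q q))
  have hW2 : ∀ z n, ∀ k < n, S (Nat.pair z k) + (z + k + 1) * (z + k + 1) ≤ W z n := by
    intro z n
    induction n with
    | zero => intro i hi; omega
    | succ n ih =>
      intro i hi
      rcases (Nat.lt_succ_iff_lt_or_eq.1 hi) with hi | rfl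
      · exact (ih i hi).trans (Nat.le_add_right _ _)
      · exact Nat.le_add_left _ _
  refine ⟨fun n => W n (K n + 1), pW.to_comp.comp Computable.id (Computable.succ.comp cK),
    s2.search (fun _ => u) (fun _ => K) (fun x a k hk => ?_) (fun x a => ?_) fun x a k hk => ?_⟩
  · have := Nat.find_min (hex a) hk
    simp only [Bool.not_eq_true, Option.isSome_eq_false_iff, Option.isNone_iff_eq_none] at this
    simp [hp, this]
  · obtain ⟨y, hy⟩ := Option.isSome_iff_exists.1 (Nat.find_spec (hex a))
    simp only [hp, Nat.unpair_pair, hK, hy]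
    simp [hval _ _ _ hy]
  · have := hW2 a (K a + 1) k (by omega)
    rw [← sq] at this
    omega

/-- The program for `u` may use an enormous amount of space, but on arguments up to `H (κ x)` this
amount is bounded by a computable function of the parameter, namely the sum of the bounds over all
these arguments. -/
theorem LogFun.computable {κ : List Bool → ℕ} {f : List Bool → ℕ → ℕ} (hf : LogFun κ f)
    {u H : ℕ → ℕ} (hu : Computable u) (hH : Computable H) (h : ∀ x a, f x a ≤ H (κ x)) :
    LogFun κ fun x a => u (f x a) := by
  obtain ⟨S, h1, h2⟩ := hf
  obtain ⟨T, t1, t2⟩ := hu.imp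
  set W : ℕ → ℕ := fun n => Nat.rec 0 (fun k IH => IH + T k) n with hW
  have cW : Computable W := by
    refine Computable.nat_rec (f := fun n => n) (g := fun _ => 0) (h := fun _ p => p.2 + T p.1)
      Computable.id (Computable.const 0) ?_
    exact Primrec.nat_add.to_comp.comp (Computable.snd.comp Computable.snd)
      (t1.comp (Computable.fst.comp Computable.snd))
  have hW2 : ∀ n, ∀ k < n, T k ≤ W n := by
    intro n
    induction n with
    | zero => intro i hi; omega
    | succ n ih =>
      intro i hi
      rcases (Nat.lt_succ_iff_lt_or_eq.1 hi) with hi | rfl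
      · exact (ih i hi).trans (Nat.le_add_right _ _)
      · exact Nat.le_add_left _ _
  exact ⟨_, (t2.comp h1).mono (S := fun x a => S x a + W (H (κ x) + 1)) fun x a =>
    Nat.add_le_add_left (hW2 _ _ (Nat.lt_succ_of_le (h x a))) _,
    h2.add (.param (g := fun n => W (H n + 1)) (cW.comp (Computable.succ.comp hH)))⟩

/-! Functions on inputs, numbers, and tuples of them -/

/-- Types whose elements are represented by numbers, relative to an input. -/
class NumRep (α : Type) where
  dec : List Bool → ℕ → α

instance : NumRep ℕ := ⟨fun _ n => n⟩
instance : NumRep Prop := ⟨fun _ n => n ≠ 0⟩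
-- The only string that is ever represented is the input itself, and every number represents it.
instance : NumRep (List Bool) := ⟨fun x _ => x⟩
instance {α β : Type} [NumRep α] [NumRep β] : NumRep (α × β) :=
  ⟨fun x n => (NumRep.dec x n.unpair.1, NumRep.dec x n.unpair.2)⟩

/-- A parameter. -/
structure InputParam where
  val : List Bool → ℕ

/-- `f` is computable on representing numbers within the space allowed for the parameter `κ`. -/
@[fun_prop]
def PL (κ : InputParam) {α β : Type} [NumRep α] [NumRep β] (f : α → β) : Prop :=
  ∃ g, LogFun κ.val g ∧ ∀ x n, (NumRep.dec x (g x n) : β) = f (NumRep.dec x n)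

variable {κ : InputParam} {α β γ : Type} [NumRep α] [NumRep β] [NumRep γ]

namespace PL

@[fun_prop]
theorem id : PL κ fun a : α => a := ⟨_, .id, fun _ _ => rfl⟩

@[fun_prop]
theorem comp {f : β → γ} {g : α → β} (hf : PL κ f) (hg : PL κ g) : PL κ fun a => f (g a) := by
  obtain ⟨f', h1, h2⟩ := hf
  obtain ⟨g', h3, h4⟩ := hg
  exact ⟨_, h1.comp h3, fun x n => by rw [h2, h4]⟩

@[fun_prop]
theorem prodMk {f : α → β} {g : α → γ} (hf : PL κ f) (hg : PL κ g) : PL κ fun a => (f a, g a) := by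
  obtain ⟨f', h1, h2⟩ := hf
  obtain ⟨g', h3, h4⟩ := hg
  exact ⟨_, h1.pair h3, fun x n => by simp [NumRep.dec, ← h2, ← h4]⟩

@[fun_prop]
theorem fst {f : α → β × γ} (hf : PL κ f) : PL κ fun a => (f a).1 :=
  comp (f := Prod.fst) ⟨_, .left, fun _ _ => rfl⟩ hf

@[fun_prop]
theorem snd {f : α → β × γ} (hf : PL κ f) : PL κ fun a => (f a).2 :=
  comp (f := Prod.snd) ⟨_, .right, fun _ _ => rfl⟩ hf

theorem succ {f : α → ℕ} (hf : PL κ f) : PL κ fun a => f a + 1 :=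
  comp (f := fun n : ℕ => n + 1) ⟨_, .succ, fun _ _ => rfl⟩ hf

@[fun_prop]
theorem const (n : ℕ) : PL κ fun _ : α => n := by
  induction n with
  | zero => exact ⟨_, .zero, fun _ _ => rfl⟩
  | succ n ih => exact ih.succ


theorem congr {f g : α → β} (hf : PL κ f) (h : ∀ a, f a = g a) : PL κ g := by
  rwa [funext h] at hf

theorem logFun {f : List Bool × ℕ → ℕ} (hf : PL κ f) : LogFun κ.val fun x n => f (x, n) := by
  obtain ⟨g, h1, h2⟩ := hf
  -- The component representing the input is immaterial; `0` is taken.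
  have := h1.comp (LogFun.pair .zero .id)
  convert this using 3 with x n
  have := h2 x (Nat.pair 0 n)
  simp only [NumRep.dec, Nat.unpair_pair] at this
  exact this.symm

theorem natRec {base : α → ℕ} {step : α → ℕ → ℕ → ℕ} (F : α → ℕ → ℕ) (hb : PL κ base)
    (hs : PL κ fun p : α × ℕ × ℕ => step p.1 p.2.1 p.2.2) (h0 : ∀ a, F a 0 = base a)
    (h1 : ∀ a n, F a (n + 1) = step a n (F a n)) {B : List Bool → ℕ → ℕ}
    (hB : PolyBd κ.val B) (hF : ∀ x z n, F (NumRep.dec x z) n ≤ B x (Nat.pair z n))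
    {f : α → ℕ} (hf : PL κ f) : PL κ fun a => F a (f a) := by
  obtain ⟨base', b1, b2⟩ := hb
  obtain ⟨step', s1, s2⟩ := hs
  have := b1.prec s1 (fun x z n => F (NumRep.dec x z) n) (fun x z => (h0 _).trans (b2 x z).symm)
    (fun x z n => (h1 _ _).trans ?_) hB hF
  · have key : PL κ fun p : α × ℕ => F p.1 p.2 := ⟨_, this, fun _ _ => rfl⟩
    exact key.comp (id.prodMk hf)
  · have := s2 x (Nat.pair z (Nat.pair n (F (NumRep.dec x z) n)))
    simpa [NumRep.dec] using this.symm

/-- A function computable within the allowed space is polynomially bounded, so it can serve as the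
bound needed for recursion. -/
theorem natRec_of_le {base : α → ℕ} {step : α → ℕ → ℕ → ℕ} (F : α → ℕ → ℕ) (hb : PL κ base)
    (hs : PL κ fun p : α × ℕ × ℕ => step p.1 p.2.1 p.2.2) (h0 : ∀ a, F a 0 = base a)
    (h1 : ∀ a n, F a (n + 1) = step a n (F a n)) {B : α → ℕ → ℕ}
    (hB : PL κ fun p : α × ℕ => B p.1 p.2) (hF : ∀ a n, F a n ≤ B a n)
    {f : α → ℕ} (hf : PL κ f) : PL κ fun a => F a (f a) := by
  obtain ⟨B', b1, b2⟩ := hB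
  refine natRec F hb hs h0 h1 b1.polyBd (fun x z n => ?_) hf
  have := b2 x (Nat.pair z n)
  simp only [NumRep.dec, Nat.unpair_pair] at this
  rw [this]
  exact hF _ _

section Arithmetic

variable {f g : α → ℕ} {p q : α → Prop}

theorem apply₂ {F : ℕ → ℕ → ℕ} (hF : PL κ fun p : ℕ × ℕ => F p.1 p.2) (hf : PL κ f)
    (hg : PL κ g) : PL κ fun a => F (f a) (g a) := hF.comp (hf.prodMk hg)

@[fun_prop]
theorem add (hf : PL κ f) (hg : PL κ g) : PL κ fun a => f a + g a := by
  refine apply₂ ?_ hf hg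
  have key : ∀ {f : ℕ × ℕ → ℕ}, PL κ f → PL κ fun a : ℕ × ℕ => a.1 + f a := fun hf =>
    natRec (α := ℕ × ℕ) (base := fun a => a.1) (step := fun _ _ y => y + 1) (fun a n => a.1 + n)
      (by fun_prop)
      (succ (by fun_prop)) (fun _ => rfl) (fun _ _ => rfl) (B := fun _ a => a + a)
      (PolyBd.arg.add .arg) (fun x z n => Nat.add_le_add ((Nat.unpair_left_le z).trans
        (Nat.left_le_pair z n)) (Nat.right_le_pair z n)) hf
  exact key (by fun_prop)

theorem pred (hf : PL κ f) : PL κ fun a => f a - 1 :=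
  natRec_of_le (fun _ n => n - 1) (const 0) (step := fun _ n _ => n) (by fun_prop) (fun _ => rfl)
    (fun _ _ => rfl) (B := fun _ n => n) (by fun_prop) (fun _ _ => Nat.sub_le _ _) hf

@[fun_prop]
theorem sub (hf : PL κ f) (hg : PL κ g) : PL κ fun a => f a - g a :=
  natRec_of_le (fun a n => f a - n) hf (step := fun _ _ y => y - 1) (pred (by fun_prop))
    (fun _ => rfl) (fun _ _ => rfl) (B := fun a _ => f a) (by fun_prop) (fun _ _ => Nat.sub_le _ _)
    hg

@[fun_prop]
theorem mul (hf : PL κ f) (hg : PL κ g) : PL κ fun a => f a * g a := by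
  refine apply₂ ?_ hf hg
  have key : ∀ {f : ℕ × ℕ → ℕ}, PL κ f → PL κ fun a : ℕ × ℕ => a.1 * f a := fun hf =>
    natRec (α := ℕ × ℕ) (step := fun a _ y => y + a.1) (fun a n => a.1 * n) (const 0)
      (by fun_prop) (fun _ => rfl) (fun _ _ => rfl) (B := fun _ a => a * a)
      (PolyBd.arg.mul .arg) (fun x z n => Nat.mul_le_mul ((Nat.unpair_left_le z).trans
        (Nat.left_le_pair z n)) (Nat.right_le_pair z n)) hf
  exact key (by fun_prop)

/-- A number representing a proposition gives rise to the proposition. -/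
theorem ne_zero (hf : PL κ f) : PL κ fun a => f a ≠ 0 := by
  obtain ⟨f', h1, h2⟩ := hf
  exact ⟨f', h1, fun x n => by simp only [NumRep.dec] at h2 ⊢; rw [h2]⟩

/-- Passing to representing numbers replaces logical connectives by arithmetic on truth values. -/
theorem exists_num (hp : PL κ p) : ∃ f : List Bool × ℕ → ℕ, PL κ f ∧
    ∀ x n, (f (x, n) ≠ 0) = p (NumRep.dec x n) := by
  obtain ⟨p', h1, h2⟩ := hp
  refine ⟨fun a => p' a.1 a.2, ⟨fun x n => p' x n.unpair.2, h1.comp .right, fun _ _ => rfl⟩,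
    fun x n => h2 x n⟩

theorem of_num {f : List Bool × ℕ → ℕ} {β : Type} [NumRep β] {F : α → β} (hf : PL κ f)
    (h : ∀ x n, (NumRep.dec x (f (x, n)) : β) = F (NumRep.dec x n)) : PL κ F := by
  have := hf.logFun
  exact ⟨_, this, h⟩

@[fun_prop]
theorem not (hp : PL κ p) : PL κ fun a => ¬ p a := by
  obtain ⟨f, h1, h2⟩ := exists_num hp
  refine of_num (f := fun a => 1 - f a) (by fun_prop) fun x n => ?_
  rw [← h2]
  simp only [NumRep.dec, ne_eq, not_not, eq_iff_iff]
  omega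

@[fun_prop]
theorem and (hp : PL κ p) (hq : PL κ q) : PL κ fun a => p a ∧ q a := by
  obtain ⟨f, h1, h2⟩ := exists_num hp
  obtain ⟨g, h3, h4⟩ := exists_num hq
  refine of_num (f := fun a => f a * g a) (by fun_prop) fun x n => ?_
  rw [← h2, ← h4]
  simp [NumRep.dec]

@[fun_prop]
theorem or (hp : PL κ p) (hq : PL κ q) : PL κ fun a => p a ∨ q a := by
  obtain ⟨f, h1, h2⟩ := exists_num hp
  obtain ⟨g, h3, h4⟩ := exists_num hq
  refine of_num (f := fun a => f a + g a) (by fun_prop) fun x n => ?_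
  rw [← h2, ← h4]
  simp only [NumRep.dec, ne_eq, Nat.add_eq_zero_iff, eq_iff_iff]
  tauto

@[fun_prop]
theorem le (hf : PL κ f) (hg : PL κ g) : PL κ fun a => f a ≤ g a :=
  (ne_zero (f := fun a => 1 - (f a - g a)) (by fun_prop)).congr fun a => by
    simp only [ne_eq, eq_iff_iff]; omega

@[fun_prop]
theorem lt (hf : PL κ f) (hg : PL κ g) : PL κ fun a => f a < g a :=
  (ne_zero (f := fun a => g a - f a) (by fun_prop)).congr fun a => by
    simp only [ne_eq, eq_iff_iff]; omega

@[fun_prop]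
theorem eq (hf : PL κ f) (hg : PL κ g) : PL κ fun a => f a = g a :=
  (and (le hf hg) (le hg hf)).congr fun a => by simp only [eq_iff_iff]; omega

@[fun_prop]
theorem ite [hd : ∀ a, Decidable (p a)] {f g : α → β} (hp : PL κ p) (hf : PL κ f) (hg : PL κ g) :
    PL κ fun a => if p a then f a else g a := by
  obtain ⟨c, h1, h2⟩ := exists_num hp
  obtain ⟨f', f1, f2⟩ := hf
  obtain ⟨g', g1, g2⟩ := hg
  have hf' : PL κ fun a : List Bool × ℕ => f' a.1 a.2 :=
    ⟨fun x n => f' x n.unpair.2, f1.comp .right, fun _ _ => rfl⟩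
  have hg' : PL κ fun a : List Bool × ℕ => g' a.1 a.2 :=
    ⟨fun x n => g' x n.unpair.2, g1.comp .right, fun _ _ => rfl⟩
  -- Definition by cases as arithmetic: `1 - c` is one exactly if `c = 0`, and `1 - (1 - c)` is the
  -- complementary truth value.
  refine of_num (f := fun a => (1 - (1 - c a)) * f' a.1 a.2 + (1 - c a) * g' a.1 a.2)
    (by fun_prop) fun x n => ?_
  have h := h2 x n
  by_cases hc : c (x, n) = 0
  · rw [if_neg (by rw [← h]; simp [hc]), ← g2]
    simp [hc]
  · rw [if_pos (by rw [← h]; simp [hc]), ← f2]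
    have : 1 - c (x, n) = 0 := by omega
    simp [this]

@[fun_prop]
theorem min (hf : PL κ f) (hg : PL κ g) : PL κ fun a => min (f a) (g a) :=
  (ite (le hf hg) hf hg).congr fun _ => rfl

end Arithmetic

end PL

/-! Bounded quantifiers, sums and search -/

def BAll (n : ℕ) (p : ℕ → Prop) : Prop := ∀ i < n, p i

def BEx (n : ℕ) (p : ℕ → Prop) : Prop := ∃ i < n, p i

open Classical in
/-- The least `i < n` such that `p i`, or `n` if there is none. -/
noncomputable def bfind (n : ℕ) (p : ℕ → Prop) : ℕ :=
  Nat.rec 0 (fun i y => if y < i then y else if p i then i else i + 1) n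

theorem bfind_le (n : ℕ) (p : ℕ → Prop) : bfind n p ≤ n := by
  classical
  induction n with
  | zero => exact le_rfl
  | succ n ih =>
    change (if bfind n p < n then bfind n p else if p n then n else n + 1) ≤ n + 1
    split_ifs <;> omega

theorem bfind_spec {n : ℕ} {p : ℕ → Prop} : (∀ i < bfind n p, ¬ p i) ∧
    (bfind n p < n → p (bfind n p)) := by
  classical
  induction n with
  | zero => exact ⟨fun i hi => absurd hi (Nat.not_lt_zero _), fun h => absurd h (Nat.not_lt_zero _)⟩
  | succ n ih =>
    have hle := bfind_le n p
    have e : bfind (n + 1) p = if bfind n p < n then bfind n p else if p n then n else n + 1 := rfl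
    obtain ⟨h1, h2⟩ := ih
    split_ifs at e with h3 h4
    · rw [e]
      exact ⟨h1, fun _ => h2 h3⟩
    · rw [e]
      exact ⟨fun i hi => h1 i (by omega), fun _ => h4⟩
    · rw [e]
      refine ⟨fun i hi => ?_, fun h => absurd h (lt_irrefl _)⟩
      rcases Nat.lt_succ_iff_lt_or_eq.1 hi with h | rfl
      · exact h1 i (by omega)
      · exact h4

theorem bfind_eq {n m : ℕ} {p : ℕ → Prop} (h1 : ∀ i < m, ¬ p i) (h2 : p m) (h : m < n) :
    bfind n p = m := by
  obtain ⟨h3, h4⟩ := bfind_spec (n := n) (p := p)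
  rcases lt_trichotomy (bfind n p) m with hl | hl | hl
  · exact absurd (h4 (by omega)) (h1 _ hl)
  · exact hl
  · exact absurd h2 (h3 _ hl)

theorem bfind_lt_iff {n : ℕ} {p : ℕ → Prop} : bfind n p < n ↔ ∃ i < n, p i := by
  obtain ⟨h3, h4⟩ := bfind_spec (n := n) (p := p)
  constructor
  · exact fun h => ⟨_, h, h4 h⟩
  · rintro ⟨i, hi, hp⟩
    by_contra h
    exact h3 i (by have := bfind_le n p; omega) hp

namespace PL

theorem sum {f : α → ℕ} {F : α → ℕ → ℕ} (hf : PL κ f)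
    (hF : PL κ fun p : α × ℕ => F p.1 p.2) : PL κ fun a => ∑ i ∈ Finset.range (f a), F a i := by
  obtain ⟨F', f1, f2⟩ := _root_.id hF
  obtain ⟨B, b1, b2, b3⟩ := f1.polyBd.exists_monotone
  refine natRec (fun a n => ∑ i ∈ Finset.range n, F a i) (const 0) (step := fun a n y => y + F a n)
    ?_ (fun _ => rfl) (fun a n => Finset.sum_range_succ _ _)
    (B := fun x a => a * B x a) (PolyBd.arg.mul b1) (fun x z n => ?_) hf
  · have : PL κ fun p : α × ℕ × ℕ => F p.1 p.2.1 :=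
      hF.comp (g := fun p : α × ℕ × ℕ => (p.1, p.2.1)) (by fun_prop)
    fun_prop
  · refine (Finset.sum_le_card_nsmul _ _ (B x (Nat.pair z n)) fun i hi => ?_).trans ?_
    · have := f2 x (Nat.pair z i)
      simp only [NumRep.dec, Nat.unpair_pair] at this
      rw [← this]
      exact (b2 _ _).trans (b3 x (Nat.pair_mono le_rfl (Finset.mem_range.1 hi).le))
    · rw [Finset.card_range, smul_eq_mul]
      exact Nat.mul_le_mul_right _ (Nat.right_le_pair _ _)

@[fun_prop]
theorem bfind {f : α → ℕ} {p : α → ℕ → Prop} (hf : PL κ f)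
    (hp : PL κ fun a : α × ℕ => p a.1 a.2) : PL κ fun a => bfind (f a) (p a) := by
  classical
  refine natRec_of_le (fun a n => _root_.bfind n (p a)) (const 0)
    (step := fun a i y => if y < i then y else if p a i then i else i + 1) ?_ (fun _ => rfl)
    (fun a n => rfl) (B := fun _ n => n) (by fun_prop) (fun _ _ => bfind_le _ _) hf
  have : PL κ fun q : α × ℕ × ℕ => p q.1 q.2.1 :=
    hp.comp (g := fun p : α × ℕ × ℕ => (p.1, p.2.1)) (by fun_prop)
  fun_prop

@[fun_prop]
theorem bEx {f : α → ℕ} {p : α → ℕ → Prop} (hf : PL κ f)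
    (hp : PL κ fun a : α × ℕ => p a.1 a.2) : PL κ fun a => BEx (f a) (p a) :=
  (lt (bfind hf hp) hf).congr fun a => by
    simp only [bfind_lt_iff, BEx]

@[fun_prop]
theorem bAll {f : α → ℕ} {p : α → ℕ → Prop} (hf : PL κ f)
    (hp : PL κ fun a : α × ℕ => p a.1 a.2) : PL κ fun a => BAll (f a) (p a) :=
  (not (bEx hf (p := fun a i => ¬ p a i) (by fun_prop))).congr fun a => by
    simp [BEx, BAll]

@[fun_prop]
theorem div {f g : α → ℕ} (hf : PL κ f) (hg : PL κ g) : PL κ fun a => f a / g a := by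
  classical
  have : PL κ fun a => if g a = 0 then 0 else _root_.bfind (f a + 1) fun q => f a < g a * (q + 1) := by
    fun_prop
  refine this.congr fun a => ?_
  split_ifs with h
  · simp [h]
  · have h1 := Nat.div_add_mod (f a) (g a)
    have h2 := Nat.mod_lt (f a) (Nat.pos_of_ne_zero h)
    refine bfind_eq (fun i hi hlt => ?_) (by rw [mul_add]; omega)
      (Nat.lt_succ_of_le (Nat.div_le_self _ _))
    have : g a * (i + 1) ≤ g a * (f a / g a) := Nat.mul_le_mul_left _ hi
    omega

@[fun_prop]
theorem mod {f g : α → ℕ} (hf : PL κ f) (hg : PL κ g) : PL κ fun a => f a % g a :=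
  (sub hf (mul hg (div hf hg))).congr fun _ => (Nat.mod_eq_sub_mul_div).symm

/-- The power may exceed every permitted bound, so it is never computed: the quotient is obtained by
dividing repeatedly. -/
theorem divPow {f g h : α → ℕ} (hf : PL κ f) (hg : PL κ g) (hh : PL κ h) :
    PL κ fun a => f a / g a ^ h a :=
  natRec_of_le (fun a n => f a / g a ^ n) hf (step := fun a _ y => y / g a) (by fun_prop)
    (fun _ => by simp) (fun a n => by rw [pow_succ, Nat.div_div_eq_div_mul])
    (B := fun a _ => f a) (by fun_prop) (fun _ _ => Nat.div_le_self _ _) hh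

end PL

/-! ### Digits, binary length, logarithm and length of the input -/

/-- The `i`-th bit of `n` is one. -/
def BitOn (n i : ℕ) : Prop := n.testBit i = true

/-- The `i`-th digit of `n` to base `b`. -/
def digit (b n i : ℕ) : ℕ := n / b ^ i % b

namespace PL

@[fun_prop]
theorem digit {f g h : α → ℕ} (hf : PL κ f) (hg : PL κ g) (hh : PL κ h) :
    PL κ fun a => digit (f a) (g a) (h a) := mod (divPow hg hf hh) hf

@[fun_prop]
theorem bitOn {f g : α → ℕ} (hf : PL κ f) (hg : PL κ g) : PL κ fun a => BitOn (f a) (g a) := by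
  have : PL κ fun a => _root_.digit 2 (f a) (g a) = 1 := by fun_prop
  refine this.congr fun a => ?_
  simp [BitOn, _root_.digit, Nat.testBit_eq_decide_div_mod_eq]

@[fun_prop]
theorem size {f : α → ℕ} (hf : PL κ f) : PL κ fun a => (f a).size := by
  have h2 : PL κ fun a : α × ℕ => f a.1 / 2 ^ a.2 := divPow (by fun_prop) (const 2) (by fun_prop)
  have : PL κ fun a => _root_.bfind (f a + 1) fun i => f a / 2 ^ i = 0 := by fun_prop
  refine this.congr fun a => bfind_eq (fun i hi h => ?_) ?_ ?_
  · rw [Nat.div_eq_zero_iff_lt (by positivity)] at h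
    exact absurd (Nat.size_le.2 h) (by omega)
  · rw [Nat.div_eq_zero_iff_lt (by positivity)]
    exact Nat.lt_size_self _
  · have : f a < 2 ^ f a := Nat.lt_two_pow_self
    exact Nat.lt_succ_of_le (Nat.size_le.2 this)

@[fun_prop]
theorem log {f : α → ℕ} (hf : PL κ f) : PL κ fun a => Nat.log 2 (f a) := by
  have : PL κ fun a => (f a).size - 1 := by fun_prop
  refine this.congr fun a => ?_
  rcases Nat.eq_zero_or_pos (f a) with h | h
  · simp [h]
  · have h1 := Nat.size_le (m := f a) (n := Nat.log 2 (f a) + 1) |>.2 (Nat.lt_pow_succ_log_self (by norm_num) _)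
    have h2 := Nat.lt_size (m := Nat.log 2 (f a)) (n := f a) |>.2 (Nat.pow_log_le_self 2 (by omega))
    omega

@[fun_prop]
theorem inputSym {f : α → List Bool} {g : α → ℕ} (hf : PL κ f) (hg : PL κ g) :
    PL κ fun a => inputSym (f a) (g a) :=
  comp (f := fun p : List Bool × ℕ => _root_.inputSym p.1 p.2)
    ⟨_, LogFun.inputSym.comp .right, fun _ _ => rfl⟩ (hf.prodMk hg)

theorem inputSym_eq_zero {x : List Bool} {i : ℕ} : _root_.inputSym x i = 0 ↔ x.length ≤ i := by
  rcases h : x[i]? with _ | _ | _ <;> simp [_root_.inputSym, h] <;>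
  first
  | exact List.getElem?_eq_none_iff.1 h
  | exact (List.getElem?_eq_some_iff.1 h).1

-- The first blank is found by an unbounded search, as no computable bound on the length is at hand
-- yet; the number of steps of the search is the length itself, which is polynomial.
@[fun_prop]
theorem length {f : α → List Bool} (hf : PL κ f) : PL κ fun a => (f a).length := by
  classical
  have h1 : PL κ fun p : List Bool × ℕ => if _root_.inputSym p.1 p.2.unpair.2 = 0
      then p.2.unpair.2 + 1 else 0 := by
    have : PL κ fun p : List Bool × ℕ => p.2.unpair.2 :=
      comp (f := fun n : ℕ => n.unpair.2) ⟨_, .right, fun _ _ => rfl⟩ (by fun_prop)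
    fun_prop
  obtain ⟨S, s1, s2⟩ := h1.logFun
  obtain ⟨T, t1, t2, t3⟩ := s2.exists_monotone
  refine comp (f := fun x : List Bool => x.length) ⟨_, ⟨_, s1.search (fun x _ => x.length)
    (fun x _ => x.length) (fun x a k hk => ?_) (fun x a => ?_) (S := fun x a =>
      T x (Nat.pair a x.length) + (a + x.length + 1) ^ 2) fun x a k hk => ⟨?_, ?_⟩, ?_⟩,
    fun _ _ => rfl⟩ hf
  · simp [inputSym_eq_zero, hk]
  · simp [inputSym_eq_zero]
  · exact ((t2 _ _).trans (t3 x (Nat.pair_mono le_rfl hk))).trans (Nat.le_add_right _ _)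
  · exact (Nat.pow_le_pow_left (by omega) 2).trans (Nat.le_add_left _ _)
  · exact (t1.comp (.pair .arg .length)).add (((PolyBd.arg.add .length).add (.const 1)).pow 2)

theorem computable {f : α → ℕ} {u H : ℕ → ℕ} (hf : PL κ f) (hu : Computable u)
    (hH : Computable H) (h : ∀ x n, f (NumRep.dec x n) ≤ H (κ.val x)) : PL κ fun a => u (f a) := by
  obtain ⟨g, h1, h2⟩ := hf
  simp only [NumRep.dec] at h2
  exact ⟨_, h1.computable hu hH fun x n => (h2 x n).trans_le (h x n), fun x n => congrArg u (h2 x n)⟩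

end PL

/-! Machines from functions on configuration numbers -/

open Prog in
-- Counter `K` keeps the argument, `T` receives the value and `U` is scratch. Since the argument
-- survives, several functions can be evaluated at it in succession.
theorem Imp.into {f S : List Bool → ℕ → ℕ} (hf : Imp f S) :
    ∃ N, 0 < N ∧ ∀ K T U, N ≤ K → N ≤ T → N ≤ U → K ≠ T → K ≠ U → T ≠ U →
      ∃ Q : Prog, Q.Below (max (max K T) U + 1) ∧ ∀ x σ B, σ.head = 0 →
        S x (σ.reg K) + σ.reg K + f x (σ.reg K) ≤ B → Q.Does x B σ fun σ' => σ'.head = 0 ∧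
          σ'.reg T = f x (σ.reg K) ∧ ∀ r ≥ N, r ≠ T → r ≠ U → σ'.reg r = σ.reg r := by
  obtain ⟨P, N, h1, h0, h2⟩ := hf
  refine ⟨N, h0, fun K T U hK hT hU hKT hKU hTU => ⟨.seq (copy K 0 U) (.seq P (copy 0 T U)), ?_,
    fun x σ B h hB => ?_⟩⟩
  · have b1 := h1.mono (show N ≤ max (max K T) U + 1 by omega)
    simp only [Below, copy, clear, repeated, nop, move₂, Prog.move, b1]
    and_intros <;> first | omega | trivial
  · refine .seq <| does_copy (by omega) (by omega) (by omega) (by omega) <| .seq <|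
      (h2 x _ B (by simpa using h) ?_).mono fun σ1 ⟨p1, p2, p3⟩ =>
        does_copy (by omega) (by omega) (by omega) ?_ ⟨?_, ?_, fun r hr hrT hrU => ?_⟩
    · simp [show 0 ≠ U by omega]; omega
    · rw [p2]; simp [show 0 ≠ U by omega]; omega
    · simpa using p1
    · simp [hTU, p2, show 0 ≠ U by omega]
    · simp only [CState.set_reg, if_neg hrU, if_neg hrT]
      rw [p3 r hr]
      simp only [CState.set_reg, if_neg hrU, if_neg (show r ≠ 0 by omega)]

open Prog in
theorem exists_stepsTo {κ : List Bool → ℕ} {f₁ f₂ f₃ : List Bool → ℕ → ℕ} (h₁ : LogFun κ f₁)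
    (h₂ : LogFun κ f₂) (h₃ : LogFun κ f₃) : ∃ (D : Prog) (p q k : ℕ) (S : List Bool → ℕ → ℕ),
      D.Below (k + 1) ∧ p ≤ k ∧ q ≤ k ∧ PolyBd κ S ∧ (∀ x, Monotone (S x)) ∧
      ∀ x B a, S x a ≤ B →
        D.StepsTo p q x B a ((decide (f₁ x a ≠ 0), decide (f₂ x a ≠ 0)), f₃ x a) := by
  have b1 := h₁.polyBd
  have b2 := h₂.polyBd
  obtain ⟨S₁, i₁, s₁⟩ := h₁
  obtain ⟨S₂, i₂, s₂⟩ := h₂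
  obtain ⟨S₃, i₃, s₃⟩ := h₃
  obtain ⟨N₁, n₁, i₁⟩ := i₁.into
  obtain ⟨N₂, n₂, i₂⟩ := i₂.into
  obtain ⟨P, N₃, t₁, n₃, t₂⟩ := i₃
  set K := max (max N₁ N₂) N₃ with hK
  obtain ⟨Q₁, q₁, r₁⟩ := i₁ K (K + 1) (K + 3) (by omega) (by omega) (by omega) (by omega) (by omega)
    (by omega)
  obtain ⟨Q₂, q₂, r₂⟩ := i₂ K (K + 2) (K + 3) (by omega) (by omega) (by omega) (by omega) (by omega)
    (by omega)
  obtain ⟨S, m1, m2, m3⟩ := ((((s₁.add s₂).add s₃).add .arg).add (b1.add b2)).exists_monotone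
  refine ⟨.seq (copy 0 K (K + 3)) <| .seq Q₁ <| .seq Q₂ <| .seq (copy K 0 (K + 3)) P, K + 1, K + 2,
    K + 3, S, ?_, by omega, by omega, m1, m3, fun x B a hB σ h ha => ?_⟩
  · have e1 := q₁.mono (show _ ≤ K + 3 + 1 by omega)
    have e2 := q₂.mono (show _ ≤ K + 3 + 1 by omega)
    have e3 := t₁.mono (show _ ≤ K + 3 + 1 by omega)
    simp only [Below, copy, clear, repeated, nop, move₂, Prog.move, e1, e2, e3]
    and_intros <;> first | omega | trivial
  · have hB' := (m2 x a).trans hB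
    suffices hD : Does x B (.seq (copy 0 K (K + 3)) <| .seq Q₁ <| .seq Q₂ <|
        .seq (copy K 0 (K + 3)) P) σ fun σ' => σ'.head = 0 ∧ σ'.reg 0 = f₃ x a ∧
          σ'.reg (K + 1) = f₁ x a ∧ σ'.reg (K + 2) = f₂ x a by
      obtain ⟨b, σ', e1, e2, e3, e4, e5⟩ := hD
      exact ⟨b, σ', e1, e2, e3, by simp [e4], by simp [e5]⟩
    refine .seq <| does_copy (by omega) (by omega) (by omega) (by omega) <| .seq <|
      (r₁ x _ B (by simpa using h) (by simp [ha]; omega)).mono fun σ1 ⟨u1, u2, u3⟩ => ?_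
    have v1 : σ1.reg K = a := by
      rw [u3 K (by omega) (by omega) (by omega)]; simp [ha]
    refine .seq <| (r₂ x _ B u1 (by rw [v1]; omega)).mono fun σ2 ⟨u4, u5, u6⟩ => ?_
    have v2 : σ2.reg K = a := by rw [u6 K (by omega) (by omega) (by omega), v1]
    have v3 : σ2.reg (K + 1) = f₁ x a := by
      rw [u6 (K + 1) (by omega) (by omega) (by omega), u2]; simp [ha]
    refine .seq <| does_copy (by omega) (by omega) (by omega) (by omega) <|
      (t₂ x _ B (by simpa using u4) ?_).mono fun τ ⟨w1, w2, w3⟩ => ⟨w1, ?_, ?_, ?_⟩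
    · simp [v2]; omega
    · simpa [v2] using w2
    · rw [w3 _ (by omega)]; simp [v3]
    · rw [w3 _ (by omega)]; simp [u5, v1]

theorem add_le_two_pow_log (m n : ℕ) : m + n + 2 ≤ 2 ^ (m + Nat.log 2 n + 2) := by
  have h1 := Nat.lt_pow_succ_log_self (b := 2) (by norm_num) n
  have h2 : m + 1 < 2 ^ (m + 1) := Nat.lt_two_pow_self
  calc m + n + 2 ≤ (m + 2) * (n + 1) := by nlinarith
    _ ≤ 2 ^ (m + 1) * 2 ^ (Nat.log 2 n + 1) := Nat.mul_le_mul (by omega) (by omega)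
    _ = _ := by rw [← pow_add]; congr 1; omega

/-- The passage from values to space: a number below a fixed power of `g (κ x) + |x| + 2` has a
number of bits linear in `g (κ x) + log |x|`. The final `+ 1` only makes the inequality strict. -/
theorem PolyBd.space {κ : List Bool → ℕ} {B : List Bool → ℕ} (h : PolyBd κ fun x _ => B x) :
    ∃ (g : ℕ → ℕ) (c : ℕ), Computable g ∧
      ∀ x, B x < 2 ^ (c * (g (κ x) + Nat.log 2 x.length + 2) + 1) := by
  obtain ⟨g, c, h1, h2⟩ := h
  refine ⟨g, c, h1, fun x => (h2 x 0).trans_lt ?_⟩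
  rw [Nat.pow_succ]
  have := Nat.pow_le_pow_left (add_le_two_pow_log (g (κ x)) x.length) c
  rw [← pow_mul, mul_comm _ c] at this
  have hp : 0 < 2 ^ (c * (g (κ x) + Nat.log 2 x.length + 2)) := by positivity
  simp only [add_zero]
  omega

/-- The first component of the pair represented by a number. -/
def nfst (n : ℕ) : ℕ := n.unpair.1

/-- The second component of the pair represented by a number. -/
def nsnd (n : ℕ) : ℕ := n.unpair.2

@[simp]
theorem nfst_pair (a b : ℕ) : nfst (Nat.pair a b) = a := by simp [nfst]

@[simp]
theorem nsnd_pair (a b : ℕ) : nsnd (Nat.pair a b) = b := by simp [nsnd]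

namespace PL

variable {κ : InputParam} {α : Type} [NumRep α]

@[fun_prop]
theorem nfst {f : α → ℕ} (hf : PL κ f) : PL κ fun a => nfst (f a) :=
  comp (f := _root_.nfst) ⟨_, .left, fun _ _ => rfl⟩ hf

@[fun_prop]
theorem nsnd {f : α → ℕ} (hf : PL κ f) : PL κ fun a => nsnd (f a) :=
  comp (f := _root_.nsnd) ⟨_, .right, fun _ _ => rfl⟩ hf

@[fun_prop]
theorem natPair {f g : α → ℕ} (hf : PL κ f) (hg : PL κ g) : PL κ fun a => Nat.pair (f a) (g a) :=
  comp (f := fun p : ℕ × ℕ => Nat.pair p.1 p.2)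
    ⟨_, .pair .left .right, fun _ _ => rfl⟩ (hf.prodMk hg)

theorem polyBd {f : List Bool → ℕ} (hf : PL κ f) : PolyBd κ.val fun x _ => f x :=
  (logFun (f := fun p : List Bool × ℕ => f p.1) (by fun_prop)).polyBd

end PL

/-- A function that is computable in space logarithmic in the input length is a
parameterization. -/
theorem isParameterization_of_pl {f : List Bool → ℕ} (hf : PL ⟨fun _ => 0⟩ f) :
    IsParameterization f := by
  -- The configuration number `a` is the position of the bit to be emitted. The iteration stops as
  -- soon as the quotient by `2 ^ a` vanishes, hence without high-order zeros, as `Nat.bits`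
  -- demands.
  have hdiv : PL ⟨fun _ => 0⟩ fun p : List Bool × ℕ => f p.1 / 2 ^ p.2 :=
    PL.divPow (by fun_prop) (PL.const 2) (by fun_prop)
  have h1 := hdiv.logFun
  have h2 := (PL.mod hdiv (PL.const 2)).logFun
  obtain ⟨D, p, q, k, S, hD, hp, hq, hS, hmono, hF⟩ := exists_stepsTo h1 h2 .succ
  have hA : PolyBd (fun _ => 0) fun x _ => S x (f x + 1) :=
    hS.comp (hf.polyBd.add (.const 1))
  -- The parameter is constantly `0` here, so `g` contributes only the constant `g 0` and the space
  -- is logarithmic.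
  obtain ⟨g, c, -, hB⟩ := hA.space
  have main : ∀ x, (D.mainFrag p q k).transducing.Behaves x
      (c * (g 0 + Nat.log 2 x.length + 2) + 1 + 2) (f x).bits
      (D.mainFrag p q k).transducing.init := by
    intro x
    refine Emits.transducer (A := f x + 1) (fun a ha => hF x _ a (hmono x ha)) (hB x) hD hp hq ?_
    have key : ∀ (n i : ℕ), i ≤ f x + 1 → f x / 2 ^ i = n → Emits (fun a =>
        ((decide (f x / 2 ^ a ≠ 0), decide (f x / 2 ^ a % 2 ≠ 0)), a + 1)) (f x + 1) n.bits i := by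
      intro n
      induction n using Nat.strong_induction_on with
      | _ n ih =>
        intro i hi hn
        rcases Nat.eq_zero_or_pos n with rfl | hpos
        · rw [Nat.zero_bits]
          exact .halt hi (by simp [hn])
        · have hbits : n.bits = n.bodd :: n.div2.bits := by
            conv_lhs => rw [← Nat.bit_bodd_div2 n]
            refine Nat.bits_append_bit _ _ fun h => ?_
            have := Nat.bit_bodd_div2 n
            rw [h] at this
            cases hb : n.bodd <;> simp_all
          have hlt : i < f x := by
            have h3 : 2 ^ i ≤ f x := by
              by_contra h
              rw [Nat.div_eq_of_lt (by omega)] at hn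
              omega
            exact Nat.lt_two_pow_self.trans_le h3
          rw [hbits]
          refine .emit hi ?_ (ih _ ?_ _ (by omega) ?_)
          · simp only [hn, Nat.mod_two_of_bodd]
            cases n.bodd <;> simp [hpos.ne']
          · rw [Nat.div2_val]; omega
          · rw [pow_succ, ← Nat.div_div_eq_div_mul, hn, Nat.div2_val]
    exact key _ 0 (by omega) (by simp)
  refine ⟨_, ⟨c * (g 0 + 2) + c + 3, fun x d hd i => ?_⟩, fun x => (main x).reaches⟩
  refine ((main x).head_lt hd i).trans_le ?_
  nlinarith [Nat.zero_le (Nat.log 2 x.length), Nat.zero_le (c * (g 0 + 2) * Nat.log 2 x.length)]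

/-- A problem decided by a short play on configuration numbers is in `TREE`. -/
theorem mem_tree_of_play {κ : List Bool → ℕ} (hκ : IsParameterization κ) {Q : Set (List Bool)}
    {f₁ f₂ f₃ : List Bool → ℕ → ℕ} (h₁ : LogFun κ f₁) (h₂ : LogFun κ f₂) (h₃ : LogFun κ f₃)
    {A E U : List Bool → ℕ} (hA : PolyBd κ fun x _ => A x) {f : ℕ → ℕ} (hf : Computable f)
    (hE : ∀ x, E x ≤ f (κ x) * Nat.log 2 x.length) (hU : ∀ x, U x ≤ f (κ x))
    (h : ∀ x, Play (fun a => ((decide (f₁ x a ≠ 0), decide (f₂ x a ≠ 0)), f₃ x a)) (A x) (E x) (U x)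
      (x ∈ Q) 0) : (Q, κ) ∈ TREE := by
  obtain ⟨D, p, q, k, S, hD, hp, hq, hS, hmono, hF⟩ := exists_stepsTo h₁ h₂ h₃
  have hB' : PolyBd κ fun x _ => S x (A x) + A x := (hS.comp hA).add hA
  obtain ⟨g, c, hg, hB⟩ := hB'.space
  have main := fun x => (h x).altTM (B := S x (A x) + A x) (fun a ha => hF x _ a
    ((hmono x ha).trans (Nat.le_add_right _ _))) (Nat.le_add_left _ _) (hB x) hD hp hq
  refine ⟨hκ, f, hf, _, fun x => (main x).1, ⟨fun n => g n + 3, computable_add hg (.const 3), c + 1,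
    fun x l hl d hd i => ?_⟩, fun x l hl => ?_, fun x l hl => ?_⟩
  · refine ((main x).2 l hl).2.2 d hd i |>.trans_le ?_
    dsimp only
    nlinarith
  · exact ((main x).2 l hl).1.trans (hE x)
  · exact ((main x).2 l hl).2.1.trans (hU x)

/-! Games in rounds: an existential choice of a number, then a universal choice of a bit -/

/-- The data of a game in rounds on inputs: a status of every position (`0`: lost, `1`: won, other:
continue), the position after a choice of a number and a bit, the number of bits of the numbers, the
number of rounds, and the first position. -/
structure RoundGame where
  status : List Bool × ℕ → ℕ
  upd : List Bool × ℕ × ℕ × ℕ → ℕ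
  bits : List Bool → ℕ
  rounds : List Bool → ℕ
  start : List Bool → ℕ

namespace RoundGame

variable (G : RoundGame)

/-- The game is won from a position within the given number of rounds. -/
def Wins (x : List Bool) : ℕ → ℕ → Prop
  | 0, q => G.status (x, q) = 1
  | t + 1, q => G.status (x, q) = 1 ∨ 1 < G.status (x, q) ∧
      ∃ g < 2 ^ G.bits x, ∀ b : Bool, Wins x t (G.upd (x, q, g, b.toNat))

/-- Kind and successor at the beginning of a round. -/
def roundStep (a : List Bool × ℕ × ℕ) : ℕ × ℕ :=
  if G.status (a.1, a.2.2) = 0 then (0, 0) else if G.status (a.1, a.2.2) = 1 then (1, 0) else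
  if a.2.1 = 0 then (0, 0) else
    (2, 2 * Nat.pair (G.bits a.1 + 1) (Nat.pair 0 (Nat.pair (a.2.1 - 1) a.2.2)))

/-- Kind and successor of the configuration number `2 * ⟨c, g, t, q⟩ + b`. -/
def step (a : List Bool × ℕ × ℕ × ℕ × ℕ × ℕ) : ℕ × ℕ :=
  if a.2.1 = 0 then G.roundStep (a.1, G.rounds a.1, G.start a.1) else
  if a.2.1 = 1 then G.roundStep (a.1, a.2.2.2.1, G.upd (a.1, a.2.2.2.2.1, a.2.2.1, a.2.2.2.2.2)) else
  if a.2.1 = 2 then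
    (3, 2 * Nat.pair 1 (Nat.pair (2 * a.2.2.1 + a.2.2.2.2.2) (Nat.pair a.2.2.2.1 a.2.2.2.2.1)))
  else
    (2, 2 * Nat.pair (a.2.1 - 1)
      (Nat.pair (2 * a.2.2.1 + a.2.2.2.2.2) (Nat.pair a.2.2.2.1 a.2.2.2.2.1)))

/-- `step` on configuration numbers. -/
def cfgStep (a : List Bool × ℕ) : ℕ × ℕ :=
  G.step (a.1, nfst (a.2 / 2), nfst (nsnd (a.2 / 2)), nfst (nsnd (nsnd (a.2 / 2))),
    nsnd (nsnd (nsnd (a.2 / 2))), a.2 % 2)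

structure IsPL (κ : InputParam) : Prop where
  status : PL κ G.status
  upd : PL κ G.upd
  bits : PL κ G.bits
  rounds : PL κ G.rounds
  start : PL κ G.start

variable {G}

theorem IsPL.cfgStep {κ : InputParam} (h : G.IsPL κ) : PL κ G.cfgStep := by
  obtain ⟨h1, h2, h3, h4, h5⟩ := h
  have k1 : PL κ G.roundStep := by
    unfold roundStep
    generalize G.status = s at *
    generalize G.bits = n at *
    fun_prop
  have k2 : PL κ G.step := by
    unfold step
    generalize G.roundStep = r at *
    generalize G.upd = u at *
    generalize G.rounds = n at *
    generalize G.start = m at *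
    fun_prop
  unfold RoundGame.cfgStep
  generalize G.step = s at *
  fun_prop

theorem cfgStep_eq (x : List Bool) (c g t q : ℕ) (b : Bool) :
    G.cfgStep (x, 2 * Nat.pair c (Nat.pair g (Nat.pair t q)) + b.toNat)
      = G.step (x, c, g, t, q, b.toNat) := by
  have h1 : ∀ n, (2 * n + b.toNat) / 2 = n := fun n => by cases b <;> simp; omega
  have h2 : ∀ n, (2 * n + b.toNat) % 2 = b.toNat := fun n => by cases b <;> simp
  simp only [cfgStep, h1, h2, nfst_pair, nsnd_pair]

/-- The kind and the successor in the form required of plays. -/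
def playStep (G : RoundGame) (x : List Bool) (a : ℕ) : (Bool × Bool) × ℕ :=
  ((decide ((G.cfgStep (x, a)).1 / 2 ≠ 0), decide ((G.cfgStep (x, a)).1 % 2 ≠ 0)),
    (G.cfgStep (x, a)).2)

theorem _root_.Play.congr {F : ℕ → (Bool × Bool) × ℕ} {A E U a : ℕ} {p p' : Prop}
    (h : Play F A E U p a) (hp : p ↔ p') : Play F A E U p' a := by rwa [← propext hp]

section

variable {x : List Bool} {K : ℕ}

/-- A bound for the configuration numbers. -/
def cfgBound (G : RoundGame) (x : List Bool) (K : ℕ) : ℕ :=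
  2 * Nat.pair (G.bits x + 1) (Nat.pair (2 ^ G.bits x) (Nat.pair (G.rounds x) K)) + 1

theorem le_cfgBound {c g t q : ℕ} {b : Bool} (hc : c ≤ G.bits x + 1) (hg : g ≤ 2 ^ G.bits x)
    (ht : t ≤ G.rounds x) (hq : q ≤ K) :
    2 * Nat.pair c (Nat.pair g (Nat.pair t q)) + b.toNat ≤ G.cfgBound x K := by
  have := Nat.pair_mono hc (Nat.pair_mono hg (Nat.pair_mono ht hq))
  have := Bool.toNat_le b
  unfold cfgBound
  omega

/-- Here `g` is the number read so far, `b` the bit just guessed and not yet appended, and `i`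
counts the existential guesses to come; the result will be `(2 * g + b) * 2 ^ i + g'`. When no bit
is missing, the universal guess ends the round. -/
theorem play_bits {t q : ℕ} (ht : t ≤ G.rounds x) (hq : q ≤ K)
    (ih : ∀ g < 2 ^ G.bits x, ∀ b : Bool, Play (G.playStep x) (G.cfgBound x K) (G.bits x * t) t
      (G.Wins x t (G.upd (x, q, g, b.toNat)))
      (2 * Nat.pair 1 (Nat.pair g (Nat.pair t q)) + b.toNat)) (i : ℕ) :
    ∀ (g : ℕ) (b : Bool), i + 1 ≤ G.bits x → (2 * g + b.toNat + 1) * 2 ^ i ≤ 2 ^ G.bits x →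
    Play (G.playStep x) (G.cfgBound x K) (i + G.bits x * t) (t + 1)
      (∃ g' < 2 ^ i, ∀ b' : Bool, G.Wins x t
        (G.upd (x, q, (2 * g + b.toNat) * 2 ^ i + g', b'.toNat)))
      (2 * Nat.pair (i + 2) (Nat.pair g (Nat.pair t q)) + b.toNat) := by
  induction i with
  | zero =>
    intro g b hi hg
    have hle : 2 * g + b.toNat < 2 ^ G.bits x := by omega
    have e : G.playStep x (2 * Nat.pair 2 (Nat.pair g (Nat.pair t q)) + b.toNat)
        = ((true, true), 2 * Nat.pair 1 (Nat.pair (2 * g + b.toNat) (Nat.pair t q))) := by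
      simp [playStep, cfgStep_eq, step]
    refine (Play.all (p := fun b' => G.Wins x t (G.upd (x, q, 2 * g + b.toNat, b'.toNat)))
      (le_cfgBound (by omega) (by omega) ht hq) (by rw [e]) fun b' => ?_).congr
      (by simp)
    rw [e, Nat.zero_add]
    exact ih _ hle b'
  | succ i ihi =>
    intro g b hi hg
    have hpos : 1 ≤ 2 ^ (i + 1) := Nat.one_le_two_pow
    have hle : (2 * g + b.toNat + 1) * 1 ≤ 2 ^ G.bits x := (Nat.mul_le_mul_left _ hpos).trans hg
    have e : G.playStep x (2 * Nat.pair (i + 1 + 2) (Nat.pair g (Nat.pair t q)) + b.toNat)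
        = ((true, false), 2 * Nat.pair (i + 2) (Nat.pair (2 * g + b.toNat) (Nat.pair t q))) := by
      simp [playStep, cfgStep_eq, step]
    rw [Nat.add_right_comm]
    refine (Play.ex (p := fun b' => ∃ g' < 2 ^ i, ∀ b'' : Bool, G.Wins x t
        (G.upd (x, q, (2 * (2 * g + b.toNat) + b'.toNat) * 2 ^ i + g', b''.toNat)))
      (le_cfgBound (by omega) (by omega) ht hq) (by rw [e]) fun b' => ?_).congr ?_
    · rw [e]
      refine ihi _ _ (by omega) (le_trans ?_ hg)
      rw [pow_succ', ← mul_assoc]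
      refine Nat.mul_le_mul_right _ ?_
      have := Bool.toNat_le b'
      omega
    · have hp : 2 ^ (i + 1) = 2 * 2 ^ i := by rw [pow_succ']
      constructor
      · rintro ⟨b', g', h1, h2⟩
        refine ⟨b'.toNat * 2 ^ i + g', ?_, ?_⟩
        · cases b' <;> simp <;> omega
        · convert h2 using 6
          rw [hp]; ring
      · rintro ⟨g', h1, h2⟩
        by_cases h : g' < 2 ^ i
        · refine ⟨false, g', h, ?_⟩
          convert h2 using 6
          rw [hp]; simp; ring
        · refine ⟨true, g' - 2 ^ i, by omega, ?_⟩
          convert h2 using 6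
          obtain ⟨d, rfl⟩ := Nat.exists_eq_add_of_le (not_lt.1 h)
          rw [hp, Nat.add_sub_cancel_left]; simp; ring

/-- A round costs `G.bits x` existential guesses and one universal guess, so `t` rounds cost `t`
times as much. At least one bit per round is needed, because the first existential guess is made
before any counting. -/
theorem play_round (hb : ∀ q, 1 < G.status (x, q) → 1 ≤ G.bits x)
    (hK : ∀ q g b, G.upd (x, q, g, b) ≤ K) (t : ℕ) :
    ∀ q a, t ≤ G.rounds x → q ≤ K → a ≤ G.cfgBound x K → G.cfgStep (x, a) = G.roundStep (x, t, q) →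
      Play (G.playStep x) (G.cfgBound x K) (G.bits x * t) t (G.Wins x t q) a := by
  induction t with
  | zero =>
    intro q a ht hq ha h
    by_cases h1 : G.status (x, q) = 1
    · refine (Play.accept ha ?_).congr (iff_of_true trivial (by simpa [Wins] using h1))
      simp [playStep, h, roundStep, h1]
    · refine (Play.reject ha ?_).congr (iff_of_false id (by simpa [Wins] using h1))
      simp [playStep, h, roundStep, h1]
  | succ t ih =>
    intro q a ht hq ha h
    by_cases h1 : G.status (x, q) = 1
    · refine (Play.accept ha ?_).congr (iff_of_true trivial (by simp [Wins, h1]))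
      simp [playStep, h, roundStep, h1]
    by_cases h0 : G.status (x, q) = 0
    · refine (Play.reject ha ?_).congr (iff_of_false id (by simp [Wins, h0]))
      simp [playStep, h, roundStep, h0]
    have hs : 1 < G.status (x, q) := by omega
    have hbits := hb q hs
    obtain ⟨n, hn⟩ := Nat.exists_eq_add_of_le hbits
    have e : G.playStep x a
        = ((true, false), 2 * Nat.pair (n + 2) (Nat.pair 0 (Nat.pair t q))) := by
      simp [playStep, h, roundStep, h1, h0, hn, Nat.add_comm 1 n]
    have hE : G.bits x * (t + 1) = (n + G.bits x * t) + 1 := by rw [hn]; ring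
    have hpow : 2 ^ G.bits x = 2 * 2 ^ n := by rw [hn, Nat.add_comm, pow_succ']
    rw [hE]
    refine (Play.ex (p := fun b => ∃ g' < 2 ^ n, ∀ b' : Bool, G.Wins x t
        (G.upd (x, q, (2 * 0 + b.toNat) * 2 ^ n + g', b'.toNat))) ha (by rw [e])
      fun b => ?_).congr ?_
    · rw [e]
      refine play_bits (by omega) hq (fun g hg b => ?_) n 0 b (by omega) ?_
      · refine ih _ _ (by omega) (hK _ _ _) (le_cfgBound (by omega) hg.le (by omega) hq) ?_
        rw [cfgStep_eq]
        simp [step]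
      · rw [hpow]
        exact Nat.mul_le_mul_right _ (by have := Bool.toNat_le b; omega)
    · simp only [Wins, h1, false_or, hs, true_and]
      constructor
      · rintro ⟨b, g', hg, h2⟩
        refine ⟨_, ?_, h2⟩
        cases b <;> simp <;> omega
      · rintro ⟨g, hg, h2⟩
        by_cases h : g < 2 ^ n
        · exact ⟨false, g, h, by simpa using h2⟩
        · refine ⟨true, g - 2 ^ n, by omega, ?_⟩
          have : (2 * 0 + true.toNat) * 2 ^ n + (g - 2 ^ n) = g := by simp; omega
          rwa [this]

end

/-- Problems defined by short games are in `TREE`. -/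
theorem mem_tree {κ : InputParam} (hκ : IsParameterization κ.val) {Q : Set (List Bool)}
    (hG : G.IsPL κ) (hb : ∀ x q, 1 < G.status (x, q) → 1 ≤ G.bits x) {K : List Bool → ℕ}
    (hK : PolyBd κ.val fun x _ => K x) (hstart : ∀ x, G.start x ≤ K x)
    (hupd : ∀ x q g b, G.upd (x, q, g, b) ≤ K x) (hbits : PolyBd κ.val fun x _ => 2 ^ G.bits x)
    {f : ℕ → ℕ} (hf : Computable f)
    (hE : ∀ x, G.bits x * G.rounds x ≤ f (κ.val x) * Nat.log 2 x.length)
    (hU : ∀ x, G.rounds x ≤ f (κ.val x)) (h : ∀ x, G.Wins x (G.rounds x) (G.start x) ↔ x ∈ Q) :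
    (Q, κ.val) ∈ TREE := by
  have h0 := hG.cfgStep
  have h1 : PL κ fun a => (G.cfgStep a).1 / 2 := by fun_prop
  have h2 : PL κ fun a => (G.cfgStep a).1 % 2 := by fun_prop
  have h3 : PL κ fun a => (G.cfgStep a).2 := by fun_prop
  refine mem_tree_of_play hκ h1.logFun h2.logFun h3.logFun (A := fun x => G.cfgBound x (K x))
    ?_ hf hE hU fun x => ?_
  · exact ((PolyBd.const 2).mul ((hG.bits.polyBd.add (.const 1)).pair (hbits.pair
      (hG.rounds.polyBd.pair hK)))).add (.const 1)
  · have hc : 0 = 2 * Nat.pair 0 (Nat.pair 0 (Nat.pair 0 0)) + false.toNat := rfl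
    refine (play_round (hb x) (hupd x) _ _ 0 le_rfl (hstart x) (Nat.zero_le _) ?_).congr (h x)
    rw [hc, cfgStep_eq]
    simp [step]

end RoundGame

/-! Reading codes of structures -/

/-- The string `w` occurs in `x` at position `p`. -/
def OccursAt (x : List Bool) (p : ℕ) (w : List Bool) : Prop := w <+: x.drop p

/-- The length of the block of ones at `p`. -/
noncomputable def onesAt (x : List Bool) (p : ℕ) : ℕ :=
  bfind x.length fun i => inputSym x (p + i) ≠ 2

/-- All reading functions are defined on arbitrary strings. Cutting off just behind the input keeps
positions polynomially bounded under iteration even where nothing sensible is coded. -/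
noncomputable def onesEnd (x : List Bool) (p : ℕ) : ℕ :=
  min (p + onesAt x p + 1) (x.length + 1)

/-- The binary code of `v` occurs at `p`. -/
def IsBinAt (x : List Bool) (p v : ℕ) : Prop :=
  (BAll v.size fun i => inputSym x (p + 2 * i) = 2 ∧
    (BitOn v i ∧ inputSym x (p + 2 * i + 1) = 2 ∨ ¬ BitOn v i ∧ inputSym x (p + 2 * i + 1) = 1)) ∧
  inputSym x (p + 2 * v.size) = 1

/-- Entries of tuples are smaller than the universe, which is coded in unary in the same string; so
a search below the length of the input is enough. -/
noncomputable def binAt (x : List Bool) (p : ℕ) : ℕ := bfind x.length (IsBinAt x p)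

noncomputable def binEnd (x : List Bool) (p : ℕ) : ℕ :=
  min (p + 2 * (binAt x p).size + 1) (x.length + 1)

/-- The position of the `j`-th entry of the tuple at `p`. -/
noncomputable def entryPos (x : List Bool) (p j : ℕ) : ℕ := (binEnd x)^[j] p

/-- The position of the `i`-th tuple, of length `k`, of the list at `p`. -/
noncomputable def tuplePos (x : List Bool) (p k i : ℕ) : ℕ :=
  (fun y => entryPos x (y + 1) k)^[i] p

noncomputable def tupleCount (x : List Bool) (p k : ℕ) : ℕ :=
  bfind x.length fun i => inputSym x (tuplePos x p k i) ≠ 2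

noncomputable def tuplesEnd (x : List Bool) (p k : ℕ) : ℕ :=
  min (tuplePos x p k (tupleCount x p k) + 1) (x.length + 1)

/-- The position of the `j`-th arity. -/
noncomputable def arityPos (x : List Bool) (j : ℕ) : ℕ := (onesEnd x)^[j] (onesEnd x 0)

noncomputable def decNum (x : List Bool) : ℕ := onesAt x 0

noncomputable def decArity (x : List Bool) (j : ℕ) : ℕ := onesAt x (arityPos x j)

/-- The position of the `j`-th relation of the structure at `s`. -/
noncomputable def relPos (x : List Bool) (s j : ℕ) : ℕ :=
  Nat.rec (onesEnd x s) (fun i y => tuplesEnd x y (decArity x i)) j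

/-- The position of the code of the first structure. -/
noncomputable def posA (x : List Bool) : ℕ := arityPos x (decNum x)

/-- The position of the code of the second structure. -/
noncomputable def posB (x : List Bool) : ℕ := relPos x (posA x) (decNum x)

/-- The number of tuples of the `j`-th relation of the structure at `s`. -/
noncomputable def relCount (x : List Bool) (s j : ℕ) : ℕ :=
  tupleCount x (relPos x s j) (decArity x j)

/-- The `e`-th entry of the `t`-th tuple of the `j`-th relation of the structure at `s`. -/
noncomputable def entry (x : List Bool) (s j t e : ℕ) : ℕ :=
  binAt x (entryPos x (tuplePos x (relPos x s j) (decArity x j) t + 1) e)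

def UnaryOK (x : List Bool) (p : ℕ) : Prop := inputSym x (p + onesAt x p) = 1

def BinOK (x : List Bool) (p c : ℕ) : Prop := binAt x p < c ∧ IsBinAt x p (binAt x p)

/-- A list of distinct tuples of length `k` over `{0, …, c - 1}` is coded at `p`. -/
def TuplesOK (x : List Bool) (p k c : ℕ) : Prop :=
  inputSym x (tuplePos x p k (tupleCount x p k)) = 1 ∧
  (BAll (tupleCount x p k) fun i => BAll k fun e =>
    BinOK x (entryPos x (tuplePos x p k i + 1) e) c) ∧
  BAll (tupleCount x p k) fun i => BAll i fun i' => BEx k fun e =>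
    binAt x (entryPos x (tuplePos x p k i + 1) e) ≠ binAt x (entryPos x (tuplePos x p k i' + 1) e)

def StrOK (x : List Bool) (s : ℕ) : Prop :=
  UnaryOK x s ∧ 0 < onesAt x s ∧
    BAll (decNum x) fun j => TuplesOK x (relPos x s j) (decArity x j) (onesAt x s)

/-- The string codes a pair of structures. -/
def PairOK (x : List Bool) : Prop :=
  UnaryOK x 0 ∧ (BAll (decNum x) fun j => UnaryOK x (arityPos x j)) ∧ StrOK x (posA x) ∧
    StrOK x (posB x) ∧ relPos x (posB x) (decNum x) = x.length

/-! ### The reading functions are computable within the allowed space -/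

namespace PL

variable {κ : InputParam} {α : Type} [NumRep α] {f : α → List Bool} {g h k l m : α → ℕ}

theorem iterate {F : List Bool × ℕ → ℕ} (hF : PL κ F) {B : List Bool → ℕ → ℕ → ℕ}
    (hB : PL κ fun p : List Bool × ℕ × ℕ => B p.1 p.2.1 p.2.2)
    (h' : ∀ x p n, (fun y => F (x, y))^[n] p ≤ B x p n) (hf : PL κ f)
    (hg : PL κ g) (hh : PL κ h) : PL κ fun a => (fun y => F (f a, y))^[h a] (g a) :=
  natRec_of_le (fun a n => (fun y => F (f a, y))^[n] (g a)) hg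
    (step := fun a _ y => F (f a, y)) (by fun_prop) (fun _ => rfl)
    (fun _ _ => Function.iterate_succ_apply' _ _ _)
    (B := fun a n => B (f a) (g a) n)
    (comp (f := fun p : List Bool × ℕ × ℕ => B p.1 p.2.1 p.2.2)
      (g := fun p : α × ℕ => (f p.1, g p.1, p.2)) hB (by fun_prop)) (fun _ _ => h' _ _ _) hh

@[fun_prop]
theorem onesAt (hf : PL κ f) (hg : PL κ g) : PL κ fun a => onesAt (f a) (g a) := by
  unfold _root_.onesAt; fun_prop

@[fun_prop]
theorem onesEnd (hf : PL κ f) (hg : PL κ g) : PL κ fun a => onesEnd (f a) (g a) := by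
  unfold _root_.onesEnd; fun_prop

@[fun_prop]
theorem isBinAt (hf : PL κ f) (hg : PL κ g) (hh : PL κ h) :
    PL κ fun a => IsBinAt (f a) (g a) (h a) := by
  unfold IsBinAt; fun_prop

@[fun_prop]
theorem binAt (hf : PL κ f) (hg : PL κ g) : PL κ fun a => binAt (f a) (g a) := by
  unfold _root_.binAt; fun_prop

@[fun_prop]
theorem binEnd (hf : PL κ f) (hg : PL κ g) : PL κ fun a => binEnd (f a) (g a) := by
  unfold _root_.binEnd; fun_prop

theorem _root_.entryPos_le (x : List Bool) (p j : ℕ) : entryPos x p j ≤ max p (x.length + 1) := by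
  cases j with
  | zero => exact le_max_left _ _
  | succ j =>
    rw [entryPos, Function.iterate_succ_apply']
    exact (min_le_right _ _).trans (le_max_right _ _)

@[fun_prop]
theorem entryPos (hf : PL κ f) (hg : PL κ g) (hh : PL κ h) :
    PL κ fun a => entryPos (f a) (g a) (h a) :=
  iterate (F := fun a => _root_.binEnd a.1 a.2) (by fun_prop) (B := fun x p _ => p + (x.length + 1))
    (by fun_prop) (fun x p n => (entryPos_le x p n).trans (by omega)) hf hg hh

@[fun_prop]
theorem tuplePos (hf : PL κ f) (hg : PL κ g) (hh : PL κ h) (hk : PL κ k) :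
    PL κ fun a => tuplePos (f a) (g a) (h a) (k a) := by
  refine natRec_of_le (fun a n => _root_.tuplePos (f a) (g a) (h a) n) hg
    (step := fun a _ y => _root_.entryPos (f a) (y + 1) (h a)) (by fun_prop) (fun _ => rfl)
    (fun _ _ => Function.iterate_succ_apply' _ _ _)
    -- A tuple of length `0` occupies only its leading `1` and calls no function that cuts off, so
    -- every step may advance by one; hence the summand `n`.
    (B := fun a n => g a + n + (f a).length + 1) (by fun_prop) (fun a n => ?_) hk
  induction n with
  | zero => simp only [_root_.tuplePos, Function.iterate_zero, id_eq]; omega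
  | succ n ih =>
    rw [_root_.tuplePos, Function.iterate_succ_apply']
    refine (entryPos_le _ _ _).trans ?_
    rw [_root_.tuplePos] at ih
    omega

@[fun_prop]
theorem tupleCount (hf : PL κ f) (hg : PL κ g) (hh : PL κ h) :
    PL κ fun a => tupleCount (f a) (g a) (h a) := by
  unfold _root_.tupleCount; fun_prop

@[fun_prop]
theorem tuplesEnd (hf : PL κ f) (hg : PL κ g) (hh : PL κ h) :
    PL κ fun a => tuplesEnd (f a) (g a) (h a) := by
  unfold _root_.tuplesEnd; fun_prop

@[fun_prop]
theorem arityPos (hf : PL κ f) (hg : PL κ g) : PL κ fun a => arityPos (f a) (g a) :=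
  iterate (F := fun a => _root_.onesEnd a.1 a.2) (by fun_prop)
    (B := fun x p _ => p + (x.length + 1)) (by fun_prop) (fun x p n => by
      cases n with
      | zero => simp only [Function.iterate_zero, id_eq]; omega
      | succ n =>
        rw [Function.iterate_succ_apply']
        exact (min_le_right _ _).trans (Nat.le_add_left _ _)) hf (onesEnd hf (const 0)) hg

@[fun_prop]
theorem decNum (hf : PL κ f) : PL κ fun a => decNum (f a) := by
  unfold _root_.decNum; fun_prop

@[fun_prop]
theorem decArity (hf : PL κ f) (hg : PL κ g) : PL κ fun a => decArity (f a) (g a) := by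
  unfold _root_.decArity; fun_prop

@[fun_prop]
theorem relPos (hf : PL κ f) (hg : PL κ g) (hh : PL κ h) :
    PL κ fun a => relPos (f a) (g a) (h a) := by
  refine natRec_of_le (fun a n => _root_.relPos (f a) (g a) n) (base := fun a =>
    _root_.onesEnd (f a) (g a)) (by fun_prop)
    (step := fun a i y => _root_.tuplesEnd (f a) y (_root_.decArity (f a) i)) (by fun_prop)
    (fun _ => rfl) (fun _ _ => rfl)
    (B := fun a n => (f a).length + 1) (by fun_prop) (fun a n => ?_) hh
  cases n <;> exact min_le_right _ _

@[fun_prop]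
theorem posA (hf : PL κ f) : PL κ fun a => posA (f a) := by
  unfold _root_.posA; fun_prop

@[fun_prop]
theorem posB (hf : PL κ f) : PL κ fun a => posB (f a) := by
  unfold _root_.posB; fun_prop

@[fun_prop]
theorem relCount (hf : PL κ f) (hg : PL κ g) (hh : PL κ h) :
    PL κ fun a => relCount (f a) (g a) (h a) := by
  unfold _root_.relCount; fun_prop

@[fun_prop]
theorem entry (hf : PL κ f) (hg : PL κ g) (hh : PL κ h) (hk : PL κ k) (hl : PL κ l) :
    PL κ fun a => entry (f a) (g a) (h a) (k a) (l a) := by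
  unfold _root_.entry; fun_prop

@[fun_prop]
theorem unaryOK (hf : PL κ f) (hg : PL κ g) : PL κ fun a => UnaryOK (f a) (g a) := by
  unfold UnaryOK; fun_prop

@[fun_prop]
theorem binOK (hf : PL κ f) (hg : PL κ g) (hh : PL κ h) : PL κ fun a => BinOK (f a) (g a) (h a) := by
  unfold BinOK; fun_prop

@[fun_prop]
theorem tuplesOK (hf : PL κ f) (hg : PL κ g) (hh : PL κ h) (hk : PL κ k) :
    PL κ fun a => TuplesOK (f a) (g a) (h a) (k a) := by
  unfold TuplesOK; fun_prop

@[fun_prop]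
theorem strOK (hf : PL κ f) (hg : PL κ g) : PL κ fun a => StrOK (f a) (g a) := by
  unfold StrOK; fun_prop

@[fun_prop]
theorem pairOK (hf : PL κ f) : PL κ fun a => PairOK (f a) := by
  unfold PairOK; fun_prop

end PL

/-! Correctness of the reading of codes -/

theorem inputSym_eq_two {x : List Bool} {i : ℕ} : inputSym x i = 2 ↔ x[i]? = some true := by
  rcases h : x[i]? with _ | _ | _ <;> simp [inputSym, h]

theorem inputSym_eq_one {x : List Bool} {i : ℕ} : inputSym x i = 1 ↔ x[i]? = some false := by
  rcases h : x[i]? with _ | _ | _ <;> simp [inputSym, h]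

namespace OccursAt

variable {x u v : List Bool} {p : ℕ}

theorem append_iff : OccursAt x p (u ++ v) ↔ OccursAt x p u ∧ OccursAt x (p + u.length) v := by
  constructor
  · rintro ⟨r, hr⟩
    refine ⟨⟨v ++ r, by rw [← hr, List.append_assoc]⟩, ⟨r, ?_⟩⟩
    rw [← List.drop_drop, ← hr, List.append_assoc, List.drop_left]
  · rintro ⟨⟨r, hr⟩, ⟨s, hs⟩⟩
    refine ⟨s, ?_⟩
    rw [← List.drop_drop, ← hr, List.drop_left] at hs
    rw [← hr, ← hs, List.append_assoc]

theorem nil : OccursAt x p [] := List.nil_prefix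

theorem singleton_iff {b : Bool} : OccursAt x p [b] ↔ x[p]? = some b := by
  rw [OccursAt, List.prefix_iff_getElem?]
  simp

theorem length_le (h : OccursAt x p u) (hu : u ≠ []) : p + u.length ≤ x.length := by
  have := List.IsPrefix.length_le h
  rw [List.length_drop] at this
  have := List.length_pos_iff.2 hu
  omega

theorem cons_iff {b : Bool} : OccursAt x p (b :: u) ↔ x[p]? = some b ∧ OccursAt x (p + 1) u := by
  rw [← List.singleton_append, append_iff, singleton_iff]
  rfl

theorem replicate_iff {n : ℕ} {b : Bool} :
    OccursAt x p (List.replicate n b) ↔ ∀ i < n, x[p + i]? = some b := by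
  rw [OccursAt, List.prefix_iff_getElem?]
  simp

theorem bits_iff {l : List Bool} : OccursAt x p (l.flatMap fun b => [true, b]) ↔
    ∀ i b, l[i]? = some b → x[p + 2 * i]? = some true ∧ x[p + 2 * i + 1]? = some b := by
  induction l generalizing p with
  | nil => simp [nil]
  | cons a l ih =>
    rw [List.flatMap_cons, List.cons_append, List.cons_append, List.nil_append, cons_iff, cons_iff,
      ih]
    constructor
    · rintro ⟨h1, h2, h3⟩ i b hi
      cases i with
      | zero =>
        simp only [List.getElem?_cons_zero, Option.some.injEq] at hi
        subst hi
        exact ⟨h1, h2⟩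
      | succ i =>
        have := h3 i b (by simpa using hi)
        rwa [show p + 1 + 1 + 2 * i = p + 2 * (i + 1) by ring] at this
    · intro h
      refine ⟨(h 0 a (by simp)).1, (h 0 a (by simp)).2, fun i b hi => ?_⟩
      have := h (i + 1) b (by simpa using hi)
      rwa [show p + 2 * (i + 1) = p + 1 + 1 + 2 * i by ring] at this

/-- The position following a block is known only if the block indeed occurs, so the hypothesis is
conditional; the occurrence of the blocks and the positions are established together, by induction.
-/
theorem flatMap_range_iff {e : ℕ → List Bool} {pos : ℕ → ℕ} {n : ℕ}
    (hs : ∀ j < n, OccursAt x (pos j) (e j) → pos (j + 1) = pos j + (e j).length) :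
    (OccursAt x (pos 0) ((List.range n).flatMap e) ↔ ∀ j < n, OccursAt x (pos j) (e j)) ∧
    (OccursAt x (pos 0) ((List.range n).flatMap e) →
      pos n = pos 0 + ((List.range n).flatMap e).length) := by
  induction n with
  | zero => simp [nil]
  | succ n ih =>
    obtain ⟨h1, h2⟩ := ih fun j hj => hs j (by omega)
    rw [List.range_succ, List.flatMap_append, List.flatMap_singleton, append_iff]
    constructor
    · constructor
      · rintro ⟨k1, k2⟩ j hj
        rcases Nat.lt_succ_iff_lt_or_eq.1 hj with hj | rfl
        · exact h1.1 k1 j hj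
        · rwa [h2 k1]
      · intro h
        have k1 := h1.2 fun j hj => h j (by omega)
        exact ⟨k1, by rw [← h2 k1]; exact h n (by omega)⟩
    · rintro ⟨k1, k2⟩
      rw [hs n (by omega) (by rwa [h2 k1]), h2 k1, List.length_append, add_assoc]

end OccursAt

theorem List.finRange_flatMap_eq {α : Type} {n : ℕ} (e : Fin n → List α) :
    (List.finRange n).flatMap e
      = (List.range n).flatMap fun i => if h : i < n then e ⟨i, h⟩ else [] := by
  rw [← List.map_coe_finRange_eq_range, List.flatMap_map]
  simp

theorem OccursAt.flatMap_finRange_iff {x : List Bool} {n : ℕ} {e : Fin n → List Bool} {pos : ℕ → ℕ}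
    (hs : ∀ j : Fin n, OccursAt x (pos j) (e j) → pos (j + 1) = pos j + (e j).length) :
    (OccursAt x (pos 0) ((List.finRange n).flatMap e) ↔ ∀ j : Fin n, OccursAt x (pos j) (e j)) ∧
    (OccursAt x (pos 0) ((List.finRange n).flatMap e) →
      pos n = pos 0 + ((List.finRange n).flatMap e).length) := by
  rw [List.finRange_flatMap_eq]
  obtain ⟨h1, h2⟩ := flatMap_range_iff (x := x) (n := n) (pos := pos)
    (e := fun i => if h : i < n then e ⟨i, h⟩ else []) (fun j hj h => by
      simp only [hj, dif_pos] at h ⊢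
      exact hs ⟨j, hj⟩ h)
  refine ⟨h1.trans ⟨fun h j => ?_, fun h j hj => ?_⟩, h2⟩
  · simpa using h j j.2
  · simpa [hj] using h ⟨j, hj⟩

section

variable {x : List Bool} {p n : ℕ}

theorem occursAt_encUnary_iff : OccursAt x p (encUnary n) ↔
    (∀ i < n, inputSym x (p + i) = 2) ∧ inputSym x (p + n) = 1 := by
  rw [encUnary, OccursAt.append_iff, OccursAt.replicate_iff, OccursAt.singleton_iff]
  simp [inputSym_eq_two, inputSym_eq_one]

theorem OccursAt.encUnary (h : OccursAt x p (encUnary n)) :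
    onesAt x p = n ∧ UnaryOK x p ∧ onesEnd x p = p + (_root_.encUnary n).length := by
  have hl := h.length_le (by simp [_root_.encUnary])
  have hlen : (_root_.encUnary n).length = n + 1 := by simp [_root_.encUnary]
  obtain ⟨h1, h2⟩ := occursAt_encUnary_iff.1 h
  have e : onesAt x p = n := bfind_eq (fun i hi => by simpa using h1 i hi) (by omega) (by omega)
  refine ⟨e, by rwa [UnaryOK, e], ?_⟩
  rw [onesEnd, e]
  omega

theorem UnaryOK.occursAt (h : UnaryOK x p) : OccursAt x p (encUnary (onesAt x p)) :=
  occursAt_encUnary_iff.2 ⟨fun i hi => by simpa using bfind_spec.1 i hi, h⟩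

theorem isBinAt_iff : IsBinAt x p n ↔ OccursAt x p (encBinary n) := by
  have hlen : (n.bits.flatMap fun b => [true, b]).length = 2 * n.size := by
    simp [Nat.size_eq_bits_len, mul_comm]
  rw [encBinary, OccursAt.append_iff, OccursAt.bits_iff, OccursAt.singleton_iff, hlen, IsBinAt,
    inputSym_eq_one]
  refine and_congr_left' ?_
  have hbit : ∀ i < n.size, n.bits[i]? = some (n.testBit i) := by
    intro i hi
    rw [← Nat.size_eq_bits_len] at hi
    rw [Nat.testBit_eq_inth, List.getI_eq_getElem _ hi, List.getElem?_eq_getElem hi]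
  constructor
  · intro h i b hi
    have hlt : i < n.size := by
      rw [← Nat.size_eq_bits_len]
      exact (List.getElem?_eq_some_iff.1 hi).1
    have h1 := h i hlt
    rw [hbit i hlt, Option.some_inj] at hi
    simp only [inputSym_eq_two, inputSym_eq_one, BitOn, hi] at h1
    cases b <;> simpa using h1
  · intro h i hi
    have h1 := h i _ (hbit i hi)
    simp only [inputSym_eq_two, inputSym_eq_one, BitOn]
    cases hb : n.testBit i <;> simpa [hb] using h1

/-- The search might return a smaller number than `n`, but the code is prefix-free, so no two
numbers have codes at the same position. -/
theorem OccursAt.encBinary (h : OccursAt x p (encBinary n)) (hn : n < x.length) :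
    binAt x p = n ∧ binEnd x p = p + (_root_.encBinary n).length := by
  have hl := h.length_le (by simp [_root_.encBinary])
  have hlen : (_root_.encBinary n).length = 2 * n.size + 1 := by
    simp [_root_.encBinary, Nat.size_eq_bits_len, mul_comm]
  have hlt : binAt x p < x.length := bfind_lt_iff.2 ⟨n, hn, isBinAt_iff.2 h⟩
  have hb := isBinAt_iff.1 (bfind_spec.2 hlt)
  have e : binAt x p = n := by
    obtain ⟨r, hr⟩ := h
    obtain ⟨s, hs⟩ := hb
    exact (encBinary_inj (hs.trans hr.symm)).1
  refine ⟨e, ?_⟩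
  rw [binEnd, e]
  omega

theorem OccursAt.encTuple_iff {k : ℕ} (t : Fin k → Fin n) (hn : n ≤ x.length) :
    (OccursAt x p (encTuple t) ↔ ∀ e : Fin k, OccursAt x (entryPos x p e) (_root_.encBinary (t e))) ∧
    (OccursAt x p (encTuple t) → entryPos x p k = p + (encTuple t).length) :=
  OccursAt.flatMap_finRange_iff (pos := entryPos x p) fun j h => by
    rw [entryPos, Function.iterate_succ_apply']
    exact (h.encBinary ((t j).2.trans_le hn)).2

theorem OccursAt.encTuples_iff {k : ℕ} (l : List (Fin k → Fin n)) (hn : n ≤ x.length) :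
    (OccursAt x p (encTuples l) ↔ (∀ i : Fin l.length, inputSym x (tuplePos x p k i) = 2 ∧
      OccursAt x (tuplePos x p k i + 1) (encTuple (l.get i))) ∧
      inputSym x (tuplePos x p k l.length) = 1) ∧
    (OccursAt x p (encTuples l) →
      tuplePos x p k l.length + 1 = p + (encTuples l).length) := by
  have hl : encTuples l = ((List.finRange l.length).flatMap fun i =>
      true :: encTuple (l.get i)) ++ [false] := by
    conv_lhs => rw [← List.map_get_finRange l]
    rw [encTuples, List.flatMap_map]
  obtain ⟨h1, h2⟩ := OccursAt.flatMap_finRange_iff (x := x) (pos := tuplePos x p k)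
    (e := fun i : Fin l.length => true :: encTuple (l.get i)) fun j h => by
      rw [tuplePos, Function.iterate_succ_apply']
      rw [OccursAt.cons_iff] at h
      rw [← tuplePos, (OccursAt.encTuple_iff _ hn).2 h.2, List.length_cons]
      ring
  rw [hl, OccursAt.append_iff, List.length_append]
  constructor
  · constructor
    · rintro ⟨k1, k2⟩
      refine ⟨fun i => ?_, ?_⟩
      · have := h1.1 k1 i
        rwa [OccursAt.cons_iff, ← inputSym_eq_two] at this
      · rw [h2 k1, inputSym_eq_one]
        exact OccursAt.singleton_iff.1 k2
    · rintro ⟨k1, k2⟩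
      have k3 := h1.2 fun i => by rw [OccursAt.cons_iff, ← inputSym_eq_two]; exact k1 i
      refine ⟨k3, ?_⟩
      rw [h2 k3, inputSym_eq_one] at k2
      exact OccursAt.singleton_iff.2 k2
  · rintro ⟨k1, k2⟩
    rw [h2 k1, List.length_singleton, add_assoc]
    rfl

theorem OccursAt.encTuples {k : ℕ} {l : List (Fin k → Fin n)} (h : OccursAt x p (encTuples l))
    (hn : n ≤ x.length) (hl : l.Nodup) :
    TuplesOK x p k n ∧ tuplesEnd x p k = p + (_root_.encTuples l).length := by
  obtain ⟨h1, h2⟩ := (OccursAt.encTuples_iff l hn).1.1 h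
  have h3 := (OccursAt.encTuples_iff l hn).2 h
  have h4 := h.length_le (by simp [_root_.encTuples])
  -- Each tuple contributes at least its leading `1`, so the number of tuples lies in the range of
  -- the search that determines it.
  have h5 : l.length < (_root_.encTuples l).length := by
    have : l.length ≤ (l.flatMap fun t => true :: encTuple t).length := by
      rw [List.length_flatMap]
      refine le_trans (by simp) (List.length_le_sum_of_one_le _ ?_)
      simp
    rw [_root_.encTuples, List.length_append, List.length_singleton]
    omega
  have hc : tupleCount x p k = l.length := by
    refine bfind_eq (fun i hi => ?_) (by rw [h2]; decide) (by omega)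
    simpa using (h1 ⟨i, hi⟩).1
  have he : ∀ (i : Fin l.length) (e : Fin k), BinOK x (entryPos x (tuplePos x p k i + 1) e) n ∧
      binAt x (entryPos x (tuplePos x p k i + 1) e) = l.get i e := by
    intro i e
    have := (OccursAt.encTuple_iff _ hn).1.1 (h1 i).2 e
    have hb := (this.encBinary ((l.get i e).2.trans_le hn)).1
    exact ⟨⟨by rw [hb]; exact Fin.isLt _, by rw [hb]; exact isBinAt_iff.2 this⟩, hb⟩
  refine ⟨⟨by rw [hc, h2], ?_, ?_⟩, ?_⟩
  · rw [hc]
    exact fun i hi e hek => (he ⟨i, hi⟩ ⟨e, hek⟩).1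
  · rw [hc]
    intro i hi i' hi'
    have hne : l.get ⟨i, hi⟩ ≠ l.get ⟨i', hi'.trans hi⟩ := fun h => by
      have := List.nodup_iff_injective_get.1 hl h
      simp only [Fin.mk.injEq] at this
      omega
    obtain ⟨e, hne⟩ := Function.ne_iff.1 hne
    refine ⟨e, e.2, ?_⟩
    exact fun h => hne (Fin.ext (((he ⟨i, hi⟩ e).2.symm.trans h).trans (he ⟨i', hi'.trans hi⟩ e).2))
  · rw [tuplesEnd, hc, h3]
    omega

/-- The tuples listed at `p`. -/
noncomputable def decTuples (x : List Bool) (p k n : ℕ) (hn : 0 < n) : List (Fin k → Fin n) :=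
  (List.range (tupleCount x p k)).map fun i e =>
    ⟨binAt x (entryPos x (tuplePos x p k i + 1) e) % n, Nat.mod_lt _ hn⟩

theorem decTuples_getElem {k i : ℕ} (hn : 0 < n) (hi : i < (decTuples x p k n hn).length) :
    (decTuples x p k n hn)[i] = fun e : Fin k =>
      ⟨binAt x (entryPos x (tuplePos x p k i + 1) e) % n, Nat.mod_lt _ hn⟩ := by
  simp [decTuples]

theorem TuplesOK.nodup {k : ℕ} (h : TuplesOK x p k n) (hn : 0 < n) : (decTuples x p k n hn).Nodup := by
  obtain ⟨-, h2, h3⟩ := h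
  refine List.Nodup.map_on ?_ List.nodup_range
  have key : ∀ i < tupleCount x p k, ∀ j < i, ¬ ∀ e : Fin k,
      binAt x (entryPos x (tuplePos x p k i + 1) e) % n
        = binAt x (entryPos x (tuplePos x p k j + 1) e) % n := by
    intro i hi j hj h
    obtain ⟨e, he, hne⟩ := h3 i hi j hj
    have := h ⟨e, he⟩
    rw [Nat.mod_eq_of_lt (h2 i hi e he).1, Nat.mod_eq_of_lt (h2 j (hj.trans hi) e he).1] at this
    exact hne this
  intro i hi j hj h
  rw [List.mem_range] at hi hj
  have h' : ∀ e : Fin k, binAt x (entryPos x (tuplePos x p k i + 1) e) % n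
        = binAt x (entryPos x (tuplePos x p k j + 1) e) % n := fun e => by
    simpa using congrArg Fin.val (congrFun h e)
  rcases lt_trichotomy i j with hlt | rfl | hlt
  · exact absurd (fun e => (h' e).symm) (key j hj i hlt)
  · rfl
  · exact absurd h' (key i hi j hlt)

theorem TuplesOK.occursAt {k : ℕ} (h : TuplesOK x p k n) (hn : 0 < n) (hx : n ≤ x.length) :
    OccursAt x p (encTuples (decTuples x p k n hn)) := by
  obtain ⟨h1, h2, -⟩ := h
  have hl : (decTuples x p k n hn).length = tupleCount x p k := by simp [decTuples]
  refine (OccursAt.encTuples_iff _ hx).1.2 ⟨fun i => ⟨?_, ?_⟩, by rwa [hl]⟩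
  · simpa using bfind_spec.1 i.1 (i.2.trans_eq hl)
  · refine (OccursAt.encTuple_iff _ hx).1.2 fun e => ?_
    have := h2 i (i.2.trans_eq hl) e e.2
    have hget : ((decTuples x p k n hn).get i e : ℕ)
        = binAt x (entryPos x (tuplePos x p k i + 1) e) := by
      rw [List.get_eq_getElem, decTuples_getElem]
      exact Nat.mod_eq_of_lt this.1
    rw [hget]
    exact isBinAt_iff.1 this.2

end

/-- The vocabulary coded by a string. -/
noncomputable def decVoc (x : List Bool) : Vocabulary := ⟨decNum x, fun j => decArity x j⟩

/-- The structure coded at `s`. -/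
noncomputable def decStr (x : List Bool) (s : ℕ) : FinStr (decVoc x) where
  -- The maximum matters only for strings that are not codes, where the universe must still be
  -- nonempty; likewise the remainders taken in `decTuples` change nothing on codes.
  card := max 1 (onesAt x s)
  card_pos := by simp
  rel j := (decTuples x (relPos x s j) (decArity x j) (max 1 (onesAt x s)) (by simp)).toFinset

theorem FinStr.CodedBy.strOK {x w : List Bool} {τ : Vocabulary} {A : FinStr τ} {s : ℕ}
    (hA : A.CodedBy w) (hw : OccursAt x s w) (hnum : decNum x = τ.num)
    (har : ∀ j : Fin τ.num, decArity x j = τ.arity j) :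
    StrOK x s ∧ relPos x s (decNum x) = s + w.length := by
  obtain ⟨l, hl, rfl⟩ := hA
  rw [OccursAt.append_iff] at hw
  obtain ⟨h1, h2⟩ := hw
  have hc := h1.length_le (by simp [encUnary])
  obtain ⟨h3, h4, h5⟩ := h1.encUnary
  have hcard : A.card ≤ x.length := by
    simp only [encUnary, List.length_append, List.length_replicate] at hc
    omega
  have step : ∀ j : Fin τ.num, OccursAt x (relPos x s j) (encTuples (l j)) →
      TuplesOK x (relPos x s j) (decArity x j) A.card ∧
        relPos x s (j + 1) = relPos x s j + (encTuples (l j)).length := by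
    intro j h
    obtain ⟨k1, k2⟩ := h.encTuples hcard (hl j).1
    rw [har]
    refine ⟨k1, ?_⟩
    rw [← k2, ← har j]
    rfl
  obtain ⟨k1, k2⟩ := OccursAt.flatMap_finRange_iff (x := x) (pos := relPos x s)
    (e := fun j : Fin τ.num => encTuples (l j)) fun j h => (step j h).2
  have h0 : relPos x s 0 = s + (encUnary A.card).length := h5
  rw [h0] at k1 k2
  refine ⟨⟨h4, by rw [h3]; exact A.card_pos, fun j hj => ?_⟩, ?_⟩
  · rw [h3]
    exact (step ⟨j, hnum ▸ hj⟩ (k1.1 h2 ⟨j, hnum ▸ hj⟩)).1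
  · rw [hnum, k2 h2, List.length_append, add_assoc]

theorem PairCode.pairOK {τ : Vocabulary} {A B : FinStr τ} {x : List Bool} (h : PairCode τ A B x) :
    PairOK x := by
  obtain ⟨a, b, ha, hb, hx⟩ := h
  have h0 : OccursAt x 0 (encVocabulary τ ++ a ++ b) := by rw [← hx]; exact List.prefix_rfl
  rw [OccursAt.append_iff, OccursAt.append_iff, encVocabulary, OccursAt.append_iff] at h0
  obtain ⟨⟨⟨h1, h2⟩, h3⟩, h4⟩ := h0
  obtain ⟨k1, k2, k3⟩ := h1.encUnary
  have hnum : decNum x = τ.num := k1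
  have step : ∀ j : Fin τ.num, OccursAt x (arityPos x j) (encUnary (τ.arity j)) →
      decArity x j = τ.arity j ∧ UnaryOK x (arityPos x j) ∧
        arityPos x (j + 1) = arityPos x j + (encUnary (τ.arity j)).length := by
    intro j h
    obtain ⟨l1, l2, l3⟩ := h.encUnary
    refine ⟨l1, l2, ?_⟩
    rw [← l3, arityPos, Function.iterate_succ_apply']
    rfl
  obtain ⟨l1, l2⟩ := OccursAt.flatMap_finRange_iff (x := x) (pos := arityPos x)
    (e := fun j : Fin τ.num => encUnary (τ.arity j)) fun j h => (step j h).2.2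
  have e0 : arityPos x 0 = 0 + (encUnary τ.num).length := k3
  rw [e0] at l1 l2
  have hall := l1.1 h2
  have har := fun j => (step j (hall j)).1
  have hposA : posA x = 0 + (encVocabulary τ).length := by
    rw [posA, hnum, l2 h2, encVocabulary, List.length_append, add_assoc]
  rw [← encVocabulary, ← hposA] at h3
  obtain ⟨m1, m2⟩ := ha.strOK h3 hnum har
  have hposB : posB x = 0 + (encVocabulary τ ++ a).length := by
    rw [posB, m2, hposA, List.length_append, add_assoc]
  rw [← encVocabulary, ← hposB] at h4
  obtain ⟨n1, n2⟩ := hb.strOK h4 hnum har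
  refine ⟨k2, fun j hj => (step ⟨j, hnum ▸ hj⟩ (hall ⟨j, hnum ▸ hj⟩)).2.1, m1, n1, ?_⟩
  rw [n2, hposB, hx]
  simp [add_assoc]

theorem StrOK.codedBy {x : List Bool} {s : ℕ} (h : StrOK x s) :
    ∃ w, (decStr x s).CodedBy w ∧ OccursAt x s w ∧ relPos x s (decNum x) = s + w.length := by
  obtain ⟨h1, h2, h3⟩ := h
  have hcard : (decStr x s).card = onesAt x s := max_eq_right h2
  have h4 := h1.occursAt
  have h5 := h4.encUnary.2.2
  have hc := h4.length_le (by simp [encUnary])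
  have hle : (decStr x s).card ≤ x.length := by
    simp only [encUnary, List.length_append, List.length_replicate] at hc
    omega
  have hT : ∀ j : Fin (decNum x), TuplesOK x (relPos x s j) (decArity x j) (decStr x s).card :=
    fun j => by rw [hcard]; exact h3 j j.2
  set l : ∀ j : Fin (decNum x), List (Fin (decArity x j) → Fin (decStr x s).card) := fun j =>
    decTuples x (relPos x s j) (decArity x j) (decStr x s).card (decStr x s).card_pos with hl
  have hnodup : ∀ j, (l j).Nodup := fun j => (hT j).nodup _
  refine ⟨_, ⟨l, fun j => ⟨hnodup j, fun t => ?_⟩, rfl⟩, ?_⟩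
  · exact (List.mem_toFinset (l := l j)).symm
  · obtain ⟨k1, k2⟩ := OccursAt.flatMap_finRange_iff (x := x) (pos := relPos x s)
      (e := fun j : Fin (decNum x) => encTuples (l j)) fun j h => by
        rw [← (h.encTuples hle (hnodup j)).2]; rfl
    have h0 : relPos x s 0 = s + (encUnary (decStr x s).card).length := by
      rw [hcard]; exact h5
    rw [h0] at k1 k2
    have hocc := k1.2 fun j => (hT j).occursAt _ hle
    refine ⟨OccursAt.append_iff.2 ⟨by rw [hcard]; exact h4, hocc⟩, ?_⟩
    rw [k2 hocc, List.length_append, add_assoc]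
    rfl

/-- The checks show that the codes of the vocabulary and of both structures occur one after the
other from position `0` on. Since the last position is the end of the string, the prefix found is
the whole string. -/
theorem PairOK.exists_codes {x : List Bool} (h : PairOK x) :
    ∃ a b, (decStr x (posA x)).CodedBy a ∧ (decStr x (posB x)).CodedBy b ∧
      x = encVocabulary (decVoc x) ++ a ++ b ∧
      posB x = (encVocabulary (decVoc x) ++ a).length := by
  obtain ⟨h1, h2, h3, h4, h5⟩ := h
  obtain ⟨a, a1, a2, a3⟩ := h3.codedBy
  obtain ⟨b, b1, b2, b3⟩ := h4.codedBy
  refine ⟨a, b, a1, b1, ?_⟩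
  have k1 := h1.occursAt
  have k2 := k1.encUnary.2.2
  obtain ⟨l1, l2⟩ := OccursAt.flatMap_finRange_iff (x := x) (pos := arityPos x)
    (e := fun j : Fin (decNum x) => encUnary (decArity x j)) fun j h => by
      rw [arityPos, Function.iterate_succ_apply']
      exact h.encUnary.2.2
  have hocc := l1.2 fun j => (h2 j j.2).occursAt
  have e0 : arityPos x 0 = 0 + (encUnary (decNum x)).length := k2
  have hv : OccursAt x 0 (encVocabulary (decVoc x)) ∧
      posA x = 0 + (encVocabulary (decVoc x)).length := by
    refine ⟨OccursAt.append_iff.2 ⟨k1, e0 ▸ hocc⟩, ?_⟩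
    rw [posA, l2 hocc, e0, encVocabulary, List.length_append, add_assoc]
    rfl
  have hposB : posB x = posA x + a.length := a3
  have hfull : OccursAt x 0 (encVocabulary (decVoc x) ++ a ++ b) := by
    refine OccursAt.append_iff.2 ⟨OccursAt.append_iff.2 ⟨hv.1, hv.2 ▸ a2⟩, ?_⟩
    rw [List.length_append, ← add_assoc, ← hv.2, ← hposB]
    exact b2
  refine ⟨(List.IsPrefix.eq_of_length hfull ?_).symm, ?_⟩
  · rw [List.drop_zero, ← h5, b3, hposB, hv.2, List.length_append, List.length_append]
    ring
  · rw [hposB, hv.2, List.length_append, Nat.zero_add]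

theorem PairOK.pairCode {x : List Bool} (h : PairOK x) :
    PairCode (decVoc x) (decStr x (posA x)) (decStr x (posB x)) x :=
  let ⟨a, b, h1, h2, h3, _⟩ := h.exists_codes
  ⟨a, b, h1, h2, h3⟩

theorem PairOK.strCode {x : List Bool} (h : PairOK x) :
    StrCode (decVoc x) (decStr x (posA x)) (x.take (posB x)) := by
  obtain ⟨a, b, h1, h2, h3, h4⟩ := h.exists_codes
  exact ⟨a, h1, (congrArg₂ List.take h4 h3).trans List.take_left⟩

theorem pairOK_iff {x : List Bool} :
    PairOK x ↔ ∃ (τ : Vocabulary) (A B : FinStr τ), PairCode τ A B x :=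
  ⟨fun h => ⟨_, _, _, h.pairCode⟩, fun ⟨_, _, _, h⟩ => h.pairOK⟩

/-! The parameter and the membership in a decidable class -/

/-- The size of the structure coded at `s`. -/
noncomputable def decSize (x : List Bool) (s : ℕ) : ℕ :=
  decNum x + onesAt x s + ∑ j ∈ Finset.range (decNum x), relCount x s j * decArity x j

-- The tuples of a relation are listed without repetition, so the number of listed tuples is the
-- cardinality of the relation.
open Classical in
theorem embParam_eq_decSize (x : List Bool) :
    embParam x = if PairOK x then decSize x (posA x) else 0 := by
  split_ifs with h
  · rw [embParam_eq h.pairCode, FinStr.size, decSize]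
    have hA := h.2.2.1
    refine congrArg₂ (· + ·) (congrArg₂ (· + ·) rfl ?_) ?_
    · exact max_eq_right hA.2.1
    · rw [Finset.sum_range]
      refine Finset.sum_congr rfl fun j _ => ?_
      congr 1
      have : TuplesOK x (relPos x (posA x) j) (decArity x j) (max 1 (onesAt x (posA x))) := by
        rw [max_eq_right hA.2.1]
        exact hA.2.2 j j.2
      exact (List.toFinset_card_of_nodup (this.nodup _)).trans (by simp [decTuples, relCount])
  · rw [embParam, dif_neg]
    rintro ⟨p, hp⟩
    exact h hp.pairOK

/-- The parameter of the embedding problem. -/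
noncomputable abbrev embP : InputParam := ⟨embParam⟩

namespace PL

variable {κ : InputParam} {α : Type} [NumRep α] {f : α → List Bool} {g : α → ℕ}

@[fun_prop]
theorem decSize (hf : PL κ f) (hg : PL κ g) : PL κ fun a => decSize (f a) (g a) := by
  unfold _root_.decSize
  have := sum (F := fun a j => _root_.relCount (f a) (g a) j * _root_.decArity (f a) j)
    (decNum hf) (by fun_prop)
  fun_prop

@[fun_prop]
theorem embParam (hf : PL κ f) : PL κ fun a => embParam (f a) := by
  classical
  have : PL κ fun a => if PairOK (f a) then _root_.decSize (f a) (_root_.posA (f a)) else 0 := by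
    fun_prop
  exact this.congr fun a => (embParam_eq_decSize (f a)).symm

end PL

theorem isParameterization_embParam : IsParameterization embParam :=
  isParameterization_of_pl (PL.embParam PL.id)

/-! Lengths of codes -/

theorem List.length_flatMap_le {α β : Type} (L : List α) (f : α → List β) (c : ℕ)
    (h : ∀ a ∈ L, (f a).length ≤ c) : (L.flatMap f).length ≤ L.length * c := by
  rw [List.length_flatMap]
  exact (List.sum_le_card_nsmul _ c (by simpa using h)).trans (by simp)

theorem length_encTuple_le {k n : ℕ} (t : Fin k → Fin n) : (encTuple t).length ≤ k * (2 * n) := by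
  refine (List.length_flatMap_le _ _ (2 * n) fun j _ => ?_).trans (by simp)
  have h1 : (t j : ℕ).size ≤ t j := Nat.size_le.2 Nat.lt_two_pow_self
  have h2 := (t j).2
  have : (encBinary (t j)).length = 2 * (t j : ℕ).size + 1 := by
    simp [encBinary, Nat.size_eq_bits_len, mul_comm]
  omega

/-- A bound for the length of the code of a structure of size `n` with symbols of arity at most
`r`. -/
def codeBound (r n : ℕ) : ℕ :=
  (n + 1 + n * (r + 1)) + (n + 1 + n * ((n + 1) * (1 + r * (2 * n)) + 1))

/-- The size does not account for arities of empty relations, which are coded in unary; this is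
where bounded arity enters. Nor does it count tuples of nullary relations, but such a relation has
at most one, whence `A.size + 1`. -/
theorem StrCode.length_le {τ : Vocabulary} {A : FinStr τ} {w : List Bool} (h : StrCode τ A w)
    {r : ℕ} (hr : ∀ i, τ.arity i ≤ r) : w.length ≤ codeBound r A.size := by
  obtain ⟨_, ⟨l, hl, rfl⟩, rfl⟩ := h
  have hn : τ.num ≤ A.size := by unfold FinStr.size; omega
  have hc : A.card ≤ A.size := by unfold FinStr.size; omega
  have hu : ∀ n, (encUnary n).length = n + 1 := fun n => by simp [encUnary]
  have hlen : ∀ i, (l i).length ≤ A.size + 1 := by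
    intro i
    have hcard : (l i).length = (A.rel i).card := by
      rw [← List.toFinset_card_of_nodup (hl i).1]
      congr 1
      ext t
      simp [(hl i).2]
    rw [hcard]
    rcases Nat.eq_zero_or_pos (τ.arity i) with h0 | h0
    · have : (A.rel i).card ≤ 1 := by
        refine Finset.card_le_one.2 fun a _ b _ => funext fun j => ?_
        exact absurd j.2 (by omega)
      omega
    · have h1 : (A.rel i).card * τ.arity i ≤ ∑ i, (A.rel i).card * τ.arity i :=
        Finset.single_le_sum (f := fun i => (A.rel i).card * τ.arity i)
          (fun _ _ => Nat.zero_le _) (Finset.mem_univ i)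
      have h2 : (A.rel i).card ≤ (A.rel i).card * τ.arity i := Nat.le_mul_of_pos_right _ h0
      unfold FinStr.size
      omega
  simp only [encVocabulary, List.length_append, hu, codeBound]
  refine Nat.add_le_add (Nat.add_le_add (by omega) ?_) (Nat.add_le_add (by omega) ?_)
  · refine (List.length_flatMap_le _ _ (r + 1) fun i _ => ?_).trans ?_
    · rw [hu]
      exact Nat.succ_le_succ (hr i)
    · rw [List.length_finRange]
      exact Nat.mul_le_mul_right _ hn
  · refine (List.length_flatMap_le _ _ ((A.size + 1) * (1 + r * (2 * A.size)) + 1)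
      fun i _ => ?_).trans ?_
    · rw [encTuples, List.length_append, List.length_singleton]
      refine Nat.succ_le_succ ((List.length_flatMap_le _ _ (1 + r * (2 * A.size))
        fun t _ => ?_).trans (Nat.mul_le_mul_right _ (hlen i)))
      rw [List.length_cons, add_comm]
      refine Nat.add_le_add_left ((length_encTuple_le t).trans ?_) 1
      exact Nat.mul_le_mul (hr i) (Nat.mul_le_mul_left _ hc)
    · rw [List.length_finRange]
      exact Nat.mul_le_mul_right _ hn

/-! Prefixes of the input as numbers -/

/-- The largest number coding a list of length at most `n` of bits. -/
def listCodeBound (n : ℕ) : ℕ := Nat.rec 0 (fun _ y => Nat.pair 1 y + 1) n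

theorem computable_listCodeBound : Computable listCodeBound :=
  (Primrec.nat_rec₁ (f := fun _ y => Nat.pair 1 y + 1) 0 (Primrec.succ.comp
    (Primrec₂.natPair.comp (Primrec.const 1) Primrec.snd))).to_comp

theorem monotone_listCodeBound : Monotone listCodeBound :=
  monotone_nat_of_le_succ fun n => (Nat.right_le_pair 1 (listCodeBound n)).trans (Nat.le_succ _)

theorem encode_le_listCodeBound (l : List Bool) : Encodable.encode l ≤ listCodeBound l.length := by
  induction l with
  | nil => simp
  | cons a l ih =>
    rw [Encodable.encode_list_cons]
    refine Nat.succ_le_succ (Nat.pair_mono ?_ ih)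
    cases a <;> simp

/-- The number of the prefix of length `m`. -/
noncomputable def prefixCode (x : List Bool) (m : ℕ) : ℕ := Encodable.encode (x.take m)

namespace PL

variable {κ : InputParam} {α : Type} [NumRep α] {f : α → List Bool} {g : α → ℕ}

/-- The number of a list grows from its last entry to its first, so the recursion runs through the
suffixes of the prefix, longer and longer. All these numbers are bounded in terms of the parameter,
because the length is. -/
theorem prefixCode (hf : PL κ f) (hg : PL κ g) {H : ℕ → ℕ} (hH : Computable H)
    (hle : ∀ x n, g (NumRep.dec x n) ≤ H (κ.val x)) : PL κ fun a => prefixCode (f a) (g a) := by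
  set F : α → ℕ → ℕ := fun a n =>
    Encodable.encode (((f a).take (g a)).drop ((g a) - n)) with hF
  have hb : ∀ x z n, F (NumRep.dec x z) n ≤ listCodeBound (H (κ.val x)) := by
    intro x z n
    refine (encode_le_listCodeBound _).trans (monotone_listCodeBound ?_)
    rw [List.length_drop, List.length_take]
    have := hle x z
    omega
  have key := natRec (κ := κ) F (const 0) (step := fun a n y =>
    if n < g a ∧ g a - n ≤ (f a).length then
      Nat.pair (if _root_.inputSym (f a) (g a - (n + 1)) = 2 then 1 else 0) y + 1
    else y) (by fun_prop) (fun a => ?_) (fun a n => ?_)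
    (.param (computable_listCodeBound.comp hH)) hb hg
  · refine key.congr fun a => ?_
    simp [F, _root_.prefixCode]
  · simp [F]
  · split_ifs with h h'
    all_goals simp only [F]
    · have e : g a - n = g a - (n + 1) + 1 := by omega
      have hlt : g a - (n + 1) < ((f a).take (g a)).length := by rw [List.length_take]; omega
      rw [List.drop_eq_getElem_cons hlt, Encodable.encode_list_cons, ← e]
      congr 2
      rw [inputSym_eq_two, List.getElem?_eq_some_iff] at h'
      obtain ⟨_, h'⟩ := h'
      simp [h']
    · have e : g a - n = g a - (n + 1) + 1 := by omega
      have hlt : g a - (n + 1) < ((f a).take (g a)).length := by rw [List.length_take]; omega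
      rw [List.drop_eq_getElem_cons hlt, Encodable.encode_list_cons, ← e]
      congr 2
      rw [inputSym_eq_two, List.getElem?_eq_some_iff] at h'
      have : (f a)[g a - (n + 1)]'(by omega) = false := by
        rw [← Bool.not_eq_true]
        exact fun h'' => h' ⟨by omega, h''⟩
      simp [this]
    · rcases Nat.lt_or_ge n (g a) with hn | hn
      · rw [List.drop_eq_nil_of_le, List.drop_eq_nil_of_le] <;> rw [List.length_take] <;> omega
      · rw [Nat.sub_eq_zero_of_le hn, Nat.sub_eq_zero_of_le (by omega)]

/-- Membership of the first structure in a decidable class of bounded arity. -/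
theorem mem_class {𝒜 : StrClass} (hdec : 𝒜.IsDecidable) (harity : 𝒜.BoundedArity)
    (hf : PL embP f) :
    PL embP fun a => PairOK (f a) ∧ (⟨decVoc (f a), decStr (f a) (_root_.posA (f a))⟩ :
      Σ τ, FinStr τ) ∈ 𝒜 := by
  refine comp (f := fun x : List Bool => PairOK x ∧ (⟨decVoc x, decStr x (_root_.posA x)⟩ :
      Σ τ, FinStr τ) ∈ 𝒜) ?_ hf
  obtain ⟨r, hr⟩ := harity
  obtain ⟨p, hp⟩ : ∃ p : List Bool → Prop, p = fun x => ∃ (τ : Vocabulary) (A : FinStr τ),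
    ⟨τ, A⟩ ∈ 𝒜 ∧ StrCode τ A x := ⟨_, rfl⟩
  rw [StrClass.IsDecidable, ← hp] at hdec
  obtain ⟨hd, hc⟩ := hdec
  have hb : Computable (codeBound r) := by
    have h1 : ∀ c : ℕ, Primrec fun _ : ℕ => c := Primrec.const
    have h2 : ∀ {f g : ℕ → ℕ}, Primrec f → Primrec g → Primrec fun n => f n + g n :=
      fun h h' => Primrec.nat_add.comp h h'
    have h3 : ∀ {f g : ℕ → ℕ}, Primrec f → Primrec g → Primrec fun n => f n * g n :=
      fun h h' => Primrec.nat_mul.comp h h'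
    have h4 : Primrec fun n : ℕ => n := Primrec.id
    exact (h2 (h2 (h2 h4 (h1 1)) (h3 h4 (h1 (r + 1)))) (h2 (h2 h4 (h1 1))
      (h3 h4 (h2 (h3 (h2 h4 (h1 1)) (h2 (h1 1) (h3 (h1 r) (h3 (h1 2) h4)))) (h1 1))))).to_comp
  -- The decision procedure as a function on numbers, with the arbitrary value `0` where no list is
  -- coded.
  set u : ℕ → ℕ := fun n =>
    ((Encodable.decode (α := List Bool) n).map fun l => if decide (p l) then 1 else 0).getD 0 with hu
  have hcu : Computable u := by
    refine Computable.option_getD (Computable.option_map Computable.decode ?_) (Computable.const 0)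
    exact (Computable.cond (hc.comp Computable.snd) (Computable.const 1) (Computable.const 0)).of_eq
      fun a => by cases h : decide (p a.2) <;> simp [h]
  -- Cutting off makes the length bounded in terms of the parameter on all inputs; on codes with
  -- arities at most `r` it does not change the prefix.
  set m : List Bool → ℕ := fun x => Min.min (_root_.posB x) (codeBound r (_root_.embParam x)) with hm
  have hpm : PL embP m := by
    unfold m codeBound
    fun_prop
  have hml : ∀ x : List Bool, m x ≤ codeBound r (_root_.embParam x) := fun x => min_le_right _ _
  have hcode : PL embP fun x : List Bool => _root_.prefixCode x (m x) :=
    prefixCode id hpm hb fun x _ => hml x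
  have huc : PL embP fun x : List Bool => u (_root_.prefixCode x (m x)) := by
    refine computable hcode hcu (computable_listCodeBound.comp hb) fun x _ => ?_
    refine (encode_le_listCodeBound _).trans (monotone_listCodeBound ?_)
    rw [List.length_take]
    exact (min_le_left _ _).trans (hml x)
  have : PL embP fun x : List Bool => PairOK x ∧ (BAll (_root_.decNum x) fun j =>
      _root_.decArity x j ≤ r) ∧ u (_root_.prefixCode x (m x)) ≠ 0 := by
    have := ne_zero huc
    fun_prop
  refine this.congr fun x => ?_
  have hmem : PairOK x → (BAll (_root_.decNum x) fun j => _root_.decArity x j ≤ r) →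
      (u (_root_.prefixCode x (m x)) ≠ 0 ↔
        (⟨decVoc x, decStr x (_root_.posA x)⟩ : Σ τ, FinStr τ) ∈ 𝒜) := by
    intro hx har
    have hs := hx.strCode
    have hle := hs.length_le (r := r) fun j => har j j.2
    rw [List.length_take, ← embParam_eq hx.pairCode] at hle
    have hpx : x.take (m x) = x.take (_root_.posB x) := by
      rcases le_or_gt (_root_.posB x) (codeBound r (_root_.embParam x)) with h | h
      · simp [m, h]
      -- If the cut-off takes effect, then by `hle` the bound is at least the length of the whole
      -- input, and both prefixes are the input.
      · have : codeBound r (_root_.embParam x) = m x := (min_eq_right h.le).symm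
        rw [List.take_of_length_le, List.take_of_length_le] <;> omega
    have : u (_root_.prefixCode x (m x)) ≠ 0 ↔ p (x.take (_root_.posB x)) := by
      simp only [u, _root_.prefixCode, Encodable.encodek, hpx, Option.map_some, Option.getD_some]
      by_cases h : p (x.take (_root_.posB x)) <;> simp [h]
    rw [this, hp]
    constructor
    · rintro ⟨τ, A, h1, h2⟩
      rwa [← h2.inj hs]
    · exact fun h => ⟨_, _, h, hs⟩
  simp only [eq_iff_iff]
  constructor
  · rintro ⟨h1, h2, h3⟩
    exact ⟨h1, (hmem h1 h2).1 h3⟩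
  · rintro ⟨h1, h2⟩
    have h3 : BAll (_root_.decNum x) fun j => _root_.decArity x j ≤ r := fun j hj => hr _ h2 ⟨j, hj⟩
    exact ⟨h1, h3, (hmem h1 h3).2 h2⟩

end PL

/-! Tree decompositions and elimination orders -/

/-- Root the tree at `r`: the ancestors of `s` are the nodes on the path from `r` to `s`, and the
depth is the length of this path. Two ancestors of the same node are comparable, and a set closed
under paths has a topmost node, which is an ancestor of all its nodes. -/
theorem SimpleGraph.IsTree.exists_rooting {W : Type} {T : SimpleGraph W} (hT : T.IsTree) (r : W) :
    ∃ (depth : W → ℕ) (anc : W → W → Prop), (∀ t a s, anc t a → anc a s → anc t s) ∧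
      (∀ a b s, anc a s → anc b s → depth a ≤ depth b →
        anc a b ∧ ∃ p : T.Walk a s, p.IsPath ∧ b ∈ p.support) ∧
      ∀ S : Set W, (∀ a ∈ S, ∀ b ∈ S, ∀ p : T.Walk a b, p.IsPath → ∀ c ∈ p.support, c ∈ S) →
        ∀ a ∈ S, (∀ b ∈ S, depth a ≤ depth b) → ∀ s ∈ S, anc a s := by
  classical
  choose P hP hPu using hT.existsUnique_path r
  have take : ∀ {a s : W} (h : a ∈ (P s).support), (P s).takeUntil a h = P a := fun h =>
    hPu _ _ ((hP _).takeUntil h)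
  have split : ∀ {a s : W} (h : a ∈ (P s).support),
      (P a).append ((P s).dropUntil a h) = P s := fun h => by
    rw [← take h]
    exact (P _).take_spec h
  have eq_of_le : ∀ {a s : W}, a ∈ (P s).support → (P s).length ≤ (P a).length → a = s := by
    intro a s h hle
    have := congrArg Walk.length (split h)
    rw [Walk.length_append] at this
    exact Walk.eq_of_length_eq_zero (p := (P s).dropUntil a h) (by omega)
  refine ⟨fun t => (P t).length, fun a s => a ∈ (P s).support, fun t a s h1 h2 => ?_,
    fun a b s ha hb hle => ?_, fun S hS a ha hmin s hs => ?_⟩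
  · dsimp only at *
    rw [← split h2, Walk.mem_support_append_iff]
    exact .inl h1
  · dsimp only at *
    by_cases hb' : b ∈ (P a).support
    · obtain rfl := eq_of_le hb' hle
      exact ⟨Walk.end_mem_support _, (P s).dropUntil b hb, (hP s).dropUntil hb,
        Walk.start_mem_support _⟩
    · have hd : b ∈ ((P s).dropUntil a ha).support := by
        rw [← split ha, Walk.mem_support_append_iff] at hb
        exact hb.resolve_left hb'
      refine ⟨?_, _, (hP s).dropUntil ha, hd⟩
      have e : (((P a).append (((P s).dropUntil a ha).takeUntil b hd)).append
          (((P s).dropUntil a ha).dropUntil b hd)) = P s := by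
        rw [← Walk.append_assoc, Walk.take_spec, split ha]
      have hp := hP s
      rw [← e] at hp
      rw [← hPu _ _ hp.of_append_left, Walk.mem_support_append_iff]
      exact .inl (Walk.end_mem_support _)
  · obtain ⟨q, hq, -⟩ := hT.existsUnique_path a s
    -- A node that the path to `a` shares with `q` lies in `S`, so by minimality it is not higher
    -- than `a`; thus it is `a` itself, and the concatenation repeats no node.
    have hpath : ((P a).append q).IsPath := by
      rw [Walk.isPath_def, Walk.support_append, List.nodup_append']
      have hq' := hq.support_nodup
      rw [← Walk.cons_tail_support, List.nodup_cons] at hq'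
      refine ⟨(hP a).support_nodup, hq'.2, fun c hc hc' => ?_⟩
      have hcS := hS a ha s hs q hq c (List.mem_of_mem_tail hc')
      obtain rfl := eq_of_le hc (hmin c hcS)
      exact hq'.1 hc'
    rw [← hPu _ _ hpath, Walk.mem_support_append_iff]
    exact .inl (Walk.end_mem_support _)

/-- The vertices of `C` can be eliminated, the set of the eliminated vertices that are still
remembered being `X`, without ever remembering more than `n` vertices: components of `C` are treated
separately, and a vertex may be forgotten if it has no neighbour left. -/
inductive SimpleGraph.Elim {V : Type} [DecidableEq V] (G : SimpleGraph V) (n : ℕ) :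
    Finset V → Finset V → Prop
  | nil (X) : Elim G n ∅ X
  | split {C₁ C₂ X} : Disjoint C₁ C₂ → C₁.Nonempty → C₂.Nonempty →
      (∀ u ∈ C₁, ∀ v ∈ C₂, ¬ G.Adj u v) → Elim G n C₁ X → Elim G n C₂ X → Elim G n (C₁ ∪ C₂) X
  | intro {v C X X'} : v ∈ C → v ∈ X' → X' ⊆ insert v X → X'.card ≤ n →
      (∀ c ∈ C, ∀ u ∈ X, G.Adj c u → u ∈ X') → Elim G n (C.erase v) X' → Elim G n C X

/-- Let `top v` be the highest node whose bag contains `v`; it is an ancestor of all such nodes.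
Choose `v` in `C` with `top v` of least depth. An edge between an element below `top v` and one that
is not would put the tops of both above a common node, making `top v` an ancestor of the second one,
so these two parts of `C` can be split. If all of `C` is below `top v`, then `v` is eliminated and
of `X` only the elements in the bag of `top v` are kept, which bounds their number. -/
theorem TreeDecomposition.elim {V : Type} [Fintype V] [DecidableEq V] {G : SimpleGraph V}
    (D : TreeDecomposition G) {n : ℕ} (hn : ∀ t, (D.bag t).card ≤ n) :
    G.Elim n Finset.univ ∅ := by
  classical
  obtain ⟨r⟩ := D.isTree.connected.nonempty
  obtain ⟨depth, anc, trans, comp, root⟩ := D.isTree.exists_rooting r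
  have htop : ∀ v, ∃ t, v ∈ D.bag t ∧ ∀ s, v ∈ D.bag s → depth t ≤ depth s := by
    intro v
    obtain ⟨t, h1, h2⟩ := Finset.exists_min_image (Finset.univ.filter fun t => v ∈ D.bag t) depth
      (by
        obtain ⟨t, ht⟩ := D.vertex_mem v
        exact ⟨t, by simpa using ht⟩)
    exact ⟨t, by simpa using h1, fun s hs => h2 s (by simpa using hs)⟩
  choose top top_mem top_le using htop
  have top_anc : ∀ v s, v ∈ D.bag s → anc (top v) s := fun v s hs =>
    root {t | v ∈ D.bag t} (fun a ha b hb p hp c hc => D.path_mem a b c p hp hc v ha hb) _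
      (top_mem v) (top_le v) s hs
  -- The invariant: remembered elements have tops at most as deep as those of the elements still to
  -- come.
  suffices key : ∀ (N : ℕ) (C X : Finset V), C.card = N →
      (∀ u ∈ X, ∀ c ∈ C, depth (top u) ≤ depth (top c)) → G.Elim n C X from
    key _ _ _ rfl (by simp)
  intro N
  induction N using Nat.strong_induction_on with
  | _ N ih =>
    intro C X hN hX
    rcases C.eq_empty_or_nonempty with rfl | hC
    · exact .nil X
    obtain ⟨v, hv, hmin⟩ := Finset.exists_min_image C (fun c => depth (top c)) hC
    set C₁ := C.filter fun c => anc (top v) (top c) with hC₁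
    set C₂ := C.filter fun c => ¬ anc (top v) (top c) with hC₂
    have hu : C₁ ∪ C₂ = C := Finset.filter_union_filter_not_eq _ _
    have hd : Disjoint C₁ C₂ := Finset.disjoint_filter_filter_not _ _ _
    have hv₁ : v ∈ C₁ := Finset.mem_filter.2 ⟨hv, top_anc v _ (top_mem v)⟩
    have hcard : C₁.card + C₂.card = N := by rw [← Finset.card_union_of_disjoint hd, hu, hN]
    have hpos : 0 < C₁.card := Finset.card_pos.2 ⟨v, hv₁⟩
    rcases C₂.eq_empty_or_nonempty with h₂ | h₂
    · have hall : ∀ c ∈ C, anc (top v) (top c) := by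
        intro c hc
        by_contra h
        have : c ∈ C₂ := Finset.mem_filter.2 ⟨hc, h⟩
        simp [h₂] at this
      refine .intro (X' := insert v (X ∩ D.bag (top v))) hv (Finset.mem_insert_self _ _)
        (Finset.insert_subset_insert _ Finset.inter_subset_left) ?_ ?_ ?_
      · refine (Finset.card_le_card ?_).trans (hn (top v))
        exact Finset.insert_subset (top_mem v) Finset.inter_subset_right
      · intro c hc u hu hcu
        obtain ⟨s, hcs, hus⟩ := D.edge_mem c u hcu
        -- A remembered neighbour `u` of some `c` in `C` shares a bag `s` with it. As `top v` lies
        -- on the path from `top u` to `s`, its bag contains `u`, so `u` is not forgotten.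
        obtain ⟨-, p, hp, hmem⟩ := comp (top u) (top v) s (top_anc u s hus)
          (trans _ _ _ (hall c hc) (top_anc c s hcs)) (hX u hu v hv)
        exact Finset.mem_insert_of_mem (Finset.mem_inter.2
          ⟨hu, D.path_mem _ _ _ p hp hmem u (top_mem u) hus⟩)
      · have := Finset.card_erase_lt_of_mem hv
        refine ih _ (by omega) _ _ rfl fun u hu c hc => ?_
        rcases Finset.mem_insert.1 hu with rfl | hu
        · exact hmin c (Finset.mem_of_mem_erase hc)
        · exact hX u (Finset.mem_inter.1 hu).1 c (Finset.mem_of_mem_erase hc)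
    · have hpos₂ := Finset.card_pos.2 h₂
      rw [← hu]
      refine .split hd ⟨v, hv₁⟩ h₂ (fun a ha c hc hac => ?_)
        (ih _ (by omega) _ _ rfl fun u hu c hc => hX u hu c (Finset.mem_filter.1 hc).1)
        (ih _ (by omega) _ _ rfl fun u hu c hc => hX u hu c (Finset.mem_filter.1 hc).1)
      obtain ⟨s, has, hcs⟩ := D.edge_mem a c hac
      obtain ⟨hcC, hc⟩ := Finset.mem_filter.1 hc
      exact hc (comp _ _ s (trans _ _ _ (Finset.mem_filter.1 ha).2 (top_anc a s has))
        (top_anc c s hcs) (hmin c hcC)).1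

/-- The infimum is attained, because there is at least the decomposition with a single bag; over the
empty set it would be `0` without any meaning. -/
theorem exists_treeDecomposition_of_treewidth_le {V : Type} [Fintype V] {G : SimpleGraph V} {w : ℕ}
    (h : treewidth G ≤ w) : ∃ D : TreeDecomposition G, ∀ t, (D.bag t).card ≤ w + 1 := by
  have hne : (Set.range fun D : TreeDecomposition G => D.width).Nonempty := by
    refine ⟨_, ⟨⟨1, ⊥, .of_subsingleton, fun _ => Finset.univ, fun v => ⟨0, Finset.mem_univ v⟩,
      fun u v _ => ⟨0, Finset.mem_univ u, Finset.mem_univ v⟩,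
      fun _ _ _ _ _ _ v _ _ => Finset.mem_univ v⟩, rfl⟩⟩
  obtain ⟨D, hD⟩ := Nat.sInf_mem hne
  refine ⟨D, fun t => ?_⟩
  have h1 : D.width ≤ w := hD.trans_le h
  have h2 : (D.bag t).card ≤ Finset.univ.sup fun t => (D.bag t).card :=
    Finset.le_sup (f := fun t => (D.bag t).card) (Finset.mem_univ t)
  unfold TreeDecomposition.width at h1
  omega

/-! The embedding game -/

/-- The base for the digits representing pairs of an element of the first and one of the second
structure. -/
noncomputable def slotBase (x : List Bool) : ℕ := Nat.pair (embParam x) x.length + 2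

/-- The `s`-th slot of `H`: zero or a pair plus one. -/
noncomputable def slot (x : List Bool) (H s : ℕ) : ℕ := digit (slotBase x) H s

/-- The partial map represented by the first `n` slots of `H` maps `u` to `b`. -/
def HasSlot (x : List Bool) (n H u b : ℕ) : Prop := BEx n fun s => slot x H s = Nat.pair u b + 1

def InDom (x : List Bool) (n H u : ℕ) : Prop :=
  BEx n fun s => slot x H s ≠ 0 ∧ nfst (slot x H s - 1) = u

/-- The number of elements of the first structure. -/
noncomputable def cardA (x : List Bool) : ℕ := onesAt x (posA x)

/-- The number of elements of the second structure. -/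
noncomputable def cardB (x : List Bool) : ℕ := onesAt x (posB x)

/-- The entry of the table `T` for a pair of elements of the first structure: a position and a
bit. -/
noncomputable def tableAt (x : List Bool) (T u v : ℕ) : ℕ :=
  digit (2 * (Nat.log 2 x.length + 1)) T (u * cardA x + v)

/-- The element `b` has the bit required by the entry `d` of a table. -/
def BitMatches (b d : ℕ) : Prop :=
  BitOn b (d / 2) ∧ d % 2 = 1 ∨ ¬ BitOn b (d / 2) ∧ ¬ d % 2 = 1

/-- The table `T` allows that `v` is mapped to `b`. -/
def Compat (x : List Bool) (T v b : ℕ) : Prop :=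
  BAll (cardA x) fun u => (¬ v < u ∨ BitMatches b (tableAt x T v u)) ∧
    (¬ u < v ∨ ¬ BitMatches b (tableAt x T u v))

/-- Tuples inside the domain of `H` are mapped to tuples. -/
def HomOn (x : List Bool) (n H : ℕ) : Prop :=
  BAll (decNum x) fun j => BAll (relCount x (posA x) j) fun t =>
    (BEx (decArity x j) fun e => ¬ InDom x n H (entry x (posA x) j t e)) ∨
    BEx (relCount x (posB x) j) fun t' => BAll (decArity x j) fun e =>
      HasSlot x n H (entry x (posA x) j t e) (entry x (posB x) j t' e)

/-- The `t`-th tuple of the `j`-th relation of the first structure has an entry in `C`. -/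
def Meets (x : List Bool) (C j t : ℕ) : Prop :=
  BEx (decArity x j) fun e => BitOn C (entry x (posA x) j t e)

/-- `C` is the disjoint union of `C₁` and `C₂`, and no tuple meets both. -/
def SplitOK (x : List Bool) (C C₁ C₂ : ℕ) : Prop :=
  (BAll (cardA x) fun i => (BitOn C i ∧ (BitOn C₁ i ∧ ¬ BitOn C₂ i ∨ ¬ BitOn C₁ i ∧ BitOn C₂ i)) ∨
    (¬ BitOn C i ∧ ¬ BitOn C₁ i ∧ ¬ BitOn C₂ i)) ∧
  BAll (decNum x) fun j => BAll (relCount x (posA x) j) fun t => ¬ (Meets x C₁ j t ∧ Meets x C₂ j t)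

/-- `C'` is `C` without `v`. -/
def EraseOK (x : List Bool) (C C' v : ℕ) : Prop :=
  v < cardA x ∧ BitOn C v ∧ BAll (cardA x) fun i =>
    (BitOn C i ∧ ¬ i = v ∧ BitOn C' i) ∨ ((¬ BitOn C i ∨ i = v) ∧ ¬ BitOn C' i)

/-- `H'` is a part of `H` together with the new pair `(v, b)`; no element that occurs together with
an element of `C` is forgotten. -/
def ExtendOK (x : List Bool) (n C H v b H' : ℕ) : Prop :=
  b < cardB x ∧ HasSlot x n H' v b ∧
  (BAll n fun s => slot x H' s = 0 ∨ slot x H' s = slot x H s ∨ slot x H' s = Nat.pair v b + 1) ∧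
  BAll (decNum x) fun j => BAll (relCount x (posA x) j) fun t => ¬ Meets x C j t ∨
    BAll (decArity x j) fun e =>
      ¬ InDom x n H (entry x (posA x) j t e) ∨ InDom x n H' (entry x (posA x) j t e)

/-- A number representing the position with table `T`, remaining elements `C` and partial map
`H`. -/
def gamePos (T C H : ℕ) : ℕ := Nat.pair 1 (Nat.pair T (Nat.pair C H))

open Classical in
/-- The position after the move `g`, which is the pair of `k` and of `C₁, C₂, v, b, H'`. -/
noncomputable def moveTo (n : ℕ) (a : List Bool × ℕ × ℕ × ℕ × ℕ × ℕ × ℕ × ℕ × ℕ × ℕ × ℕ) : ℕ :=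
  let x := a.1
  let T := a.2.1
  let C := a.2.2.1
  let H := a.2.2.2.1
  let k := a.2.2.2.2.1
  let C₁ := a.2.2.2.2.2.1
  let C₂ := a.2.2.2.2.2.2.1
  let v := a.2.2.2.2.2.2.2.1
  let b := a.2.2.2.2.2.2.2.2.1
  let H' := a.2.2.2.2.2.2.2.2.2.1
  let i := a.2.2.2.2.2.2.2.2.2.2
  if k = 0 then
    if SplitOK x C C₁ C₂ then gamePos T (if i = 0 then C₁ else C₂) H else Nat.pair 2 0
  else
    if EraseOK x C C₁ v ∧ Compat x T v b ∧ ExtendOK x n C H v b H' then gamePos T C₁ H'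
    else Nat.pair 2 0

/-- The set of all elements of the first structure. -/
noncomputable def fullMask (x : List Bool) : ℕ := 2 ^ min (cardA x) (embParam x) - 1

/-- Logarithm of a bound for tables, sets of elements, and partial maps. -/
noncomputable def compBits (n : ℕ) (x : List Bool) : ℕ :=
  embParam x * embParam x * (embParam x * embParam x) + 2 * (embParam x * embParam x) +
    Nat.log 2 x.length + 1 + embParam x + n * (2 * (embParam x + Nat.log 2 x.length + 2) + 1)

/-- The number of bits of a move. -/
noncomputable def moveBits (n : ℕ) (x : List Bool) : ℕ := 32 * compBits n x

noncomputable def posBound (n : ℕ) (x : List Bool) : ℕ := 2 ^ moveBits n x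

-- The initial position has first component `0`, and the number chosen there is the table; the
-- universal bit of that round is ignored. The position `Nat.pair 2 0` is lost. Sending oversized
-- positions there makes the bound on positions hold for all moves, sensible or not.
open Classical in
noncomputable def gameUpd (n : ℕ) (a : List Bool × ℕ × ℕ × ℕ) : ℕ :=
  let y := if nfst a.2.1 = 0 then gamePos a.2.2.1 (fullMask a.1) 0 else
    moveTo n (a.1, nfst (nsnd a.2.1), nfst (nsnd (nsnd a.2.1)), nsnd (nsnd (nsnd a.2.1)),
      nfst a.2.2.1, nfst (nsnd a.2.2.1), nfst (nsnd (nsnd a.2.2.1)), nfst (nsnd (nsnd (nsnd a.2.2.1))),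
      nfst (nsnd (nsnd (nsnd (nsnd a.2.2.1)))), nsnd (nsnd (nsnd (nsnd (nsnd a.2.2.1)))), a.2.2.2)
  if y ≤ posBound n a.1 then y else Nat.pair 2 0

/-- The embedding game for the structures satisfying `M`. Positions with first component `0` are
initial; in the first round, the table is chosen. -/
noncomputable def embGame (M : List Bool → Prop) (n : ℕ) : RoundGame where
  status a := open Classical in
    if nfst a.2 = 0 then if M a.1 then 2 else 0 else
    if nfst a.2 = 1 ∧ HomOn a.1 n (nsnd (nsnd (nsnd a.2))) then
      if BAll (cardA a.1) fun i => ¬ BitOn (nfst (nsnd (nsnd a.2))) i then 1 else 2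
    else 0
  upd := gameUpd n
  bits := moveBits n
  rounds x := open Classical in if Nat.log 2 x.length = 0 then 0 else embParam x + 2
  start _ := 0

theorem cardA_le (x : List Bool) (h : PairOK x) : cardA x ≤ embParam x := by
  rw [embParam_eq_decSize, if_pos h, decSize, cardA]
  omega

theorem two_pow_log_le (n : ℕ) : 2 ^ Nat.log 2 n ≤ n + 1 := by
  rcases Nat.eq_zero_or_pos n with rfl | h
  · simp
  · exact (Nat.pow_log_le_self 2 h.ne').trans (Nat.le_succ n)

/-- The part of `compBits` depending on the parameter only. -/
def paramBits (n k : ℕ) : ℕ := k * k * (k * k) + 2 * (k * k) + 1 + k + n * (2 * (k + 2) + 1)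

theorem compBits_eq (n : ℕ) (x : List Bool) :
    compBits n x = (1 + 2 * n) * Nat.log 2 x.length + paramBits n (embParam x) := by
  unfold compBits paramBits
  ring

theorem primrec_paramBits (n : ℕ) : Primrec (paramBits n) := by
  have h1 : ∀ c : ℕ, Primrec fun _ : ℕ => c := Primrec.const
  have h2 : ∀ {f g : ℕ → ℕ}, Primrec f → Primrec g → Primrec fun n => f n + g n :=
    fun h h' => Primrec.nat_add.comp h h'
  have h3 : ∀ {f g : ℕ → ℕ}, Primrec f → Primrec g → Primrec fun n => f n * g n :=
    fun h h' => Primrec.nat_mul.comp h h'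
  have h4 : Primrec fun n : ℕ => n := Primrec.id
  exact h2 (h2 (h2 (h2 (h3 (h3 h4 h4) (h3 h4 h4)) (h3 (h1 2) (h3 h4 h4))) (h1 1)) h4)
    (h3 (h1 n) (h2 (h3 (h1 2) (h2 h4 (h1 2))) (h1 1)))

theorem primrec_two_pow : Primrec fun k : ℕ => 2 ^ k := by
  have h : Primrec fun k : ℕ => Nat.rec (motive := fun _ => ℕ) 1 (fun _ y => 2 * y) k :=
    Primrec.nat_rec₁ _ (Primrec.nat_mul.comp (Primrec.const 2) Primrec.snd)
  refine h.of_eq fun k => ?_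
  induction k with
  | zero => rfl
  | succ k ih => rw [pow_succ', ← ih]

/-- The exponent is a constant multiple of the logarithm, giving a power of the length, plus a term
depending on the parameter only. The coefficient of the logarithm contains the number of slots `n`
but not the parameter; this is where bounded treewidth pays. -/
theorem polyBd_posBound (n : ℕ) : PolyBd embParam fun x _ => posBound n x := by
  have hp : Computable fun k => 2 ^ (32 * paramBits n k) :=
    (primrec_two_pow.comp (Primrec.nat_mul.comp (Primrec.const 32) (primrec_paramBits n))).to_comp
  refine (((PolyBd.length.add (.const 1)).pow (32 * (1 + 2 * n))).mul (.param hp)).mono fun x _ => ?_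
  rw [posBound, moveBits, compBits_eq, mul_add, pow_add]
  refine Nat.mul_le_mul_right _ ?_
  rw [← mul_assoc, mul_comm _ (Nat.log 2 x.length), pow_mul]
  exact Nat.pow_le_pow_left (two_pow_log_le _) _

/-! ### The conditions of the game are computable within the allowed space -/

namespace PL

variable {κ : InputParam} {α : Type} [NumRep α] {f : α → List Bool} {g h k l m : α → ℕ}

@[fun_prop]
theorem slot (hf : PL embP f) (hg : PL embP g) (hh : PL embP h) :
    PL embP fun a => slot (f a) (g a) (h a) := by
  unfold _root_.slot slotBase; fun_prop

@[fun_prop]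
theorem hasSlot {n : ℕ} (hf : PL embP f) (hg : PL embP g) (hh : PL embP h) (hk : PL embP k) :
    PL embP fun a => HasSlot (f a) n (g a) (h a) (k a) := by
  unfold HasSlot; fun_prop

@[fun_prop]
theorem inDom {n : ℕ} (hf : PL embP f) (hg : PL embP g) (hh : PL embP h) :
    PL embP fun a => InDom (f a) n (g a) (h a) := by
  unfold InDom; fun_prop

@[fun_prop]
theorem cardA (hf : PL κ f) : PL κ fun a => cardA (f a) := by
  unfold _root_.cardA; fun_prop

@[fun_prop]
theorem cardB (hf : PL κ f) : PL κ fun a => cardB (f a) := by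
  unfold _root_.cardB; fun_prop

@[fun_prop]
theorem tableAt (hf : PL κ f) (hg : PL κ g) (hh : PL κ h) (hk : PL κ k) :
    PL κ fun a => tableAt (f a) (g a) (h a) (k a) := by
  unfold _root_.tableAt; fun_prop

@[fun_prop]
theorem bitMatches (hg : PL κ g) (hh : PL κ h) : PL κ fun a => BitMatches (g a) (h a) := by
  unfold BitMatches; fun_prop

@[fun_prop]
theorem compat (hf : PL κ f) (hg : PL κ g) (hh : PL κ h) (hk : PL κ k) :
    PL κ fun a => Compat (f a) (g a) (h a) (k a) := by
  unfold Compat; fun_prop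

@[fun_prop]
theorem homOn {n : ℕ} (hf : PL embP f) (hg : PL embP g) : PL embP fun a => HomOn (f a) n (g a) := by
  unfold HomOn; fun_prop

@[fun_prop]
theorem meets (hf : PL κ f) (hg : PL κ g) (hh : PL κ h) (hk : PL κ k) :
    PL κ fun a => Meets (f a) (g a) (h a) (k a) := by
  unfold Meets; fun_prop

@[fun_prop]
theorem splitOK (hf : PL κ f) (hg : PL κ g) (hh : PL κ h) (hk : PL κ k) :
    PL κ fun a => SplitOK (f a) (g a) (h a) (k a) := by
  unfold SplitOK; fun_prop

@[fun_prop]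
theorem eraseOK (hf : PL κ f) (hg : PL κ g) (hh : PL κ h) (hk : PL κ k) :
    PL κ fun a => EraseOK (f a) (g a) (h a) (k a) := by
  unfold EraseOK; fun_prop

@[fun_prop]
theorem extendOK {n : ℕ} (hf : PL embP f) (hg : PL embP g) (hh : PL embP h) (hk : PL embP k)
    (hl : PL embP l) (hm : PL embP m) :
    PL embP fun a => ExtendOK (f a) n (g a) (h a) (k a) (l a) (m a) := by
  unfold ExtendOK; fun_prop

@[fun_prop]
theorem gamePos (hf : PL κ g) (hg : PL κ h) (hk : PL κ k) :
    PL κ fun a => gamePos (g a) (h a) (k a) := by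
  unfold _root_.gamePos; fun_prop

theorem moveTo (n : ℕ) : PL embP (moveTo n) := by
  unfold _root_.moveTo; dsimp only; fun_prop

theorem moveBits (n : ℕ) : PL embP (moveBits n) := by
  unfold _root_.moveBits compBits; fun_prop

theorem two_pow {F : List Bool → ℕ} (hF : PL κ F) (hB : PolyBd κ.val fun x _ => 2 ^ F x) :
    PL κ fun x => 2 ^ F x := by
  have := natRec (κ := κ) (α := List Bool) (fun x i => 2 ^ Min.min i (F x)) (const 1)
    (step := fun x i y => if i < F x then 2 * y else y) (by fun_prop) (fun _ => by simp)
    (fun x i => ?_) hB (fun x z i => Nat.pow_le_pow_right (by norm_num) (min_le_right _ _)) hF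
  · exact this.congr fun x => by simp
  · split_ifs with h
    · rw [min_eq_left h.le, min_eq_left h, pow_succ']
    · rw [min_eq_right (by omega), min_eq_right (by omega)]

theorem posBound (n : ℕ) : PL embP (posBound n) := two_pow (moveBits n) (polyBd_posBound n)

end PL

/-- On strings that are not codes the number of elements need not be bounded by the parameter, so
the exponent is the minimum of the two. -/
theorem PL.fullMask : PL embP fullMask := by
  have h : PL embP fun x : List Bool => Min.min (_root_.cardA x) (_root_.embParam x) := by fun_prop
  have := two_pow h ((PolyBd.param (κ := _root_.embParam) primrec_two_pow.to_comp).mono fun x _ =>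
    Nat.pow_le_pow_right (by norm_num) (min_le_right _ _))
  unfold _root_.fullMask
  fun_prop

theorem embGame_isPL {M : List Bool → Prop} (hM : PL embP M) (n : ℕ) : (embGame M n).IsPL embP where
  status := by
    unfold embGame; dsimp only; fun_prop
  upd := by
    have h1 := PL.moveTo n
    have h2 := PL.posBound n
    have h3 := PL.fullMask
    unfold embGame gameUpd
    dsimp only
    generalize moveTo n = F at *
    generalize posBound n = K at *
    generalize fullMask = G at *
    fun_prop
  bits := PL.moveBits n
  rounds := by
    unfold embGame; dsimp only; fun_prop
  start := PL.const 0

/-! Soundness of the embedding game -/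

/-- The map `h` is an embedding of the first structure coded by `x` into the second one. -/
def IsEmb (x : List Bool) (h : ℕ → ℕ) : Prop :=
  (∀ u < cardA x, h u < cardB x) ∧ (∀ u < cardA x, ∀ v < cardA x, h u = h v → u = v) ∧
  ∀ j < decNum x, ∀ t < relCount x (posA x) j, ∃ t' < relCount x (posB x) j,
    ∀ e < decArity x j, entry x (posB x) j t' e = h (entry x (posA x) j t e)

theorem inDom_iff {x : List Bool} {n H u : ℕ} : InDom x n H u ↔ ∃ b, HasSlot x n H u b := by
  constructor
  · rintro ⟨s, hs, h1, h2⟩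
    refine ⟨nsnd (slot x H s - 1), s, hs, ?_⟩
    rw [← h2, nfst, nsnd, Nat.pair_unpair]
    omega
  · rintro ⟨b, s, hs, h⟩
    exact ⟨s, hs, by rw [h]; omega, by rw [h, Nat.add_sub_cancel, nfst_pair]⟩

theorem entry_lt {x : List Bool} {s : ℕ} (hx : StrOK x s) {j t e : ℕ} (hj : j < decNum x)
    (ht : t < relCount x s j) (he : e < decArity x j) : entry x s j t e < onesAt x s :=
  ((hx.2.2 j hj).2.1 t ht e he).1

namespace EmbGame

variable {M : List Bool → Prop} {x : List Bool} {n : ℕ}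

theorem status_gamePos (T C H : ℕ) : (embGame M n).status (x, gamePos T C H) = open Classical in
    if HomOn x n H then if ∀ i < cardA x, ¬ BitOn C i then 1 else 2 else 0 := by
  have e1 : nfst (gamePos T C H) = 1 := nfst_pair _ _
  have e2 : nfst (nsnd (nsnd (gamePos T C H))) = C := by simp [gamePos]
  have e3 : nsnd (nsnd (nsnd (gamePos T C H))) = H := by simp [gamePos]
  simp only [embGame]
  rw [if_neg (by omega)]
  by_cases h : HomOn x n H
  · rw [if_pos ⟨e1, by rwa [e3]⟩, if_pos h, e2]
    by_cases hC : ∀ i < cardA x, ¬ BitOn C i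
    · exact (if_pos hC).trans (if_pos hC).symm
    · exact (if_neg hC).trans (if_neg hC).symm
  · rw [if_neg (fun h' => h (by rw [e3] at h'; exact h'.2)), if_neg h]

theorem not_wins_dead (t : ℕ) : ¬ (embGame M n).Wins x t (Nat.pair 2 0) := by
  have : (embGame M n).status (x, Nat.pair 2 0) = 0 := by simp [embGame]
  cases t <;> simp [RoundGame.Wins, this]

theorem wins_ite {t y : ℕ} {p : Prop} [Decidable p] :
    (embGame M n).Wins x t (if p then y else Nat.pair 2 0) ↔ p ∧ (embGame M n).Wins x t y := by
  split_ifs with h <;> simp [h, not_wins_dead]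

theorem wins_upd {t T C H g i : ℕ} :
    (embGame M n).Wins x t (gameUpd n (x, gamePos T C H, g, i)) ↔
      moveTo n (x, T, C, H, nfst g, nfst (nsnd g), nfst (nsnd (nsnd g)), nfst (nsnd (nsnd (nsnd g))),
        nfst (nsnd (nsnd (nsnd (nsnd g)))), nsnd (nsnd (nsnd (nsnd (nsnd g)))), i) ≤ posBound n x ∧
      (embGame M n).Wins x t (moveTo n (x, T, C, H, nfst g, nfst (nsnd g), nfst (nsnd (nsnd g)),
        nfst (nsnd (nsnd (nsnd g))), nfst (nsnd (nsnd (nsnd (nsnd g)))),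
        nsnd (nsnd (nsnd (nsnd (nsnd g)))), i)) := by
  simp only [gameUpd, gamePos, nfst_pair, nsnd_pair, one_ne_zero, if_false]
  exact wins_ite

theorem wins_split {t T C H C₁ C₂ v b H' i : ℕ} :
    (embGame M n).Wins x t (moveTo n (x, T, C, H, 0, C₁, C₂, v, b, H', i)) ↔
      SplitOK x C C₁ C₂ ∧ (embGame M n).Wins x t (gamePos T (if i = 0 then C₁ else C₂) H) := by
  classical
  simp only [moveTo, if_true]
  exact wins_ite

theorem wins_intro {t T C H k C₁ C₂ v b H' i : ℕ} (hk : k ≠ 0) :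
    (embGame M n).Wins x t (moveTo n (x, T, C, H, k, C₁, C₂, v, b, H', i)) ↔
      (EraseOK x C C₁ v ∧ Compat x T v b ∧ ExtendOK x n C H v b H') ∧
        (embGame M n).Wins x t (gamePos T C₁ H') := by
  classical
  simp only [moveTo, if_neg hk]
  exact wins_ite

/-- Properties of the positions that occur. -/
structure Inv (x : List Bool) (n C H : ℕ) : Prop where
  func : ∀ u b b', HasSlot x n H u b → HasSlot x n H u b' → b = b'
  disj : ∀ u < cardA x, BitOn C u → ¬ InDom x n H u
  closed : ∀ j < decNum x, ∀ t < relCount x (posA x) j, Meets x C j t → ∀ e < decArity x j,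
    BitOn C (entry x (posA x) j t e) ∨ InDom x n H (entry x (posA x) j t e)

/-- The map `g` extends the one represented by `H` to `C`, as required by `T`. -/
structure Extends (x : List Bool) (n T C H : ℕ) (g : ℕ → ℕ) : Prop where
  eq : ∀ u b, HasSlot x n H u b → g u = b
  compat : ∀ c < cardA x, BitOn C c → g c < cardB x ∧ Compat x T c (g c)
  hom : ∀ j < decNum x, ∀ t < relCount x (posA x) j, Meets x C j t →
    ∃ t' < relCount x (posB x) j, ∀ e < decArity x j,
      entry x (posB x) j t' e = g (entry x (posA x) j t e)

theorem Inv.split {C H C₁ C₂ : ℕ} (h : Inv x n C H) (hx : StrOK x (posA x))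
    (hC : SplitOK x C C₁ C₂) : Inv x n C₁ H ∧ Inv x n C₂ H := by
  obtain ⟨h1, h2⟩ := hC
  have sub : ∀ i < cardA x, (BitOn C₁ i → BitOn C i) ∧ (BitOn C₂ i → BitOn C i) := fun i hi => by
    have := h1 i hi; dsimp only at this; tauto
  refine ⟨⟨h.func, fun u hu hc => h.disj u hu ((sub u hu).1 hc), fun j hj t ht hm e he => ?_⟩,
    ⟨h.func, fun u hu hc => h.disj u hu ((sub u hu).2 hc), fun j hj t ht hm e he => ?_⟩⟩ <;>
  · obtain ⟨e', he', hm'⟩ := id hm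
    have hlt := entry_lt hx hj ht he
    have := h.closed j hj t ht ⟨e', he', by
      have := sub _ (entry_lt hx hj ht he'); dsimp only at *; tauto⟩ e he
    refine this.imp_left fun h3 => ?_
    have h4 := h1 _ hlt
    have h5 := h2 j hj t ht
    have h6 : ∀ D, BitOn D (entry x (posA x) j t e) → Meets x D j t := fun D hD => ⟨e, he, hD⟩
    have h7 := h6 C₁
    have h8 := h6 C₂
    dsimp only at *
    tauto

/-- Glue the two maps along the division of `C`. A tuple that meets one part has its other entries
in that part or in the domain of `H`, where both maps agree with `H`; so it is mapped as by one of
them. -/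
theorem Extends.split {T C H C₁ C₂ : ℕ} {g₁ g₂ : ℕ → ℕ} (h : Inv x n C H) (hx : StrOK x (posA x))
    (hC : SplitOK x C C₁ C₂) (h₁ : Extends x n T C₁ H g₁) (h₂ : Extends x n T C₂ H g₂) :
    ∃ g, Extends x n T C H g := by
  classical
  obtain ⟨i₁, i₂⟩ := h.split hx hC
  obtain ⟨h1, -⟩ := hC
  refine ⟨fun u => if u < cardA x ∧ BitOn C₁ u then g₁ u else g₂ u, fun u b hub => ?_,
    fun c hc hcC => ?_, fun j hj t ht hm => ?_⟩
  · split_ifs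
    · exact h₁.eq u b hub
    · exact h₂.eq u b hub
  · split_ifs with h3
    · exact h₁.compat c hc h3.2
    · refine h₂.compat c hc ?_
      have := h1 c hc
      dsimp only at this
      tauto
  · obtain ⟨e', he', hm'⟩ := id hm
    have hor : Meets x C₁ j t ∨ Meets x C₂ j t := by
      have := h1 _ (entry_lt hx hj ht he')
      dsimp only at this
      have h5 : ∀ D, BitOn D (entry x (posA x) j t e') → Meets x D j t := fun D hD => ⟨e', he', hD⟩
      have h7 := h5 C₁
      have h8 := h5 C₂
      tauto
    rcases hor with hm | hm
    · obtain ⟨t', ht', h3⟩ := h₁.hom j hj t ht hm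
      refine ⟨t', ht', fun e he => ?_⟩
      rw [h3 e he]
      have hlt := entry_lt hx hj ht he
      split_ifs with h4
      · rfl
      · rcases i₁.closed j hj t ht hm e he with h5 | h5
        · exact absurd ⟨hlt, h5⟩ h4
        · obtain ⟨b, hb⟩ := inDom_iff.1 h5
          rw [h₁.eq _ b hb, h₂.eq _ b hb]
    · obtain ⟨t', ht', h3⟩ := h₂.hom j hj t ht hm
      refine ⟨t', ht', fun e he => ?_⟩
      rw [h3 e he]
      have hlt := entry_lt hx hj ht he
      split_ifs with h4
      · rcases i₂.closed j hj t ht hm e he with h5 | h5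
        · have := h1 _ hlt
          dsimp only at this
          tauto
        · obtain ⟨b, hb⟩ := inDom_iff.1 h5
          rw [h₁.eq _ b hb, h₂.eq _ b hb]
      · rfl

theorem hasSlot_of_extendOK {C H v b H' u c : ℕ} (hE : ExtendOK x n C H v b H')
    (h : HasSlot x n H' u c) : HasSlot x n H u c ∨ u = v ∧ c = b := by
  obtain ⟨s, hs, h⟩ := h
  rcases hE.2.2.1 s hs with h1 | h1 | h1
  · omega
  · exact .inl ⟨s, hs, h1.symm.trans h⟩
  · rw [h, Nat.add_right_cancel_iff, Nat.pair_eq_pair] at h1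
    exact .inr h1

/-- Elements in the domain of `H` are never in `C`, so `v` is new and the added pair cannot conflict
with old ones. Entries of tuples meeting `C` are not forgotten, so closedness persists. -/
theorem Inv.extend {C H C₁ v b H' : ℕ} (h : Inv x n C H) (hx : StrOK x (posA x))
    (hv : EraseOK x C C₁ v) (hE : ExtendOK x n C H v b H') : Inv x n C₁ H' := by
  obtain ⟨hvk, hvC, hC⟩ := hv
  have hvH := h.disj v hvk hvC
  have sub : ∀ i < cardA x, BitOn C₁ i → BitOn C i ∧ i ≠ v := fun i hi h1 => by
    have := hC i hi; dsimp only at this; tauto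
  refine ⟨fun u c c' hc hc' => ?_, fun u hu huC huH => ?_, fun j hj t ht hm e he => ?_⟩
  · rcases hasSlot_of_extendOK hE hc with h1 | ⟨rfl, rfl⟩ <;>
    rcases hasSlot_of_extendOK hE hc' with h2 | ⟨h3, rfl⟩
    · exact h.func u c c' h1 h2
    · exact absurd (inDom_iff.2 ⟨c, h3 ▸ h1⟩) hvH
    · exact absurd (inDom_iff.2 ⟨c', h2⟩) hvH
    · rfl
  · obtain ⟨c, hc⟩ := inDom_iff.1 huH
    obtain ⟨h1, h2⟩ := sub u hu huC
    rcases hasSlot_of_extendOK hE hc with h3 | ⟨h3, -⟩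
    · exact h.disj u hu h1 (inDom_iff.2 ⟨c, h3⟩)
    · exact h2 h3
  · obtain ⟨e', he', hm'⟩ := id hm
    have hm2 : Meets x C j t := ⟨e', he', (sub _ (entry_lt hx hj ht he') hm').1⟩
    rcases h.closed j hj t ht hm2 e he with h1 | h1
    · by_cases hev : entry x (posA x) j t e = v
      · rw [hev]
        exact .inr (inDom_iff.2 ⟨b, hE.2.1⟩)
      · have := hC _ (entry_lt hx hj ht he)
        dsimp only at this
        tauto
    · rcases hE.2.2.2 j hj t ht with h2 | h2
      · exact absurd hm2 h2
      · rcases h2 e he with h3 | h3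
        · exact absurd h1 h3
        · exact .inr h3

/-- The map obtained for the new position may differ from `H` at forgotten elements, so there it is
corrected to the value of `H`. No tuple meeting `C` contains such an element. A tuple meeting `C` in
`v` only lies inside the domain of `H'`, and its image is guaranteed by the check of `H'`. -/
theorem Extends.extend {T C H C₁ v b H' : ℕ} {g : ℕ → ℕ} (h : Inv x n C H)
    (hx : StrOK x (posA x)) (hv : EraseOK x C C₁ v) (hE : ExtendOK x n C H v b H')
    (hT : Compat x T v b) (hH : HomOn x n H') (hg : Extends x n T C₁ H' g) :
    ∃ g, Extends x n T C H g := by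
  classical
  have h' := h.extend hx hv hE
  obtain ⟨hvk, hvC, hC⟩ := hv
  have hgv : g v = b := hg.eq v b hE.2.1
  choose! F hF using fun u (hu : InDom x n H u) => inDom_iff.1 hu
  set g' : ℕ → ℕ := fun u => if InDom x n H u ∧ ¬ InDom x n H' u then F u else g u with hg'
  have g'_eq : ∀ u, ¬ InDom x n H u ∨ InDom x n H' u → g' u = g u := fun u hu =>
    if_neg (by tauto)
  refine ⟨g', fun u c hc => ?_, fun c hc hcC => ?_, fun j hj t ht hm => ?_⟩
  · have hu := inDom_iff.2 ⟨c, hc⟩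
    by_cases h1 : InDom x n H' u
    · rw [g'_eq u (.inr h1)]
      obtain ⟨d, hd⟩ := inDom_iff.1 h1
      rw [hg.eq u d hd]
      rcases hasSlot_of_extendOK hE hd with h2 | ⟨h2, -⟩
      · exact h.func u d c h2 hc
      · exact absurd (h2 ▸ hu) (h.disj v hvk hvC)
    · have : g' u = F u := if_pos ⟨hu, h1⟩
      rw [this]
      exact h.func u _ c (hF u hu) hc
  · rw [g'_eq c (.inl (h.disj c hc hcC))]
    by_cases hcv : c = v
    · subst hcv
      rw [hgv]
      exact ⟨hE.1, hT⟩
    · refine hg.compat c hc ?_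
      have := hC c hc
      dsimp only at this
      tauto
  · have hstep : ∀ e < decArity x j, InDom x n H (entry x (posA x) j t e) →
        InDom x n H' (entry x (posA x) j t e) := fun e he h1 => by
      rcases hE.2.2.2 j hj t ht with h2 | h2
      · exact absurd hm h2
      · exact (h2 e he).resolve_left (not_not.2 h1)
    have heq : ∀ e < decArity x j, g' (entry x (posA x) j t e) = g (entry x (posA x) j t e) :=
      fun e he => g'_eq _ (by have := hstep e he; tauto)
    by_cases hm1 : Meets x C₁ j t
    · obtain ⟨t', ht', h1⟩ := hg.hom j hj t ht hm1
      exact ⟨t', ht', fun e he => by rw [h1 e he, heq e he]⟩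
    · have hall : ∀ e < decArity x j, InDom x n H' (entry x (posA x) j t e) := by
        intro e he
        rcases h.closed j hj t ht hm e he with h1 | h1
        · by_cases hev : entry x (posA x) j t e = v
          · rw [hev]
            exact inDom_iff.2 ⟨b, hE.2.1⟩
          · refine absurd ⟨e, he, ?_⟩ hm1
            have := hC _ (entry_lt hx hj ht he)
            dsimp only at this ⊢
            tauto
        · exact hstep e he h1
      rcases hH j hj t ht with ⟨e, he, h1⟩ | ⟨t', ht', h1⟩
      · exact absurd (hall e he) h1
      · exact ⟨t', ht', fun e he => by rw [heq e he, hg.eq _ _ (h1 e he)]⟩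

theorem homOn_of_wins {t T C H : ℕ} (h : (embGame M n).Wins x t (gamePos T C H)) : HomOn x n H := by
  by_contra hH
  have : (embGame M n).status (x, gamePos T C H) = 0 := by
    rw [status_gamePos, if_neg hH]
  cases t <;> simp [RoundGame.Wins, this] at h

/-- Induction on the number of rounds: a split glues the maps won in both branches, a new element
extends the map of the remaining play, and in a won position nothing remains to be mapped beyond
`H`. -/
theorem exists_extends (hx : StrOK x (posA x)) {T : ℕ} (t : ℕ) :
    ∀ C H, (embGame M n).Wins x t (gamePos T C H) → Inv x n C H → ∃ g, Extends x n T C H g := by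
  classical
  have base : ∀ C H t, (embGame M n).Wins x t (gamePos T C H) →
      (embGame M n).status (x, gamePos T C H) = 1 → Inv x n C H → ∃ g, Extends x n T C H g := by
    intro C H t hw hs hI
    rw [status_gamePos, if_pos (homOn_of_wins hw)] at hs
    have hC : ∀ i < cardA x, ¬ BitOn C i := by
      by_contra h
      rw [if_neg h] at hs
      omega
    choose! F hF using fun u (hu : InDom x n H u) => inDom_iff.1 hu
    refine ⟨F, fun u b hb => hI.func u _ b (hF u (inDom_iff.2 ⟨b, hb⟩)) hb,
      fun c hc hcC => absurd hcC (hC c hc), fun j hj t ht ⟨e, he, hm⟩ => ?_⟩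
    exact absurd hm (hC _ (entry_lt hx hj ht he))
  induction t with
  | zero => exact fun C H hw hI => base C H 0 hw hw hI
  | succ t ih =>
    intro C H hw hI
    rcases id hw with hs | ⟨-, g, -, hg⟩
    · exact base C H _ hw hs hI
    have h0 := (wins_upd.1 (hg false)).2
    have h1 := (wins_upd.1 (hg true)).2
    generalize nfst g = k, nfst (nsnd g) = C₁, nfst (nsnd (nsnd g)) = C₂,
      nfst (nsnd (nsnd (nsnd g))) = v, nfst (nsnd (nsnd (nsnd (nsnd g)))) = b,
      nsnd (nsnd (nsnd (nsnd (nsnd g)))) = H' at h0 h1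
    by_cases hk : k = 0
    · subst hk
      obtain ⟨hS, h0⟩ := wins_split.1 h0
      obtain ⟨-, h1⟩ := wins_split.1 h1
      obtain ⟨i₁, i₂⟩ := hI.split hx hS
      obtain ⟨g₁, h₁⟩ := ih _ _ h0 (by simpa using i₁)
      obtain ⟨g₂, h₂⟩ := ih _ _ h1 (by simpa using i₂)
      exact Extends.split hI hx hS (by simpa using h₁) (by simpa using h₂)
    · obtain ⟨⟨e1, e2, e3⟩, h0⟩ := (wins_intro hk).1 h0
      obtain ⟨g₁, h₁⟩ := ih _ _ h0 (hI.extend hx e1 e3)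
      exact h₁.extend hI hx e1 e3 e2 (homOn_of_wins h0)

theorem bitOn_fullMask (hx : PairOK x) {i : ℕ} : BitOn (fullMask x) i ↔ i < cardA x := by
  rw [BitOn, fullMask, min_eq_left (cardA_le x hx), Nat.testBit_two_pow_sub_one]
  simp

theorem slot_zero (s : ℕ) : slot x 0 s = 0 := by simp [slot, digit]

theorem not_inDom_zero (u : ℕ) : ¬ InDom x n 0 u := by
  rintro ⟨s, -, h, -⟩
  exact h (slot_zero s)

theorem inv_init (hx : PairOK x) : Inv x n (fullMask x) 0 where
  func := fun u b _ h _ => absurd (inDom_iff.2 ⟨b, h⟩) (not_inDom_zero u)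
  disj := fun u _ _ => not_inDom_zero u
  closed := fun _ hj _ ht _ _ he =>
    .inl ((bitOn_fullMask hx).2 (entry_lt hx.2.2.1 hj ht he))

/-- The entry of the table for `u < v` demands a bit of the image of `u` and forbids it for the
image of `v`. This gives injectivity although the two images are never compared. -/
theorem Compat.ne {T u v b : ℕ} (hu : u < cardA x) (hv : v < cardA x) (huv : u < v)
    (h1 : Compat x T u b) (h2 : Compat x T v b) : False :=
  (h2 u hu).2.resolve_left (not_not.2 huv) ((h1 v hv).1.resolve_left (not_not.2 huv))

theorem isEmb_of_wins (hx : PairOK x) {t T : ℕ}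
    (hw : (embGame M n).Wins x t (gamePos T (fullMask x) 0)) : ∃ h, IsEmb x h := by
  obtain ⟨g, hg⟩ := exists_extends hx.2.2.1 t _ _ hw (inv_init hx)
  have hfull := fun {i} => bitOn_fullMask (i := i) hx
  refine ⟨g, fun u hu => (hg.compat u hu (hfull.2 hu)).1, fun u hu v hv huv => ?_,
    fun j hj t ht => ?_⟩
  · have h1 := (hg.compat u hu (hfull.2 hu)).2
    have h2 := (hg.compat v hv (hfull.2 hv)).2
    rcases lt_trichotomy u v with h | h | h
    · exact (Compat.ne hu hv h h1 (huv ▸ h2)).elim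
    · exact h
    · exact (Compat.ne hv hu h (huv ▸ h2) h1).elim
  -- Nullary tuples meet no set of elements; they are taken care of by the check in the first
  -- position after the table.
  · rcases Nat.eq_zero_or_pos (decArity x j) with h0 | h0
    · rcases homOn_of_wins hw j hj t ht with ⟨e, he, -⟩ | ⟨t', ht', -⟩
      · omega
      · exact ⟨t', ht', fun e he => by omega⟩
    · exact hg.hom j hj t ht ⟨0, h0, hfull.2 (entry_lt hx.2.2.1 hj ht h0)⟩

end EmbGame

/-! Completeness of the embedding game -/

theorem exists_digits {b n : ℕ} {d : ℕ → ℕ} (hd : ∀ i < n, d i < b) :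
    ∃ N < b ^ n, ∀ i < n, digit b N i = d i := by
  induction n generalizing d with
  | zero => exact ⟨0, by simp, fun i hi => by omega⟩
  | succ n ih =>
    obtain ⟨N, hN, h⟩ := ih fun i hi => hd (i + 1) (by omega)
    have h0 := hd 0 (by omega)
    refine ⟨d 0 + b * N, ?_, fun i hi => ?_⟩
    · rw [pow_succ']
      calc d 0 + b * N < b * (N + 1) := by rw [mul_add]; omega
        _ ≤ b * b ^ n := Nat.mul_le_mul_left _ hN
    · rcases i with _ | i
      · simp [digit, Nat.mod_eq_of_lt h0]
      · rw [← h i (by omega), digit, digit, pow_succ', ← Nat.div_div_eq_div_mul,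
          Nat.add_mul_div_left _ _ (by omega), Nat.div_eq_of_lt h0, zero_add]

theorem exists_mask {k : ℕ} (C : Finset (Fin k)) :
    ∃ N < 2 ^ k, ∀ i : Fin k, BitOn N i ↔ i ∈ C := by
  classical
  obtain ⟨N, hN, h⟩ := exists_digits (b := 2) (n := k)
    (d := fun i => if ∃ j ∈ C, (j : ℕ) = i then 1 else 0) fun i _ => by split_ifs <;> omega
  refine ⟨N, hN, fun i => ?_⟩
  have := h i i.2
  rw [BitOn, Nat.testBit_eq_decide_div_mod_eq, decide_eq_true_eq, ← digit, this]
  simp [Fin.val_inj]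

theorem Nat.pair_lt_two_pow {a b t : ℕ} (ha : a < 2 ^ t) (hb : b < 2 ^ t) :
    Nat.pair a b < 2 ^ (2 * t) := by
  rw [mul_comm, pow_mul]
  exact (Nat.pair_lt_max_add_one_sq a b).trans_le (Nat.pow_le_pow_left (max_lt ha hb) 2)

/-- The estimate that makes the table affordable: `(L + 1) ^ m` is at most `m!` times the binomial
coefficient of `L + m` over `m`, hence at most `m! * 2 ^ (L + m)`. With `L` the logarithm of the
input length, a power of the logarithm costs only one factor linear in the length, and the rest
depends on `m`. -/
theorem mul_pow_le_two_pow (L m : ℕ) : (2 * (L + 1)) ^ m ≤ 2 ^ (m * m + 2 * m + L) := by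
  have h1 : (L + 1) ^ m ≤ m.factorial * 2 ^ (L + m) :=
    calc (L + 1) ^ m ≤ (L + 1).ascFactorial m := Nat.pow_succ_le_ascFactorial _ _
      _ = m.factorial * (L + m).choose m := Nat.ascFactorial_eq_factorial_mul_choose _ _
      _ ≤ _ := Nat.mul_le_mul_left _ (Nat.choose_le_two_pow _ _)
  have h2 : m.factorial ≤ 2 ^ (m * m) := by
    rw [pow_mul]
    exact (Nat.factorial_le_pow m).trans (Nat.pow_le_pow_left Nat.lt_two_pow_self.le m)
  calc (2 * (L + 1)) ^ m = 2 ^ m * (L + 1) ^ m := mul_pow _ _ _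
    _ ≤ 2 ^ m * (2 ^ (m * m) * 2 ^ (L + m)) :=
      Nat.mul_le_mul_left _ (h1.trans (Nat.mul_le_mul_right _ h2))
    _ = _ := by rw [← pow_add, ← pow_add]; congr 1; ring

theorem onesAt_le (x : List Bool) (p : ℕ) : onesAt x p ≤ x.length := bfind_le _ _

theorem slotBase_le (x : List Bool) :
    slotBase x ≤ 2 ^ (2 * (embParam x + Nat.log 2 x.length + 2)) := by
  have h1 := Nat.pair_lt_max_add_one_sq (embParam x) x.length
  have h2 := add_le_two_pow_log (embParam x) x.length
  rw [mul_comm 2, pow_mul]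
  refine le_trans ?_ (Nat.pow_le_pow_left h2 2)
  have h3 : max (embParam x) x.length ≤ embParam x + x.length := by omega
  have h4 := Nat.pow_le_pow_left (Nat.add_le_add_right h3 1) 2
  rw [slotBase]
  nlinarith

namespace EmbGame

variable {M : List Bool → Prop} {x : List Bool} {n : ℕ} {h : ℕ → ℕ}

theorem lt_of_slots {H : ℕ} (hH : H < slotBase x ^ n) : H < 2 ^ compBits n x := by
  refine hH.trans_le ((Nat.pow_le_pow_left (slotBase_le x) n).trans ?_)
  rw [← pow_mul]
  refine Nat.pow_le_pow_right (by norm_num) ?_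
  rw [compBits]
  have : 2 * (embParam x + Nat.log 2 x.length + 2) * n ≤
      n * (2 * (embParam x + Nat.log 2 x.length + 2) + 1) := by nlinarith
  omega

theorem lt_of_mask (hx : PairOK x) {C : ℕ} (hC : C < 2 ^ cardA x) : C < 2 ^ compBits n x := by
  refine hC.trans_le (Nat.pow_le_pow_right (by norm_num) ?_)
  have := cardA_le x hx
  rw [compBits]
  omega

theorem gamePos_le {T C H : ℕ} (hT : T < 2 ^ compBits n x) (hC : C < 2 ^ compBits n x)
    (hH : H < 2 ^ compBits n x) : gamePos T C H ≤ posBound n x := by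
  have mono : ∀ {a m : ℕ}, 1 ≤ m → a < 2 ^ compBits n x → a < 2 ^ (m * compBits n x) :=
    fun hm h => h.trans_le (Nat.pow_le_pow_right (by norm_num) (Nat.le_mul_of_pos_left _ hm))
  have h1 : 1 < 2 ^ compBits n x := Nat.one_lt_two_pow (by rw [compBits]; omega)
  have e1 := Nat.pair_lt_two_pow hC hH
  have e2 := Nat.pair_lt_two_pow (mono (m := 2) (by norm_num) hT) e1
  rw [← mul_assoc] at e2
  have e3 := Nat.pair_lt_two_pow (mono (m := 4) (by norm_num) h1) e2
  rw [gamePos, posBound, moveBits]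
  refine e3.le.trans (Nat.pow_le_pow_right (by norm_num) ?_)
  omega

/-- The code of a move. -/
def moveCode (k C₁ C₂ v b H' : ℕ) : ℕ :=
  Nat.pair k (Nat.pair C₁ (Nat.pair C₂ (Nat.pair v (Nat.pair b H'))))

/-- Pairing doubles the number of bits. Five nested pairings yield the factor `32` in the length of
a move. -/
theorem moveCode_lt {k C₁ C₂ v b H' : ℕ} (hk : k < 2) (h1 : C₁ < 2 ^ compBits n x)
    (h2 : C₂ < 2 ^ compBits n x) (hv : v < 2 ^ compBits n x) (hb : b < 2 ^ compBits n x)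
    (hH : H' < 2 ^ compBits n x) : moveCode k C₁ C₂ v b H' < 2 ^ moveBits n x := by
  have mono : ∀ {a : ℕ} (m : ℕ), 1 ≤ m → a < 2 ^ compBits n x → a < 2 ^ (m * compBits n x) :=
    fun m hm h => h.trans_le (Nat.pow_le_pow_right (by norm_num) (Nat.le_mul_of_pos_left _ hm))
  have h1 : 1 < 2 ^ compBits n x := Nat.one_lt_two_pow (by rw [compBits]; omega)
  have e1 := Nat.pair_lt_two_pow hb hH
  have e2 := Nat.pair_lt_two_pow (mono 2 (by norm_num) hv) e1
  rw [← mul_assoc] at e2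
  have e3 := Nat.pair_lt_two_pow (mono 4 (by norm_num) h2) e2
  rw [← mul_assoc] at e3
  have e4 := Nat.pair_lt_two_pow (mono 8 (by norm_num) ‹C₁ < _›) e3
  rw [← mul_assoc] at e4
  have e5 := Nat.pair_lt_two_pow (mono 16 (by norm_num) (show k < _ by omega)) e4
  rw [← mul_assoc] at e5
  exact e5

/-- The slots of `H` represent the restriction of `h` to `X`, each pair occurring once. -/
structure Rep (x : List Bool) (n : ℕ) (h : ℕ → ℕ) {k : ℕ} (X : Finset (Fin k)) (H : ℕ) : Prop where
  sound : ∀ s < n, slot x H s = 0 ∨ ∃ u ∈ X, slot x H s = Nat.pair u (h u) + 1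
  complete : ∀ u ∈ X, ∃ s < n, slot x H s = Nat.pair u (h u) + 1
  inj : ∀ s < n, ∀ s' < n, slot x H s = slot x H s' → slot x H s ≠ 0 → s = s'

namespace Rep

variable {k : ℕ} {X : Finset (Fin k)} {H : ℕ}

theorem hasSlot_iff (hR : Rep x n h X H) {u b : ℕ} :
    HasSlot x n H u b ↔ ∃ u' ∈ X, (u' : ℕ) = u ∧ b = h u := by
  constructor
  · rintro ⟨s, hs, e⟩
    rcases hR.sound s hs with h0 | ⟨u', hu', e'⟩
    · omega
    · rw [e, Nat.add_right_cancel_iff, Nat.pair_eq_pair] at e'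
      exact ⟨u', hu', e'.1.symm, by rw [e'.1, e'.2]⟩
  · rintro ⟨u', hu', rfl, rfl⟩
    exact hR.complete u' hu'

theorem inDom_iff (hR : Rep x n h X H) {u : ℕ} :
    InDom x n H u ↔ ∃ u' ∈ X, (u' : ℕ) = u := by
  rw [_root_.inDom_iff]
  simp only [hR.hasSlot_iff]
  exact ⟨fun ⟨_, u', hu', e, _⟩ => ⟨u', hu', e⟩, fun ⟨u', hu', e⟩ => ⟨_, u', hu', e, rfl⟩⟩

theorem homOn (hR : Rep x n h X H) (hh : IsEmb x h) : HomOn x n H := by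
  intro j hj t ht
  by_cases hD : ∃ e < decArity x j, ¬ InDom x n H (entry x (posA x) j t e)
  · exact .inl hD
  · push Not at hD
    obtain ⟨t', ht', e'⟩ := hh.2.2 j hj t ht
    refine .inr ⟨t', ht', fun e he => hR.hasSlot_iff.2 ?_⟩
    obtain ⟨u, hu, hue⟩ := hR.inDom_iff.1 (hD e he)
    exact ⟨u, hu, hue, e' e he⟩

theorem empty : Rep x n h (∅ : Finset (Fin k)) 0 where
  sound s _ := .inl (slot_zero s)
  complete u hu := absurd hu (by simp)
  inj s _ s' _ _ h := absurd (slot_zero s) h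

end Rep

/-- The parameter bounds the elements of the first structure and the input length those of the
second; `slotBase` leaves room for the value `0` of an empty slot. -/
theorem pair_lt_slotBase (hx : PairOK x) (hh : IsEmb x h) {u : ℕ} (hu : u < cardA x) :
    Nat.pair u (h u) + 1 < slotBase x := by
  have h1 := hu.trans_le (cardA_le x hx)
  have h2 := (hh.1 u hu).trans_le (onesAt_le x _)
  have := (Nat.pair_lt_pair_left (h u) h1).trans (Nat.pair_lt_pair_right (embParam x) h2)
  rw [slotBase]
  omega

/-- The new map must be written slot by slot over the old one. The elements to be kept besides `v`
number fewer than `n` and each occupies only one slot, so some slot is free for the new pair; the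
slots of forgotten elements are emptied. -/
theorem Rep.extend (hx : PairOK x) (hh : IsEmb x h) {X X' : Finset (Fin (cardA x))} {H : ℕ}
    (hR : Rep x n h X H) {v : Fin (cardA x)} (hv : v ∈ X') (hX : X' ⊆ insert v X)
    (hn : X'.card ≤ n) : ∃ H' < slotBase x ^ n, Rep x n h X' H' ∧
      ∀ s < n, slot x H' s = 0 ∨ slot x H' s = slot x H s ∨
        slot x H' s = Nat.pair v (h v) + 1 := by
  classical
  -- The slots holding an element that is remembered further on; each represents a different element
  -- other than `v`.
  let kept : ℕ → Prop := fun s => ∃ u ∈ X'.erase v, slot x H s = Nat.pair u (h u) + 1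
  obtain ⟨s₀, hs₀, hfree⟩ : ∃ s₀ < n, ¬ kept s₀ := by
    by_contra hcon
    push Not at hcon
    have : Nonempty (Fin (cardA x)) := ⟨v⟩
    choose! F hF1 hF2 using hcon
    have hc : (Finset.range n).card ≤ (X'.erase v).card := by
      refine Finset.card_le_card_of_injOn F (fun s hs => hF1 s (by simpa using hs)) ?_
      intro s hs s' hs' e
      have hs := Finset.mem_range.1 hs
      have hs' := Finset.mem_range.1 hs'
      refine hR.inj s hs s' hs' ?_ ?_
      · rw [hF2 s hs, hF2 s' hs', e]
      · rw [hF2 s hs]; omega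
    rw [Finset.card_range, Finset.card_erase_of_mem hv] at hc
    have := Finset.card_pos.2 ⟨v, hv⟩
    omega
  obtain ⟨H', hH', hd⟩ := exists_digits (b := slotBase x) (n := n)
    (d := fun s => if s = s₀ then Nat.pair v (h v) + 1 else if kept s then slot x H s else 0)
    fun s hs => by
      split_ifs
      · exact pair_lt_slotBase hx hh v.2
      · exact Nat.mod_lt _ (by rw [slotBase]; omega)
      · rw [slotBase]; omega
  have e₀ : slot x H' s₀ = Nat.pair v (h v) + 1 := by rw [slot, hd s₀ hs₀, if_pos rfl]
  have e₁ : ∀ s < n, s ≠ s₀ → kept s → slot x H' s = slot x H s := fun s hs hne hk => by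
    rw [slot, hd s hs, if_neg hne, if_pos hk]
  have e₂ : ∀ s < n, s ≠ s₀ → ¬ kept s → slot x H' s = 0 := fun s hs hne hk => by
    rw [slot, hd s hs, if_neg hne, if_neg hk]
  have hne₀ : ∀ s < n, s ≠ s₀ → slot x H' s ≠ Nat.pair v (h v) + 1 := fun s hs hne e => by
    by_cases hk : kept s
    · obtain ⟨u, hu, e'⟩ := id hk
      rw [e₁ s hs hne hk, e', Nat.add_right_cancel_iff, Nat.pair_eq_pair] at e
      exact Finset.ne_of_mem_erase hu (Fin.ext e.1)
    · rw [e₂ s hs hne hk] at e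
      omega
  refine ⟨H', hH', ⟨fun s hs => ?_, fun u hu => ?_, fun s hs s' hs' e hne => ?_⟩, fun s hs => ?_⟩
  · by_cases hs0 : s = s₀
    · subst hs0
      exact .inr ⟨v, hv, e₀⟩
    by_cases hk : kept s
    · obtain ⟨u, hu, e⟩ := id hk
      exact .inr ⟨u, Finset.mem_of_mem_erase hu, (e₁ s hs hs0 hk).trans e⟩
    · exact .inl (e₂ s hs hs0 hk)
  · by_cases huv : u = v
    · subst huv
      exact ⟨s₀, hs₀, e₀⟩
    · obtain ⟨s, hs, e⟩ := hR.complete u ((Finset.mem_insert.1 (hX hu)).resolve_left huv)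
      have hk : kept s := ⟨u, Finset.mem_erase.2 ⟨huv, hu⟩, e⟩
      exact ⟨s, hs, (e₁ s hs (fun h0 => hfree (h0 ▸ hk)) hk).trans e⟩
  · by_cases h1 : s = s₀ <;> by_cases h2 : s' = s₀
    · rw [h1, h2]
    · rw [h1, e₀] at e
      exact absurd e.symm (hne₀ s' hs' h2)
    · rw [h2, e₀] at e
      exact absurd e (hne₀ s hs h1)
    · have hk : kept s := by_contra fun hk => hne (e₂ s hs h1 hk)
      have hk' : kept s' := by_contra fun hk' => hne (e.trans (e₂ s' hs' h2 hk'))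
      rw [e₁ s hs h1 hk, e₁ s' hs' h2 hk'] at e
      refine hR.inj s hs s' hs' e ?_
      rwa [← e₁ s hs h1 hk]
  · by_cases hs0 : s = s₀
    · exact .inr (.inr (hs0 ▸ e₀))
    by_cases hk : kept s
    · exact .inr (.inl (e₁ s hs hs0 hk))
    · exact .inl (e₂ s hs hs0 hk)

theorem wins_succ_of {t T C H k C₁ C₂ v b H' : ℕ} (hs : 1 < (embGame M n).status (x, gamePos T C H))
    (hlt : moveCode k C₁ C₂ v b H' < 2 ^ moveBits n x)
    (hm : ∀ i < 2, moveTo n (x, T, C, H, k, C₁, C₂, v, b, H', i) ≤ posBound n x ∧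
      (embGame M n).Wins x t (moveTo n (x, T, C, H, k, C₁, C₂, v, b, H', i))) :
    (embGame M n).Wins x (t + 1) (gamePos T C H) := by
  refine .inr ⟨hs, moveCode k C₁ C₂ v b H', hlt, fun i => wins_upd.2 ?_⟩
  simpa only [moveCode, nfst_pair, nsnd_pair] using hm i.toNat i.toNat_lt

/-- The winning strategy follows the elimination and answers with the values of `h`. All checks
succeed because `h` is an embedding compatible with the table, and the rounds suffice because `C`
loses an element in each round, also in a split, whose parts are nonempty. -/
theorem wins_of_elim (hx : PairOK x) (hh : IsEmb x h) {G : SimpleGraph (Fin (cardA x))}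
    (hG : ∀ j < decNum x, ∀ t < relCount x (posA x) j, ∀ e < decArity x j, ∀ e' < decArity x j,
      ∀ u v : Fin (cardA x), entry x (posA x) j t e = u → entry x (posA x) j t e' = v → u ≠ v →
        G.Adj u v)
    {T : ℕ} (hT : T < 2 ^ compBits n x) (hTh : ∀ v < cardA x, Compat x T v (h v))
    {C X : Finset (Fin (cardA x))} (hE : G.Elim n C X) :
    ∀ (t D H : ℕ), Disjoint C X → (∀ i : Fin (cardA x), BitOn D i ↔ i ∈ C) → Rep x n h X H →
      D < 2 ^ compBits n x → H < 2 ^ compBits n x → C.card ≤ t →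
      (embGame M n).Wins x t (gamePos T D H) := by
  have hb : ∀ v < cardA x, h v < 2 ^ compBits n x := fun v hv => by
    refine ((hh.1 v hv).trans_le (onesAt_le x _)).trans_le
      ((Nat.lt_pow_succ_log_self (by norm_num) _).le.trans
        (Nat.pow_le_pow_right (by norm_num) ?_))
    rw [compBits]
    omega
  have hpos : 0 < 2 ^ compBits n x := by positivity
  have hst : ∀ {C X : Finset (Fin (cardA x))} {D H : ℕ}, C.Nonempty →
      (∀ i : Fin (cardA x), BitOn D i ↔ i ∈ C) → Rep x n h X H →
      1 < (embGame M n).status (x, gamePos T D H) := by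
    intro C X D H ⟨c, hc⟩ hD hR
    rw [status_gamePos, if_pos (hR.homOn hh), if_neg]
    · norm_num
    · exact fun h0 => h0 c c.2 ((hD c).2 hc)
  induction hE with
  | nil X =>
    intro t D H _ hD hR _ _ _
    have : (embGame M n).status (x, gamePos T D H) = 1 := by
      rw [status_gamePos, if_pos (hR.homOn hh), if_pos]
      exact fun i hi hi' => absurd ((hD ⟨i, hi⟩).1 hi') (by simp)
    cases t with
    | zero => exact this
    | succ t => exact .inl this
  | @split C₁ C₂ X hdis hne₁ hne₂ hadj _ _ ih₁ ih₂ =>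
    intro t D H hCX hD hR hDlt hHlt ht
    rw [Finset.card_union_of_disjoint hdis] at ht
    have p1 := hne₁.card_pos
    have p2 := hne₂.card_pos
    obtain ⟨t, rfl⟩ : ∃ t', t = t' + 1 := ⟨t - 1, by omega⟩
    -- The move announces both parts; the universal bit decides which of them remains.
    obtain ⟨D₁, hlt₁, hD₁⟩ := exists_mask C₁
    obtain ⟨D₂, hlt₂, hD₂⟩ := exists_mask C₂
    replace hlt₁ := lt_of_mask (n := n) hx hlt₁
    replace hlt₂ := lt_of_mask (n := n) hx hlt₂
    rw [Finset.disjoint_union_left] at hCX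
    have hS : SplitOK x D D₁ D₂ := by
      refine ⟨fun i hi => ?_, fun j hj s hs ⟨⟨e, he, h1⟩, ⟨e', he', h2⟩⟩ => ?_⟩
      · have h0 := hD ⟨i, hi⟩
        have h1 := hD₁ ⟨i, hi⟩
        have h2 := hD₂ ⟨i, hi⟩
        have h3 : (⟨i, hi⟩ : Fin (cardA x)) ∈ C₁ → (⟨i, hi⟩ : Fin (cardA x)) ∉ C₂ :=
          fun h => Finset.disjoint_left.1 hdis h
        rw [Finset.mem_union] at h0
        dsimp only at h0 h1 h2 ⊢
        rw [h0, h1, h2]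
        tauto
      · have hu := entry_lt hx.2.2.1 hj hs he
        have hv := entry_lt hx.2.2.1 hj hs he'
        have m1 := (hD₁ ⟨_, hu⟩).1 h1
        have m2 := (hD₂ ⟨_, hv⟩).1 h2
        exact hadj _ m1 _ m2 (hG j hj s hs e he e' he' ⟨_, hu⟩ ⟨_, hv⟩ rfl rfl
          (fun h0 => Finset.disjoint_left.1 hdis m1 (h0 ▸ m2)))
    refine wins_succ_of (k := 0) (C₁ := D₁) (C₂ := D₂) (v := 0) (b := 0) (H' := 0)
      (hst (hne₁.mono Finset.subset_union_left) hD hR)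
      (moveCode_lt (by norm_num) hlt₁ hlt₂ hpos hpos hpos) fun i _ => ⟨?_, wins_split.2 ⟨hS, ?_⟩⟩
    · simp only [moveTo, if_true, if_pos hS]
      split_ifs
      · exact gamePos_le hT hlt₁ hHlt
      · exact gamePos_le hT hlt₂ hHlt
    · split_ifs
      · exact ih₁ t D₁ H hCX.1 hD₁ hR hlt₁ hHlt (by omega)
      · exact ih₂ t D₂ H hCX.2 hD₂ hR hlt₂ hHlt (by omega)
  | @intro v C X X' hvC hvX hX hcard hnb _ ih =>
    intro t D H hCX hD hR hDlt hHlt ht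
    have p1 := Finset.card_pos.2 ⟨v, hvC⟩
    obtain ⟨t, rfl⟩ : ∃ t', t = t' + 1 := ⟨t - 1, by omega⟩
    obtain ⟨D', hlt, hD'⟩ := exists_mask (C.erase v)
    replace hlt := lt_of_mask (n := n) hx hlt
    obtain ⟨H', hH', hR', hslots⟩ := hR.extend hx hh hvX hX hcard
    replace hH' := lt_of_slots hH'
    have hv : (v : ℕ) < 2 ^ compBits n x :=
      lt_of_mask hx (v.2.trans Nat.lt_two_pow_self)
    have hOK : EraseOK x D D' v ∧ Compat x T v (h v) ∧ ExtendOK x n D H v (h v) H' := by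
      refine ⟨⟨v.2, (hD v).2 hvC, fun i hi => ?_⟩, hTh v v.2, hh.1 v v.2,
        hR'.hasSlot_iff.2 ⟨v, hvX, rfl, rfl⟩, hslots, fun j hj s hs => ?_⟩
      · have h0 := hD ⟨i, hi⟩
        have h1 := hD' ⟨i, hi⟩
        rw [Finset.mem_erase, Ne, Fin.ext_iff] at h1
        dsimp only at h0 h1 ⊢
        rw [h0, h1]
        tauto
      · by_cases hm : Meets x D j s
        · obtain ⟨e', he', hm⟩ := hm
          refine .inr fun e he => ?_
          by_cases hd : InDom x n H (entry x (posA x) j s e)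
          · refine .inr ?_
            obtain ⟨u, hu, hue⟩ := hR.inDom_iff.1 hd
            have hc := entry_lt hx.2.2.1 hj hs he'
            have hcC := (hD ⟨_, hc⟩).1 hm
            refine hR'.inDom_iff.2 ⟨u, hnb ⟨_, hc⟩ hcC u hu (hG j hj s hs e' he' e he _ _ rfl hue.symm ?_),
              hue⟩
            exact fun h0 => Finset.disjoint_left.1 hCX hcC (h0 ▸ hu)
          · exact .inl hd
        · exact .inl hm
    refine wins_succ_of (k := 1) (C₁ := D') (C₂ := 0) (v := v) (b := h v) (H' := H')
      (hst ⟨v, hvC⟩ hD hR) (moveCode_lt (by norm_num) hlt hpos hv (hb v v.2) hH')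
      fun i _ => ⟨?_, (wins_intro one_ne_zero).2 ⟨hOK, ?_⟩⟩
    · simp only [moveTo, one_ne_zero, if_false, if_pos hOK]
      exact gamePos_le hT hlt hH'
    · refine ih t D' H' ?_ hD' hR' hlt hH' (by rw [Finset.card_erase_of_mem hvC]; omega)
      refine Finset.disjoint_left.2 fun c hc hcX => ?_
      rw [Finset.mem_erase] at hc
      exact Finset.disjoint_left.1 hCX hc.2 ((Finset.mem_insert.1 (hX hcX)).resolve_left hc.1)

/-- Distinct images are below `2 ^ (L + 1)`, hence differ at a position at most `L`. The table
stores this position together with the bit of the image of the smaller element as one digit to the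
base `2 * (L + 1)`. -/
theorem exists_table (hx : PairOK x) (hh : IsEmb x h) :
    ∃ T < 2 ^ compBits n x, ∀ v < cardA x, Compat x T v (h v) := by
  classical
  set L := Nat.log 2 x.length
  have hlog : ∀ u < cardA x, h u < 2 ^ (L + 1) := fun u hu =>
    ((hh.1 u hu).trans_le (onesAt_le x _)).trans (Nat.lt_pow_succ_log_self (by norm_num) _)
  have hd : ∀ u v, ∃ p, u < cardA x → v < cardA x → u ≠ v →
      p ≤ L ∧ (h u).testBit p ≠ (h v).testBit p := by
    intro u v
    by_cases huv : u < cardA x ∧ v < cardA x ∧ u ≠ v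
    · obtain ⟨p, hp⟩ := Nat.exists_testBit_ne_of_ne fun e => huv.2.2 (hh.2.1 u huv.1 v huv.2.1 e)
      refine ⟨p, fun _ _ _ => ⟨?_, hp⟩⟩
      by_contra hpL
      have hle : 2 ^ (L + 1) ≤ 2 ^ p := Nat.pow_le_pow_right (by norm_num) (by omega)
      rw [Nat.testBit_lt_two_pow ((hlog u huv.1).trans_le hle),
        Nat.testBit_lt_two_pow ((hlog v huv.2.1).trans_le hle)] at hp
      exact hp rfl
    · exact ⟨0, fun h1 h2 h3 => absurd ⟨h1, h2, h3⟩ huv⟩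
  choose p hp using hd
  -- Quotient and remainder of the index are the two elements; entries not belonging to a pair in
  -- increasing order are never consulted and are set to `0`.
  let d : ℕ → ℕ := fun i =>
    if i / cardA x < i % cardA x then
      2 * p (i / cardA x) (i % cardA x) +
        ((h (i / cardA x)).testBit (p (i / cardA x) (i % cardA x))).toNat else 0
  obtain ⟨T, hT, hTd⟩ := exists_digits (b := 2 * (L + 1)) (n := cardA x * cardA x) (d := d)
    fun i hi => by
      dsimp only [d]
      split_ifs with hlt
      · have h1 : i / cardA x < cardA x := Nat.div_lt_of_lt_mul hi
        have h2 : i % cardA x < cardA x := Nat.mod_lt _ hx.2.2.1.2.1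
        have := (hp _ _ h1 h2 hlt.ne).1
        have := ((h (i / cardA x)).testBit (p (i / cardA x) (i % cardA x))).toNat_lt
        omega
      · omega
  have hat : ∀ u v, u < cardA x → v < cardA x → u < v →
      tableAt x T u v = 2 * p u v + ((h u).testBit (p u v)).toNat := by
    intro u v hu hv huv
    have hpos : 0 < cardA x := hx.2.2.1.2.1
    have h1 : (u * cardA x + v) / cardA x = u := by
      rw [mul_comm, Nat.mul_add_div hpos, Nat.div_eq_of_lt hv, add_zero]
    have h2 : (u * cardA x + v) % cardA x = v := by
      rw [Nat.mul_add_mod', Nat.mod_eq_of_lt hv]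
    rw [tableAt, hTd _ (by nlinarith)]
    dsimp only [d]
    rw [h1, h2, if_pos huv]
  have hmatch : ∀ u v b, u < cardA x → v < cardA x → u < v →
      (BitMatches b (tableAt x T u v) ↔ b.testBit (p u v) = (h u).testBit (p u v)) := by
    intro u v b hu hv huv
    rw [hat u v hu hv huv, BitMatches, BitOn]
    have h1 : (2 * p u v + ((h u).testBit (p u v)).toNat) / 2 = p u v := by
      have := ((h u).testBit (p u v)).toNat_lt
      omega
    rw [h1, Nat.mul_add_mod]
    cases (h u).testBit (p u v) <;> simp
  refine ⟨T, hT.trans_le ?_, fun v hv u hu => ⟨?_, ?_⟩⟩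
  · have hk := cardA_le x hx
    have hm : cardA x * cardA x ≤ embParam x * embParam x := Nat.mul_le_mul hk hk
    refine (Nat.pow_le_pow_right (by omega) hm).trans ((mul_pow_le_two_pow _ _).trans
      (Nat.pow_le_pow_right (by norm_num) ?_))
    rw [compBits]
    omega
  · by_cases hvu : v < u
    · exact .inr ((hmatch v u _ hv hu hvu).2 rfl)
    · exact .inl hvu
  · by_cases huv : u < v
    · exact .inr fun hm => (hp u v hu hv huv.ne).2 ((hmatch u v _ hu hv huv).1 hm).symm
    · exact .inl huv

end EmbGame

/-! The embedding problem and the game -/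

section Bridge

variable {x : List Bool}

theorem card_decStr {s : ℕ} (hs : StrOK x s) : (decStr x s).card = onesAt x s :=
  max_eq_right hs.2.1

theorem mem_rel_decStr {s : ℕ} (hs : StrOK x s) (j : Fin (decNum x))
    (a : Fin (decArity x j) → Fin (decStr x s).card) :
    a ∈ (decStr x s).rel j ↔ ∃ t < relCount x s j, ∀ e : Fin (decArity x j),
      (a e : ℕ) = entry x s j t e := by
  have key : a ∈ (decStr x s).rel j ↔ ∃ t < relCount x s j,
      (fun e : Fin (decArity x j) => (⟨entry x s j t e % max 1 (onesAt x s),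
        Nat.mod_lt _ (by simp)⟩ : Fin (decStr x s).card)) = a := by
    refine List.mem_toFinset.trans (List.mem_map.trans ?_)
    exact exists_congr fun t => and_congr List.mem_range Iff.rfl
  rw [key]
  refine exists_congr fun t => and_congr_right fun ht => ?_
  rw [funext_iff]
  refine forall_congr' fun e => ?_
  rw [Fin.ext_iff, eq_comm]
  have h1 := entry_lt hs j.2 ht e.2
  dsimp only
  rw [Nat.mod_eq_of_lt (by omega)]

theorem embeds_decStr_iff (hx : PairOK x) :
    (decStr x (posA x)).Embeds (decStr x (posB x)) ↔ ∃ h, IsEmb x h := by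
  have hA := hx.2.2.1
  have hB := hx.2.2.2.1
  have cA : (decStr x (posA x)).card = cardA x := card_decStr hA
  have cB : (decStr x (posB x)).card = cardB x := card_decStr hB
  constructor
  · rintro ⟨h, hom, inj⟩
    refine ⟨fun u => if hu : u < (decStr x (posA x)).card then h ⟨u, hu⟩ else 0,
      fun u hu => ?_, fun u hu v hv huv => ?_, fun j hj t ht => ?_⟩
    · rw [← cA] at hu
      dsimp only
      rw [dif_pos hu, ← cB]
      exact (h _).2
    · rw [← cA] at hu hv
      dsimp only at huv
      rw [dif_pos hu, dif_pos hv] at huv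
      simpa using inj (Fin.ext huv)
    · have he : ∀ e : Fin (decArity x j), entry x (posA x) j t e < (decStr x (posA x)).card :=
        fun e => cA ▸ entry_lt hA hj ht e.2
      have hm := (mem_rel_decStr hA ⟨j, hj⟩ fun e => ⟨_, he e⟩).2 ⟨t, ht, fun e => rfl⟩
      obtain ⟨t', ht', h'⟩ := (mem_rel_decStr hB ⟨j, hj⟩ _).1 (hom _ _ hm)
      refine ⟨t', ht', fun e hej => ?_⟩
      dsimp only
      rw [dif_pos (show entry x (posA x) j t e < _ from he ⟨e, hej⟩)]
      exact (h' ⟨e, hej⟩).symm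
  · rintro ⟨h, h1, h2, h3⟩
    refine ⟨fun u => ⟨h u, by rw [cB]; exact h1 u (u.2.trans_eq cA)⟩, fun j a ha => ?_,
      fun u v huv => Fin.ext (h2 u (u.2.trans_eq cA) v (v.2.trans_eq cA) (Fin.ext_iff.1 huv))⟩
    obtain ⟨t, ht, hta⟩ := (mem_rel_decStr hA j a).1 ha
    obtain ⟨t', ht', h'⟩ := h3 j j.2 t ht
    refine (mem_rel_decStr hB j _).2 ⟨t', ht', fun e => ?_⟩
    dsimp only
    rw [h' e e.2, hta e]

theorem mem_embProblem_iff {𝒜 : StrClass} : x ∈ embProblem 𝒜 ↔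
    (PairOK x ∧ (⟨decVoc x, decStr x (posA x)⟩ : Σ τ, FinStr τ) ∈ 𝒜) ∧ ∃ h, IsEmb x h := by
  constructor
  · rintro ⟨τ, A, B, hc, hA, hE⟩
    have hx := hc.pairOK
    have key : ∀ p q : Σ τ : Vocabulary, FinStr τ × FinStr τ, p = q →
        (⟨p.1, p.2.1⟩ : Σ τ, FinStr τ) ∈ 𝒜 ∧ p.2.1.Embeds p.2.2 →
        (⟨q.1, q.2.1⟩ : Σ τ, FinStr τ) ∈ 𝒜 ∧ q.2.1.Embeds q.2.2 := by
      rintro p _ rfl h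
      exact h
    have := key _ _ (PairCode.inj hc hx.pairCode) ⟨hA, hE⟩
    exact ⟨⟨hx, this.1⟩, (embeds_decStr_iff hx).1 this.2⟩
  · rintro ⟨⟨hx, hA⟩, h⟩
    exact ⟨_, _, _, hx.pairCode, hA, (embeds_decStr_iff hx).2 h⟩

/-- Codes of pairs have length at least two. Hence the inputs on which no existential guess is
allowed, the logarithm being `0`, are all to be rejected. -/
theorem PairOK.log_pos (hx : PairOK x) : Nat.log 2 x.length ≠ 0 := by
  have h1 := onesAt_le x (posA x)
  have h2 := hx.2.2.1.2.1
  obtain ⟨τ, A, B, a, b, ⟨_, _, rfl⟩, _, e⟩ := pairOK_iff.1 hx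
  have := congrArg List.length e
  simp only [encVocabulary, encUnary, List.length_append, List.length_replicate,
    List.length_singleton] at this
  exact (Nat.log_pos (by norm_num) (by omega)).ne'

end Bridge

namespace EmbGame

variable {M : List Bool → Prop} {x : List Bool} {n : ℕ}

theorem upd_le (q g b : ℕ) : (embGame M n).upd (x, q, g, b) ≤ posBound n x := by
  have h : Nat.pair 2 0 ≤ posBound n x := by
    have : 2 ^ 32 ≤ posBound n x := Nat.pow_le_pow_right (by norm_num) (by
      rw [moveBits, compBits]; omega)
    exact le_trans (by decide) this
  dsimp only [embGame, gameUpd]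
  generalize posBound n x = K at h ⊢
  split_ifs <;> assumption

theorem wins_start {t : ℕ} : (embGame M n).Wins x (t + 1) 0 ↔
    M x ∧ ∃ T < 2 ^ moveBits n x, gamePos T (fullMask x) 0 ≤ posBound n x ∧
      (embGame M n).Wins x t (gamePos T (fullMask x) 0) := by
  have h0 : nfst 0 = 0 := nfst_pair 0 0
  have hs : (embGame M n).status (x, 0) = open Classical in if M x then 2 else 0 := by
    simp only [embGame, h0, if_true]
  have hu : ∀ T i, (embGame M n).Wins x t ((embGame M n).upd (x, 0, T, i)) ↔
      gamePos T (fullMask x) 0 ≤ posBound n x ∧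
        (embGame M n).Wins x t (gamePos T (fullMask x) 0) := by
    intro T i
    rw [← wins_ite]
    simp only [embGame, gameUpd, h0, if_true]
  simp only [RoundGame.Wins, hs, hu]
  by_cases hM : M x
  · simp [hM, embGame]
  · simp [hM]

theorem wins_iff {w : ℕ} {𝒜 : StrClass} (htw : ∀ A ∈ 𝒜, treewidth A.2.gaifman ≤ w)
    {M : List Bool → Prop}
    (hM : ∀ x, M x ↔ PairOK x ∧ (⟨decVoc x, decStr x (posA x)⟩ : Σ τ, FinStr τ) ∈ 𝒜)
    (x : List Bool) :
    (embGame M (w + 1)).Wins x ((embGame M (w + 1)).rounds x) ((embGame M (w + 1)).start x) ↔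
      x ∈ embProblem 𝒜 := by
  rw [mem_embProblem_iff, ← hM]
  change (embGame M (w + 1)).Wins x (if Nat.log 2 x.length = 0 then 0 else embParam x + 2) 0 ↔ _
  -- On inputs of length at most one the game has no rounds, and the initial position is not won.
  by_cases hl : Nat.log 2 x.length = 0
  · refine iff_of_false ?_ fun h => ((hM x).1 h.1).1.log_pos hl
    have h0 : nfst 0 = 0 := nfst_pair 0 0
    rw [if_pos hl, RoundGame.Wins]
    simp only [embGame, h0, if_true]
    split_ifs <;> simp
  rw [if_neg hl, wins_start]
  refine and_congr_right fun hMx => ?_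
  obtain ⟨hx, hA⟩ := (hM x).1 hMx
  constructor
  · rintro ⟨T, -, -, hw⟩
    exact isEmb_of_wins hx hw
  · rintro ⟨h, hh⟩
    obtain ⟨T, hT, hTh⟩ := exists_table (n := w + 1) hx hh
    have hF : fullMask x < 2 ^ compBits (w + 1) x := lt_of_mask hx (by
      rw [fullMask, min_eq_left (cardA_le x hx)]
      have : 0 < 2 ^ cardA x := by positivity
      omega)
    have hpos : 0 < 2 ^ compBits (w + 1) x := by positivity
    refine ⟨T, hT.trans_le (Nat.pow_le_pow_right (by norm_num) (by rw [moveBits]; omega)),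
      gamePos_le hT hF hpos, ?_⟩
    have hAc := hx.2.2.1
    have cA : (decStr x (posA x)).card = cardA x := card_decStr hAc
    obtain ⟨D, hD⟩ := exists_treeDecomposition_of_treewidth_le (htw _ hA)
    have hE := D.elim hD
    have hG : ∀ j < decNum x, ∀ t < relCount x (posA x) j, ∀ e < decArity x j,
        ∀ e' < decArity x j, ∀ u v : Fin (decStr x (posA x)).card, entry x (posA x) j t e = u →
          entry x (posA x) j t e' = v → u ≠ v → (decStr x (posA x)).gaifman.Adj u v := by
      intro j hj t ht e he e' he' u v hu hv huv
      have hlt : ∀ e : Fin (decArity x j), entry x (posA x) j t e < (decStr x (posA x)).card :=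
        fun e => cA ▸ entry_lt hAc hj ht e.2
      exact ⟨huv, ⟨j, hj⟩, fun e => ⟨_, hlt e⟩,
        (mem_rel_decStr hAc ⟨j, hj⟩ _).2 ⟨t, ht, fun e => rfl⟩,
        ⟨⟨e, he⟩, Fin.ext hu⟩, ⟨⟨e', he'⟩, Fin.ext hv⟩⟩
    -- The universe of the decoded structure and `Fin (cardA x)` have equal size; once the graph is
    -- arbitrary, the equation can be substituted.
    revert hE hG
    generalize (decStr x (posA x)).gaifman = G
    revert G
    rw [cA]
    intro G hE hG
    refine wins_of_elim hx hh hG hT hTh hE _ _ _ (by simp) (fun i => ?_) .empty hF hpos ?_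
    · simp [bitOn_fullMask hx]
    · simpa using (cardA_le x hx).trans (Nat.le_succ _)

end EmbGame

/-! ### The theorem -/

theorem theorem5p5 (𝒜 : StrClass) (hdec : 𝒜.IsDecidable) (harity : 𝒜.BoundedArity)
    (htw : 𝒜.BoundedTreewidth) : (embProblem 𝒜, embParam) ∈ TREE := by
  obtain ⟨w, hw⟩ := htw
  let M : List Bool → Prop := fun x =>
    PairOK x ∧ (⟨decVoc x, decStr x (posA x)⟩ : Σ τ, FinStr τ) ∈ 𝒜
  have hM : PL embP M := PL.mem_class hdec harity PL.id
  have hb1 : ∀ x, 1 ≤ compBits (w + 1) x := fun x => by rw [compBits]; omega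
  -- Rounds times bits per round, divided by the logarithm. One round chooses the table, at most `k`
  -- rounds eliminate the elements, and one is spare.
  have hf : Computable fun k : ℕ =>
      (k + 2) * (32 * ((1 + 2 * (w + 1)) + paramBits (w + 1) k)) := by
    have h1 : Primrec fun k : ℕ => k + 2 := Primrec.nat_add.comp .id (.const 2)
    have h2 := Primrec.nat_mul.comp (Primrec.const 32)
      (Primrec.nat_add.comp (Primrec.const (1 + 2 * (w + 1))) (primrec_paramBits (w + 1)))
    exact (Primrec.nat_mul.comp h1 h2).to_comp
  have hbits : ∀ x, Nat.log 2 x.length ≠ 0 → moveBits (w + 1) x ≤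
      32 * ((1 + 2 * (w + 1)) + paramBits (w + 1) (embParam x)) * Nat.log 2 x.length := by
    intro x hl
    -- The part of a move that depends only on the parameter is absorbed into the multiple of the
    -- logarithm, which is at least one here.
    have : paramBits (w + 1) (embParam x) ≤ paramBits (w + 1) (embParam x) * Nat.log 2 x.length :=
      Nat.le_mul_of_pos_right _ (Nat.pos_of_ne_zero hl)
    rw [moveBits, compBits_eq]
    nlinarith
  have hr : ∀ x, (embGame M (w + 1)).rounds x ≤ embParam x + 2 := fun x => by
    dsimp only [embGame]
    split_ifs <;> omega
  refine RoundGame.mem_tree (κ := embP) (G := embGame M (w + 1)) (K := posBound (w + 1))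
    isParameterization_embParam (embGame_isPL hM _) (fun x q _ => ?_) (polyBd_posBound _)
    (fun x => Nat.zero_le _) (fun x q g b => EmbGame.upd_le q g b) (polyBd_posBound _) hf
    (fun x => ?_) (fun x => ?_) (EmbGame.wins_iff hw fun x => Iff.rfl)
  · have := hb1 x
    change 1 ≤ moveBits (w + 1) x
    rw [moveBits]
    omega
  · by_cases hl : Nat.log 2 x.length = 0
    · have : (embGame M (w + 1)).rounds x = 0 := if_pos hl
      rw [this, mul_zero]
      exact Nat.zero_le _
    · rw [mul_comm, mul_assoc]
      exact Nat.mul_le_mul (hr x) (hbits x hl)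
  · refine (hr x).trans (Nat.le_mul_of_pos_right _ ?_)
    omega
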